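/- Let $\mathcal H$ be a finite dimensional complex Hilbert space and $1\le n\le\dim\mathcal H$. Identify the cotangent bundle of the Grassmannian $\mathbf G_n\mathcal H$ of $n$-dimensional subspaces with $$\mathrm T^*\mathbf G_n\mathcal H=\{q\in B\mathcal H:\ q^2=q,\ \operatorname{Tr}q=n\},$$ a complex submanifold of $B\mathcal H$ with tangent spaces $\mathrm T_q=\{A\in B\mathcal H: qA+Aq=A\}$; the base point of $q$ is $q(\mathcal H)$, and the zero section $\mathbf G_n\mathcal H$ is the set of Hermitian projections. Let $I A=iA$ (holomorphic means $I$-holomorphic), $J_qA=i[A,q]$, let $\operatorname{tr}_n=\frac1n\operatorname{Tr}$, and let $\Omega_q(A,B)=i\operatorname{tr}_n(q[A,B])$. Then: (a) $\mathcal E=\{(q,v)\in\mathrm T^*\mathbf G_n\mathcal H\times\mathcal H: qv=v\}\to\mathrm T^*\mathbf G_n\mathcal H$ is a holomorphic vector bundle of rank $n$, and the map $\mathcal E\to\mathcal H$, $(q,v)\mapsto v$, is holomorphic. (b) $P(q_1,q_2):\mathcal E_{q_1}\to\mathcal E_{q_2}$, $P(q_1,q_2)v=q_2v$, is a holomorphic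 section of $\mathcal E^*\boxtimes\mathcal E=\operatorname{Hom}(\pi_0^*\mathcal E,\pi_1^*\mathcal E)$ over $\mathrm T^*\mathbf G_n\mathcal H\times\mathrm T^*\mathbf G_n\mathcal H$, where $\pi_0,\pi_1$ are the two projections, and $P(q,q)$ is the identity for all $q$. (c) $P$ determines a holomorphic connection $\nabla$ on $\mathcal E$: differentiating $q'\mapsto P(q,q')v$ at $q'=q$ gives the horizontal lifts, that is, regarding sections as $\mathcal H$-valued functions, $$(\nabla_A\sigma)(q)=d_q\sigma(A)-d_{q'}\big(P(q,q')\sigma(q)\big)\big|_{q'=q}(A),\qquad A\in \mathrm T_q .$$ With respect to the connection induced by $\nabla$ on $\mathcal E^*\boxtimes\mathcal E$, the section $P$ is polarized along $\mathcal J=(-J,J)$, that is, covariantly constant along the $+i$-eigenbundle of $\mathcal J$: $\nabla_ZP-i\nabla_{\mathcal JZ}P=0$ for all tangent vectors $Z$ of $\mathrm T^*\mathbf G_n\mathcal H\times\mathrm T^*\mathbf G_n\mathcal H$. If $R(X,Y)=\nabla_X\nabla_Y-\nabla_Y\nabla_X-\nabla_{[X,Y]}$, then the curvature form $F=iR$ satisfies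 $\operatorname{tr}_nF=\Omega$. (d) There is a unique Borel measure $\Omega^{\mathrm{top}}$ on $\mathbf G_n\mathcal H$ which in all smooth local coordinates $x_1,\dots,x_{2m}$, $m=n(\dim\mathcal H-n)$, has the density $|\Omega^{\wedge m}(\partial_{x_1},\dots,\partial_{x_{2m}})|$, and its total mass $\mathrm{Vol}$ satisfies $0<\mathrm{Vol}<\infty$. Put $d\nu=\frac{\dim\mathcal H}{n\,\mathrm{Vol}}\,\Omega^{\mathrm{top}}$. Then $P$ is an idempotent of the convolution algebra over the zero section: writing products of kernels from left to right, the integrand is integrable and $$\int_{\mathbf G_n\mathcal H}P(q_1,q)P(q,q_2)\,d\nu(q)=P(q_1,q_2)\qquad\text{for all } q_1,q_2\in\mathrm T^*\mathbf G_n\mathcal H.$$ (e) On the space of global holomorphic sections of $\mathcal E$ the formula $$(\hat P\psi)(q)=\int_{\mathbf G_n\mathcal H}P(q',q)\psi(q')\,d\nu(q')$$ defines (the integrand being integrable) a linear map $\hat P$ into the same space with $\hat P^2=\hat P$. On its image $\mathcal H_P$, $$\langle\psi_1,\psi_2\rangle=\int_{\mathbf G_n\mathcal H}\langle\psi_1(q),\psi_2(q)\rangle\,d\nu(q)$$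 is a (positive definite) inner product, the integrand being integrable, and $\Psi\mapsto(q\mapsto q\Psi)$ is a linear bijection $\mathcal H\to\mathcal H_P$ that preserves inner products; so the Hilbert space $\mathcal H_P$ is unitarily equivalent to $\mathcal H$. -/

import Mathlib

open scoped Manifold ContDiff Bundle Topology

namespace GrassCot

section Ring
variable {R : Type*} [Ring R]

/-- The block-diagonal part, relative to an idempotent `p`, of `q * p + (1 - q) * (1 - p)`. -/
def diagPart (p q : R) : R := p * q * p + (1 - p) * (1 - q) * (1 - p)
def mover (p q : R) : R := q * p + (1 - q) * (1 - p)
/-- For idempotents `p`, `q` close to each other: the unique `1 + A` with `A` block-off-diagonal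
for `p` which conjugates `p` into `q`. -/
noncomputable def normMover (p q : R) : R := mover p q * Ring.inverse (diagPart p q)
/-- The commutator `[A, p]`. -/
def twist (p A : R) : R := A * p - p * A
/-- The conjugate of `p` by `1 + A`. -/
noncomputable def rotate (p A : R) : R := (1 + A) * p * Ring.inverse (1 + A)

variable {p q A : R}

theorem one_sub_sq (hp : p * p = p) : (1 - p) * (1 - p) = 1 - p := by
  rw [mul_sub, sub_mul, sub_mul, hp]; simp

theorem diagPart_comm (hp : p * p = p) : p * diagPart p q = diagPart p q * p := by
  have h2 : p * (1 - p) = 0 := by rw [mul_sub, hp, mul_one, sub_self]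
  have h3 : (1 - p) * p = 0 := by rw [sub_mul, hp, one_mul, sub_self]
  simp only [diagPart, mul_add, add_mul, ← mul_assoc, hp, h2, zero_mul]
  simp only [mul_assoc, hp, h3, mul_zero]

theorem inverse_comm {a b : R} (h : a * b = b * a) (hb : IsUnit b) :
    a * Ring.inverse b = Ring.inverse b * a := by
  obtain ⟨u, rfl⟩ := hb
  rw [Ring.inverse_unit]
  exact (Commute.units_inv_right (show Commute a u from h)).eq

theorem mover_left (hq : q * q = q) : q * mover p q = q * p := by
  have h2 : q * (1 - q) = 0 := by rw [mul_sub, hq, mul_one, sub_self]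
  rw [mover, mul_add, ← mul_assoc, ← mul_assoc, hq, h2, zero_mul, add_zero]

theorem mover_right (hp : p * p = p) : mover p q * p = q * p := by
  have h3 : (1 - p) * p = 0 := by rw [sub_mul, hp, one_mul, sub_self]
  rw [mover, add_mul, mul_assoc, mul_assoc, hp, h3, mul_zero, add_zero]

theorem mul_normMover (hp : p * p = p) (hq : q * q = q) (hD : IsUnit (diagPart p q)) :
    q * normMover p q = normMover p q * p := by
  rw [normMover, ← mul_assoc, mover_left hq, ← mover_right hp, mul_assoc, mul_assoc,
    inverse_comm (diagPart_comm hp) hD]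

theorem proj_mul_mover (hp : p * p = p) : p * mover p q * p = diagPart p q * p := by
  have h3 : (1 - p) * p = 0 := by rw [sub_mul, hp, one_mul, sub_self]
  rw [mul_assoc, mover_right hp, diagPart, add_mul, mul_assoc _ (1 - p) p, h3, mul_zero, add_zero,
    mul_assoc _ p p, hp, mul_assoc]

theorem proj_mul_normMover (hp : p * p = p) (hD : IsUnit (diagPart p q)) :
    p * normMover p q * p = p := by
  rw [normMover, mul_assoc, mul_assoc, ← inverse_comm (diagPart_comm hp) hD, ← mul_assoc,
    ← mul_assoc, proj_mul_mover hp, ← diagPart_comm hp, mul_assoc, Ring.mul_inverse_cancel _ hD,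
    mul_one]

theorem coproj_mul_normMover (hp : p * p = p) (hD : IsUnit (diagPart p q)) :
    (1 - p) * normMover p q * (1 - p) = 1 - p := by
  have hp' : (1 - p) * (1 - p) = 1 - p := one_sub_sq hp
  have e1 : diagPart (1 - p) (1 - q) = diagPart p q := by
    simp only [diagPart, sub_sub_cancel]; abel
  have e2 : mover (1 - p) (1 - q) = mover p q := by
    simp only [mover, sub_sub_cancel]; abel
  have := proj_mul_normMover (p := 1 - p) (q := 1 - q) hp' (by rwa [e1])
  rwa [normMover, e1, e2] at this

/-- tangent condition -/
theorem normMover_tangent (hp : p * p = p) (hD : IsUnit (diagPart p q)) :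
    p * (normMover p q - 1) + (normMover p q - 1) * p = normMover p q - 1 := by
  have h1 := proj_mul_normMover hp hD
  have h2 := coproj_mul_normMover hp hD
  have : (1 - p) * normMover p q * (1 - p) = normMover p q - p * normMover p q
      - normMover p q * p + p * normMover p q * p := by noncomm_ring
  rw [this, h1] at h2
  have h3 : p * normMover p q + normMover p q * p = normMover p q + p - (1 - p) := by
    rw [← h2]; abel
  calc _ = p * normMover p q + normMover p q * p - p - p := by noncomm_ring
    _ = _ := by rw [h3]; abel

theorem tangent_mid (hp : p * p = p) (hA : p * A + A * p = A) : p * A * p = 0 := by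
  have := congrArg (p * ·) hA
  simp only [mul_add, ← mul_assoc, hp] at this
  exact left_eq_add.mp this.symm

theorem twist_tangent (hp : p * p = p) : p * twist p A + twist p A * p = twist p A := by
  simp only [twist, mul_sub, sub_mul]
  rw [← mul_assoc, ← mul_assoc, hp, mul_assoc A p p, hp]; abel

theorem twist_twist (hp : p * p = p) (hA : p * A + A * p = A) : twist p (twist p A) = A := by
  have h := tangent_mid hp hA
  simp only [twist, mul_sub, sub_mul]
  rw [← mul_assoc p p, hp, mul_assoc A p p, hp, ← mul_assoc, h]
  nth_rewrite 3 [← hA]; abel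

theorem rotate_normMover (hp : p * p = p) (hq : q * q = q) (hD : IsUnit (diagPart p q))
    (hg : IsUnit (mover p q)) : rotate p (normMover p q - 1) = q := by
  have hU : IsUnit (normMover p q) := hg.mul hD.ringInverse
  rw [rotate, add_sub_cancel, ← mul_normMover hp hq hD, mul_assoc,
    Ring.mul_inverse_cancel _ hU, mul_one]

theorem rotate_sq (hp : p * p = p) (hU : IsUnit (1 + A)) :
    rotate p A * rotate p A = rotate p A := by
  have : rotate p A * rotate p A =
      (1 + A) * (p * ((Ring.inverse (1 + A) * (1 + A)) * p)) * Ring.inverse (1 + A) := by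
    simp only [rotate, mul_assoc]
  rw [this, Ring.inverse_mul_cancel _ hU, one_mul, hp, rotate]

theorem unit_neg (hp : p * p = p) (hA : p * A + A * p = A) (hU : IsUnit (1 + A)) :
    IsUnit (1 - A) := by
  have hs : (2 * p - 1) * (2 * p - 1) = 1 := by
    calc _ = 4 * (p * p) - 4 * p + 1 := by noncomm_ring
      _ = _ := by rw [hp]; abel
  have hsu : IsUnit (2 * p - 1) := ⟨⟨_, _, hs, hs⟩, rfl⟩
  have h := tangent_mid hp hA
  have : 1 - A = (2 * p - 1) * (1 + A) * (2 * p - 1) := by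
    calc 1 - A = 1 + A - 2 * A := by noncomm_ring
      _ = (2 * p - 1) * (2 * p - 1) + A - 2 * (p * A + A * p) + 4 * (p * A * p) := by
        rw [hs, hA, h]; noncomm_ring
      _ = _ := by noncomm_ring
  rw [this]
  exact (hsu.mul hU).mul hsu

theorem rotate_data (hp : p * p = p) (hA : p * A + A * p = A) (hU : IsUnit (1 + A)) :
    IsUnit (diagPart p (rotate p A)) ∧ IsUnit (mover p (rotate p A)) ∧
      normMover p (rotate p A) = 1 + A := by
  have hW := unit_neg hp hA hU
  have h := tangent_mid hp hA
  have h' : (1 - p) * A * (1 - p) = 0 := by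
    calc _ = A - (p * A + A * p) + p * A * p := by noncomm_ring
      _ = 0 := by rw [hA, h]; abel
  have hp' : (1 - p) * (1 - p) = 1 - p := one_sub_sq hp
  have hpz : p * (1 - p) = 0 := by rw [mul_sub, hp, mul_one, sub_self]
  set N := (1 + A) * (1 - A) with hN
  have hNu : IsUnit N := hU.mul hW
  have hiN : Ring.inverse (1 + A) * N = 1 - A := by
    rw [hN, ← mul_assoc, Ring.inverse_mul_cancel _ hU, one_mul]
  have hpN : p * N = N * p := by
    have hAp : A * p = A - p * A := by rw [← hA]; abel_nf; rw [hA]; abel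
    have : p * (A * A) = A * A * p := by
      have e1 : A * A * p = A * A - A * (p * A) := by rw [mul_assoc, hAp, mul_sub]
      have e2 : A * (p * A) = A * A - p * (A * A) := by rw [← mul_assoc, hAp, sub_mul, mul_assoc]
      rw [e1, e2]; abel
    calc p * N = p - p * (A * A) := by rw [hN]; noncomm_ring
      _ = N * p := by rw [this, hN]; noncomm_ring
  have h1 : rotate p A * p * N = (1 + A) * p := by
    rw [mul_assoc, hpN, rotate, mul_assoc, ← mul_assoc _ N p, hiN]
    calc _ = (1 + A) * (p * p - p * A * p) := by noncomm_ring
      _ = _ := by rw [hp, h, sub_zero]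
  have hc : 1 - rotate p A = (1 + A) * (1 - p) * Ring.inverse (1 + A) := by
    rw [mul_sub, sub_mul, mul_one, Ring.mul_inverse_cancel _ hU, rotate]
  have h2 : (1 - rotate p A) * (1 - p) * N = (1 + A) * (1 - p) := by
    have : (1 - p) * N = N * (1 - p) := by rw [sub_mul, mul_sub, hpN]; simp
    rw [mul_assoc, this, hc, mul_assoc, ← mul_assoc _ N, hiN]
    calc _ = (1 + A) * ((1 - p) * (1 - p) - (1 - p) * A * (1 - p)) := by noncomm_ring
      _ = _ := by rw [hp', h', sub_zero]
  have hgN : mover p (rotate p A) * N = 1 + A := by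
    rw [mover, add_mul, h1, h2, ← mul_add]; simp
  have hDN : diagPart p (rotate p A) * N = 1 := by
    have : diagPart p (rotate p A) * N =
        p * (rotate p A * p * N) + (1 - p) * ((1 - rotate p A) * (1 - p) * N) := by
      simp only [diagPart, add_mul, mul_assoc]
    rw [this, h1, h2]
    calc _ = p * p + p * A * p + ((1 - p) * (1 - p) + (1 - p) * A * (1 - p)) := by noncomm_ring
      _ = 1 := by rw [hp, h, hp', h']; abel
  have hD : diagPart p (rotate p A) = Ring.inverse N := by
    rw [← mul_one (diagPart _ _), ← Ring.mul_inverse_cancel _ hNu, ← mul_assoc, hDN, one_mul]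
  have hg : mover p (rotate p A) = (1 + A) * Ring.inverse N := by
    rw [← hgN, mul_assoc, Ring.mul_inverse_cancel _ hNu, mul_one]
  refine ⟨hD ▸ hNu.ringInverse, hg ▸ hU.mul hNu.ringInverse, ?_⟩
  obtain ⟨u, hu⟩ := hNu
  rw [normMover, hD, hg, ← hu, Ring.inverse_unit, Ring.inverse_unit, inv_inv, mul_assoc]
  simp
end Ring

noncomputable section

section Spaces

variable (H : Type*) [NormedAddCommGroup H] [InnerProductSpace ℂ H] (n : ℕ)

/-- The cotangent bundle `T*G_n H` of the Grassmannian of `n`-planes of `H`, identified with the set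
of all (not necessarily orthogonal) rank-`n` projections of `H`: the projection `q` corresponds to
the covector `q|_{Vᗮ} ∈ Hom(Vᗮ, V)` at the point `V = range q`. -/
@[ext]
structure CotGr where
  op : H →L[ℂ] H
  idem : op * op = op
  trace_op : LinearMap.trace ℂ H (op : H →ₗ[ℂ] H) = n

instance : TopologicalSpace (CotGr H n) := TopologicalSpace.induced CotGr.op inferInstance

/-- Model space of the complex manifold `T*G_n H`. -/
abbrev Model : Type := EuclideanSpace ℂ (Fin (2 * (n * (Module.finrank ℂ H - n))))

/-- Model fibre of the tautological bundle. -/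
abbrev FibModel : Type := EuclideanSpace ℂ (Fin n)

variable {H n}

theorem isEmbedding_op : Topology.IsEmbedding (CotGr.op : CotGr H n → H →L[ℂ] H) :=
  ⟨⟨rfl⟩, fun _ _ h => CotGr.ext h⟩


/-- The tangent space of `T*G_n H` at `q`, as a complex subspace `{A | qA + Aq = A}` of `B(H)`. -/
def tangentSubmodule (q : H →L[ℂ] H) : Submodule ℂ (H →L[ℂ] H) where
  carrier := {A | q * A + A * q = A}
  zero_mem' := by simp
  add_mem' {A B} hA hB := by
    simp only [Set.mem_ofPred_eq] at *
    nth_rewrite 3 [← hA]; nth_rewrite 3 [← hB]; noncomm_ring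
  smul_mem' c A hA := by
    simp only [Set.mem_ofPred_eq] at *
    rw [mul_smul_comm, smul_mul_assoc, ← smul_add, hA]

/-- The fibre `{v | q v = v}`. -/
def fib (q : H →L[ℂ] H) : Submodule ℂ H where
  carrier := {v | q v = v}
  zero_mem' := by simp
  add_mem' {v w} hv hw := by simp_all
  smul_mem' c v hv := by simp_all

/-- The complexified tautological bundle `E = {(q, v) | q v = v}`, as a family of fibres. -/
abbrev Taut (q : CotGr H n) : Type _ := fib q.op

/-- The projection `q`, as a map onto the fibre over `q`. -/
def toFib (q : CotGr H n) : H →L[ℂ] Taut q :=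
  q.op.codRestrict (fib q.op) fun v => congrArg (fun f : H →L[ℂ] H => f v) q.idem

/-- The projection of `B(H)` onto the tangent space at `q`. -/
def tangentProj (q : CotGr H n) : (H →L[ℂ] H) →L[ℂ] tangentSubmodule q.op :=
  ContinuousLinearMap.codRestrict
    (ContinuousLinearMap.mulLeftRight ℂ (H →L[ℂ] H) q.op (1 - q.op) +
      ContinuousLinearMap.mulLeftRight ℂ (H →L[ℂ] H) (1 - q.op) q.op) _ fun A => by
    have h := q.idem
    have h2 : q.op * (1 - q.op) = 0 := by rw [mul_sub, h, mul_one, sub_self]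
    have h3 : (1 - q.op) * q.op = 0 := by rw [sub_mul, h, one_mul, sub_self]
    change q.op * (q.op * A * (1 - q.op) + (1 - q.op) * A * q.op) +
      (q.op * A * (1 - q.op) + (1 - q.op) * A * q.op) * q.op =
      q.op * A * (1 - q.op) + (1 - q.op) * A * q.op
    simp only [mul_add, add_mul, ← mul_assoc, h, h2, zero_mul, add_zero]
    simp only [mul_assoc, h, h3, mul_zero, zero_add]

theorem tangentProj_apply (q : CotGr H n) {A : H →L[ℂ] H} (hA : A ∈ tangentSubmodule q.op) :
    (tangentProj q A : H →L[ℂ] H) = A := by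
  have h := tangent_mid q.idem hA
  change q.op * A * (1 - q.op) + (1 - q.op) * A * q.op = A
  calc _ = q.op * A + A * q.op - q.op * A * q.op - q.op * A * q.op := by noncomm_ring
    _ = A := by rw [h, sub_zero, sub_zero]; exact hA

theorem twist_normMover (p : CotGr H n) (q : H →L[ℂ] H) :
    (tangentProj p (twist p.op (normMover p.op q)) : H →L[ℂ] H) =
      twist p.op (normMover p.op q - 1) := by
  rw [tangentProj_apply p (twist_tangent p.idem)]
  simp only [twist, sub_mul, mul_sub, one_mul, mul_one]; abel

instance : TopologicalSpace (Bundle.TotalSpace (FibModel n) (Taut : CotGr H n → Type _)) :=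
  TopologicalSpace.induced (fun x => (x.proj, (x.snd : H))) inferInstance

theorem isInducing_total : Topology.IsInducing
    (fun x : Bundle.TotalSpace (FibModel n) (Taut : CotGr H n → Type _) =>
      (x.proj, (x.snd : H))) := ⟨rfl⟩

theorem op_fib (q : CotGr H n) (v : Taut q) : q.op v.1 = v.1 := v.2

variable [FiniteDimensional ℂ H]

theorem finrank_fib (q : CotGr H n) : Module.finrank ℂ (Taut q) = n := by
  have h : LinearMap.IsProj (fib q.op) (q.op : H →ₗ[ℂ] H) :=
    ⟨fun v => (toFib q v).2, fun v hv => hv⟩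
  have := h.trace
  rw [q.trace_op] at this
  exact_mod_cast this.symm

theorem finrank_coker (q : CotGr H n) :
    Module.finrank ℂ (LinearMap.ker (q.op : H →ₗ[ℂ] H)) = Module.finrank ℂ H - n := by
  have h := LinearMap.finrank_range_add_finrank_ker (q.op : H →ₗ[ℂ] H)
  have : LinearMap.range (q.op : H →ₗ[ℂ] H) = fib q.op := by
    ext v
    exact ⟨fun ⟨w, hw⟩ => hw ▸ (toFib q w).2, fun hv => ⟨v, hv⟩⟩
  rw [this, finrank_fib q] at h
  omega

/-- Tangent vectors at `q` are pairs of maps `range q → ker q`, `ker q → range q`. -/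
def tangentLinearEquiv (q : CotGr H n) : tangentSubmodule q.op ≃ₗ[ℂ]
    (Taut q →ₗ[ℂ] LinearMap.ker (q.op : H →ₗ[ℂ] H)) ×
      (LinearMap.ker (q.op : H →ₗ[ℂ] H) →ₗ[ℂ] Taut q) :=
  have hqq : ∀ v, q.op (q.op v) = q.op v := fun v => (toFib q v).2
  { toFun := fun A =>
      (LinearMap.codRestrict _ ((A.1 : H →ₗ[ℂ] H) ∘ₗ (fib q.op).subtype) fun v => by
        have h2 := congrArg (fun f : H →L[ℂ] H => f v.1) (tangent_mid q.idem A.2)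
        have hv : q.op v.1 = v.1 := v.2
        simpa [hv] using h2,
       LinearMap.codRestrict _ ((A.1 : H →ₗ[ℂ] H) ∘ₗ (LinearMap.ker (q.op : H →ₗ[ℂ] H)).subtype)
        fun v => by
        have hv : q.op v.1 = 0 := v.2
        have h2 := congrArg (fun f : H →L[ℂ] H => f v.1) A.2
        exact (by simpa [hv] using h2 : q.op (A.1 v.1) = A.1 v.1))
    invFun := fun f => ⟨LinearMap.toContinuousLinearMap
      ((LinearMap.ker (q.op : H →ₗ[ℂ] H)).subtype ∘ₗ f.1 ∘ₗ (toFib q : H →ₗ[ℂ] Taut q) +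
        (fib q.op).subtype ∘ₗ f.2 ∘ₗ LinearMap.codRestrict (LinearMap.ker (q.op : H →ₗ[ℂ] H))
          (LinearMap.id - (q.op : H →ₗ[ℂ] H)) fun v => by simp [hqq]), by
        ext v
        have e1 : toFib q (q.op v) = toFib q v := Subtype.ext (hqq v)
        have e2 : ∀ h, (⟨q.op v - q.op (q.op v), h⟩ : LinearMap.ker (q.op : H →ₗ[ℂ] H)) = 0 :=
          fun h => Subtype.ext (by simp [hqq])
        have e3 : ∀ w : Taut q, q.op w.1 = w.1 := fun w => w.2
        have e4 : ∀ w : LinearMap.ker (q.op : H →ₗ[ℂ] H), q.op w.1 = 0 := fun w => w.2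
        simp [LinearMap.codRestrict, e1, e2, e3, e4, add_comm]⟩
    map_add' := fun A B => by ext <;> rfl
    map_smul' := fun c A => by ext <;> rfl
    left_inv := fun A => by
      ext v
      change A.1 (q.op v) + A.1 (v - q.op v) = A.1 v
      rw [← map_add, add_sub_cancel]
    right_inv := fun f => by
      refine Prod.ext (LinearMap.ext fun v => Subtype.ext ?_) (LinearMap.ext fun v => Subtype.ext ?_)
      · have e1 : toFib q v.1 = v := Subtype.ext v.2
        have e2 : ∀ h, (⟨v.1 - q.op v.1, h⟩ : LinearMap.ker (q.op : H →ₗ[ℂ] H)) = 0 :=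
          fun h => Subtype.ext (sub_eq_zero.2 v.2.symm)
        simp [LinearMap.codRestrict, e1, e2]
      · have e0 : q.op v.1 = 0 := v.2
        have e1 : toFib q v.1 = 0 := Subtype.ext e0
        simp [LinearMap.codRestrict, e1] }

theorem finrank_tangent (q : CotGr H n) : Module.finrank ℂ (tangentSubmodule q.op) =
    Module.finrank ℂ (Model H n) := by
  rw [(tangentLinearEquiv q).finrank_eq, Module.finrank_prod, Module.finrank_linearMap,
    Module.finrank_linearMap, finrank_fib, finrank_coker, finrank_euclideanSpace_fin]
  ring

/-- A linear identification of the model space with the tangent space at `q`. -/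
def tangentVec (q : CotGr H n) : Model H n ≃L[ℂ] tangentSubmodule q.op :=
  (ContinuousLinearEquiv.ofFinrankEq (finrank_tangent q)).symm

/-- A linear identification of the fibre at `q` with the model fibre. -/
def fibEquiv (q : CotGr H n) : Taut q ≃L[ℂ] FibModel n :=
  ContinuousLinearEquiv.ofFinrankEq (by rw [finrank_fib, finrank_euclideanSpace_fin])

def chartFun (p : CotGr H n) (q : H →L[ℂ] H) : Model H n :=
  (tangentVec p).symm (tangentProj p (twist p.op (normMover p.op q)))

def chartInv (p : CotGr H n) (m : Model H n) : H →L[ℂ] H :=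
  rotate p.op (twist p.op (tangentVec p m : H →L[ℂ] H))

theorem chartInv_mem (p : CotGr H n) {m : Model H n}
    (hm : IsUnit (1 + twist p.op (tangentVec p m : H →L[ℂ] H))) :
    chartInv p m * chartInv p m = chartInv p m ∧
      LinearMap.trace ℂ H (chartInv p m : H →ₗ[ℂ] H) = n := by
  refine ⟨rotate_sq p.idem hm, ?_⟩
  have ht := p.trace_op
  rw [chartInv, rotate]
  change LinearMap.trace ℂ H ((((1 + twist p.op (tangentVec p m : H →L[ℂ] H)) * p.op :
    H →L[ℂ] H) : H →ₗ[ℂ] H) * (Ring.inverse (1 + twist p.op (tangentVec p m : H →L[ℂ] H)) :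
    H →L[ℂ] H)) = n
  rw [LinearMap.trace_mul_comm, ← ContinuousLinearMap.toLinearMap_mul, ← mul_assoc,
    Ring.inverse_mul_cancel _ hm, one_mul, ht]

theorem contDiff_diagPart (p : H →L[ℂ] H) :
    ContDiff ℂ ω (fun q : H →L[ℂ] H => diagPart p q) := by
  unfold diagPart; fun_prop

theorem contDiff_mover (p : H →L[ℂ] H) :
    ContDiff ℂ ω (fun q : H →L[ℂ] H => mover p q) := by
  unfold mover; fun_prop

theorem contDiffAt_inverse {E : Type*} [NormedAddCommGroup E] [NormedSpace ℂ E]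
    {f : E → H →L[ℂ] H} {x : E} (hf : ContDiffAt ℂ ω f x) (hx : IsUnit (f x)) :
    ContDiffAt ℂ ω (fun y => Ring.inverse (f y)) x := by
  have := FiniteDimensional.complete ℂ H
  obtain ⟨u, hu⟩ := hx
  exact ContDiffAt.comp x (hu ▸ contDiffAt_ringInverse ℂ u) hf

theorem contDiffAt_normMover (p : H →L[ℂ] H) {q : H →L[ℂ] H} (hq : IsUnit (diagPart p q)) :
    ContDiffAt ℂ ω (fun q : H →L[ℂ] H => normMover p q) q :=
  (contDiff_mover p).contDiffAt.mul (contDiffAt_inverse (contDiff_diagPart p).contDiffAt hq)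

theorem contDiffAt_chartFun (p : CotGr H n) {q : H →L[ℂ] H} (hq : IsUnit (diagPart p.op q)) :
    ContDiffAt ℂ ω (chartFun p) q := by
  have h := contDiffAt_normMover p.op hq
  have : ContDiffAt ℂ ω (fun q => twist p.op (normMover p.op q)) q :=
    (h.mul contDiffAt_const).sub (contDiffAt_const.mul h)
  have h2 : ContDiff ℂ ω fun A : H →L[ℂ] H => (tangentVec p).symm (tangentProj p A) := by fun_prop
  exact h2.contDiffAt.comp q this

theorem contDiff_tangentTwist (p : CotGr H n) :
    ContDiff ℂ ω (fun m : Model H n => twist p.op (tangentVec p m : H →L[ℂ] H)) := by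
  have : ContDiff ℂ ω (fun m : Model H n => (tangentVec p m : H →L[ℂ] H)) :=
    ((tangentSubmodule p.op).subtypeL ∘L (tangentVec p : Model H n →L[ℂ] _)).contDiff
  exact (this.mul contDiff_const).sub (contDiff_const.mul this)

theorem contDiffAt_chartInv (p : CotGr H n) {m : Model H n}
    (hm : IsUnit (1 + twist p.op (tangentVec p m : H →L[ℂ] H))) :
    ContDiffAt ℂ ω (chartInv p) m := by
  have h : ContDiffAt ℂ ω
      (fun m : Model H n => 1 + twist p.op (tangentVec p m : H →L[ℂ] H)) m :=
    contDiffAt_const.add (contDiff_tangentTwist p).contDiffAt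
  exact (h.mul contDiffAt_const).mul (contDiffAt_inverse h hm)

theorem isOpen_unit_preimage {X : Type*} [TopologicalSpace X] {f : X → H →L[ℂ] H}
    (hf : Continuous f) : IsOpen {x | IsUnit (f x)} := by
  have := FiniteDimensional.complete ℂ H
  exact Units.isOpen.preimage hf

open Classical in
def chartInvPt (p : CotGr H n) (m : Model H n) : CotGr H n :=
  if hm : IsUnit (1 + twist p.op (tangentVec p m : H →L[ℂ] H)) then
    ⟨chartInv p m, (chartInv_mem p hm).1, (chartInv_mem p hm).2⟩ else p

theorem chartInvPt_op (p : CotGr H n) {m : Model H n}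
    (hm : IsUnit (1 + twist p.op (tangentVec p m : H →L[ℂ] H))) :
    (chartInvPt p m).op = chartInv p m := by
  rw [chartInvPt, dif_pos hm]

theorem twist_chartFun (p q : CotGr H n) (hq : IsUnit (diagPart p.op q.op)) :
    twist p.op (tangentVec p (chartFun p q.op) : H →L[ℂ] H) = normMover p.op q.op - 1 := by
  rw [chartFun, ContinuousLinearEquiv.apply_symm_apply, twist_normMover,
    twist_twist p.idem (normMover_tangent p.idem hq)]

/-- The holomorphic chart of `T*G_n H` centred at `p`; its inverse sends `A`, tangent at `p`, to the
conjugate of `p` by `1 + [A, p]`. -/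
def chart (p : CotGr H n) : OpenPartialHomeomorph (CotGr H n) (Model H n) where
  toFun q := chartFun p q.op
  invFun m := chartInvPt p m
  source := {q | IsUnit (diagPart p.op q.op) ∧ IsUnit (mover p.op q.op)}
  target := {m | IsUnit (1 + twist p.op (tangentVec p m : H →L[ℂ] H))}
  map_source' q hq := by
    change IsUnit (1 + twist p.op (tangentVec p (chartFun p q.op) : H →L[ℂ] H))
    rw [twist_chartFun p q hq.1, add_sub_cancel]
    exact hq.2.mul hq.1.ringInverse
  map_target' m hm := by
    have hd := rotate_data p.idem (twist_tangent p.idem) hm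
    change IsUnit (diagPart p.op (chartInvPt p m).op) ∧ IsUnit (mover p.op (chartInvPt p m).op)
    rw [chartInvPt_op p hm]
    exact ⟨hd.1, hd.2.1⟩
  left_inv' q hq := by
    have hu : IsUnit (1 + twist p.op (tangentVec p (chartFun p q.op) : H →L[ℂ] H)) := by
      rw [twist_chartFun p q hq.1, add_sub_cancel]; exact hq.2.mul hq.1.ringInverse
    apply CotGr.ext
    rw [chartInvPt_op p hu, chartInv, twist_chartFun p q hq.1,
      rotate_normMover p.idem q.idem hq.1 hq.2]
  right_inv' m hm := by
    have hd := rotate_data p.idem (twist_tangent p.idem) hm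
    rw [chartInvPt_op p hm, chartFun, ContinuousLinearEquiv.symm_apply_eq]
    apply Subtype.ext
    rw [twist_normMover, chartInv, hd.2.2, add_sub_cancel_left,
      twist_twist p.idem (tangentVec p m).2]
  open_source := (isOpen_unit_preimage
      ((contDiff_diagPart p.op).continuous.comp isEmbedding_op.continuous)).inter
    (isOpen_unit_preimage ((contDiff_mover p.op).continuous.comp isEmbedding_op.continuous))
  open_target := isOpen_unit_preimage
    (continuous_const.add (contDiff_tangentTwist p).continuous)
  continuousOn_toFun q hq := ((contDiffAt_chartFun p hq.1).continuousAt.comp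
    isEmbedding_op.continuous.continuousAt).continuousWithinAt
  continuousOn_invFun := by
    rw [isEmbedding_op.isInducing.continuousOn_iff]
    exact ContinuousOn.congr (f := chartInv p)
      (fun m hm => (contDiffAt_chartInv p hm).continuousAt.continuousWithinAt)
      fun m hm => chartInvPt_op p hm

theorem chart_symm_op (p : CotGr H n) {m : Model H n} (hm : m ∈ (chart p).target) :
    ((chart p).symm m).op = chartInv p m := chartInvPt_op p hm

theorem mem_chart_source (p : CotGr H n) : p ∈ (chart p).source := by
  have h : 1 - p.op = (1 - p.op) * (1 - p.op) := (one_sub_sq p.idem).symm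
  have h1 : diagPart p.op p.op = 1 := by
    rw [diagPart, p.idem, p.idem, ← h, ← h]; abel
  have h2 : mover p.op p.op = 1 := by rw [mover, p.idem, ← h]; abel
  change IsUnit _ ∧ IsUnit _
  rw [h1, h2]
  exact ⟨isUnit_one, isUnit_one⟩

instance : ChartedSpace (Model H n) (CotGr H n) where
  atlas := Set.range chart
  chartAt := chart
  mem_chart_source := mem_chart_source
  chart_mem_atlas p := ⟨p, rfl⟩

instance : IsManifold 𝓘(ℂ, Model H n) ω (CotGr H n) :=
  isManifold_of_contDiffOn _ _ _ fun e e' he he' => by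
    obtain ⟨p, rfl⟩ := he
    obtain ⟨p', rfl⟩ := he'
    intro m hm
    have hm' : m ∈ (chart p).target ∧ (chart p).symm m ∈ (chart p').source := by simpa using hm
    refine ContDiffWithinAt.congr_of_mem (f := chartFun p' ∘ chartInv p) ?_ ?_ hm
    · refine (ContDiffAt.comp m ?_ (contDiffAt_chartInv p hm'.1)).contDiffWithinAt
      rw [← chart_symm_op p hm'.1]
      exact contDiffAt_chartFun p' hm'.2.1
    · intro y hy
      have hy' : y ∈ (chart p).target ∧ (chart p).symm y ∈ (chart p').source := by simpa using hy
      have := chart_symm_op p hy'.1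
      change chartFun p' ((chart p).symm y).1 = _
      rw [this]; rfl

theorem normMover_fib (p q : CotGr H n) (hD : IsUnit (diagPart p.op q.op)) (v : Taut p) :
    (toFib q (normMover p.op q.op v) : H) = normMover p.op q.op v := by
  change (q.op * normMover p.op q.op) v.1 = _
  rw [mul_normMover p.idem q.idem hD, mul_apply_eq_comp, op_fib]

theorem toFib_normMover (p q : CotGr H n) (hD : IsUnit (diagPart p.op q.op)) (v : Taut p) :
    toFib p (toFib q (normMover p.op q.op v) : H) = v := by
  apply Subtype.ext
  rw [normMover_fib p q hD]
  have := congrArg (fun f : H →L[ℂ] H => f v.1) (proj_mul_normMover p.idem hD)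
  have h2 := op_fib p v
  change p.op (normMover p.op q.op v.1) = v.1
  simpa [h2] using this

theorem toFib_injective (p q : CotGr H n) (hD : IsUnit (diagPart p.op q.op)) :
    Function.Injective fun v : Taut q => toFib p (v : H) := by
  have key : ∀ v : H, q.op v = v → p.op v = 0 → v = 0 := by
    intro v hv h0
    have h1 : diagPart p.op q.op v = 0 := by
      simp [diagPart, h0, hv]
    obtain ⟨u, hu⟩ := hD
    rw [← hu] at h1
    have := congrArg (fun w => (u⁻¹ : (H →L[ℂ] H)ˣ).1 w) h1
    simpa [← mul_apply_eq_comp] using this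
  intro v w hvw
  have h := congrArg Subtype.val hvw
  change p.op v.1 = p.op w.1 at h
  apply Subtype.ext
  apply sub_eq_zero.1
  exact key _ (by rw [map_sub, op_fib, op_fib]) (by rw [map_sub, h, sub_self])

def trivBase (p : CotGr H n) : Set (CotGr H n) := {q | IsUnit (diagPart p.op q.op)}

theorem isOpen_trivBase (p : CotGr H n) : IsOpen (trivBase p) :=
  isOpen_unit_preimage ((contDiff_diagPart p.op).continuous.comp isEmbedding_op.continuous)

theorem continuous_proj : Continuous
    (Bundle.TotalSpace.proj : Bundle.TotalSpace (FibModel n) (Taut : CotGr H n → Type _) → _) :=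
  continuous_fst.comp isInducing_total.continuous

def trivFun (p : CotGr H n) (x : Bundle.TotalSpace (FibModel n) (Taut : CotGr H n → Type _)) :
    CotGr H n × FibModel n := (x.proj, fibEquiv p (toFib p (x.snd : H)))

def trivInv (p : CotGr H n) (y : CotGr H n × FibModel n) :
    Bundle.TotalSpace (FibModel n) (Taut : CotGr H n → Type _) :=
  ⟨y.1, toFib y.1 (normMover p.op y.1.op ((fibEquiv p).symm y.2))⟩

theorem continuous_trivFun (p : CotGr H n) : Continuous (trivFun p) := by
  have h2 : Continuous fun x : Bundle.TotalSpace (FibModel n) (Taut : CotGr H n → Type _) =>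
      (x.snd : H) := continuous_snd.comp isInducing_total.continuous
  have h3 : Continuous fun v : H => fibEquiv p (toFib p v) :=
    (fibEquiv p).continuous.comp (toFib p).continuous
  exact continuous_proj.prodMk (h3.comp h2)

theorem continuousOn_trivInv (p : CotGr H n) :
    ContinuousOn (trivInv p) (trivBase p ×ˢ Set.univ) := by
  rw [isInducing_total.continuousOn_iff]
  intro y hy
  have hy1 : IsUnit (diagPart p.op y.1.op) := (Set.mem_prod.1 hy).1
  have h0 : Continuous fun y : CotGr H n × FibModel n => y.1.op :=
    isEmbedding_op.continuous.comp continuous_fst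
  have h1 : ContinuousAt (fun y : CotGr H n × FibModel n => normMover p.op y.1.op) y :=
    (contDiffAt_normMover p.op hy1).continuousAt.comp_of_eq h0.continuousAt rfl
  have h3 : Continuous (fun y : CotGr H n × FibModel n => ((fibEquiv p).symm y.2 : H)) :=
    continuous_subtype_val.comp ((fibEquiv p).symm.continuous.comp continuous_snd)
  have h4 : ContinuousAt (fun y : CotGr H n × FibModel n =>
      y.1.op (normMover p.op y.1.op ((fibEquiv p).symm y.2 : H))) y :=
    h0.continuousAt.clm_apply (h1.clm_apply h3.continuousAt)
  exact (continuous_fst.continuousAt.prodMk h4).continuousWithinAt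

theorem trivInv_trivFun (p : CotGr H n)
    (x : Bundle.TotalSpace (FibModel n) (Taut : CotGr H n → Type _)) (hx : x.proj ∈ trivBase p) :
    trivInv p (trivFun p x) = x := by
  obtain ⟨q, v⟩ := x
  simp only [trivInv, trivFun, ContinuousLinearEquiv.symm_apply_apply]
  congr 1
  exact toFib_injective p q hx (toFib_normMover p q hx _)

theorem trivFun_trivInv (p : CotGr H n) (y : CotGr H n × FibModel n) (hy : y.1 ∈ trivBase p) :
    trivFun p (trivInv p y) = y := by
  obtain ⟨q, w⟩ := y
  simp only [trivInv, trivFun]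
  rw [toFib_normMover p q hy, ContinuousLinearEquiv.apply_symm_apply]

/-- The local trivialization `(q, v) ↦ (q, p v)` of the tautological bundle near `p`. -/
def triv (p : CotGr H n) : Bundle.Trivialization (FibModel n)
    (Bundle.TotalSpace.proj : Bundle.TotalSpace (FibModel n) (Taut : CotGr H n → Type _) → _) where
  toFun := trivFun p
  invFun := trivInv p
  source := Bundle.TotalSpace.proj ⁻¹' trivBase p
  target := trivBase p ×ˢ Set.univ
  baseSet := trivBase p
  map_source' _ hx := Set.mk_mem_prod hx (Set.mem_univ _)
  map_target' _ hy := (Set.mem_prod.1 hy).1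
  left_inv' x hx := trivInv_trivFun p x hx
  right_inv' y hy := trivFun_trivInv p y (Set.mem_prod.1 hy).1
  open_source := (isOpen_trivBase p).preimage continuous_proj
  open_target := (isOpen_trivBase p).prod isOpen_univ
  continuousOn_toFun := (continuous_trivFun p).continuousOn
  continuousOn_invFun := continuousOn_trivInv p
  open_baseSet := isOpen_trivBase p
  source_eq := rfl
  target_eq := rfl
  proj_toFun _ _ := rfl

instance : FiberBundle (FibModel n) (Taut : CotGr H n → Type _) where
  totalSpaceMk_isInducing' q := by
    refine Topology.IsInducing.of_comp_iff isInducing_total |>.1 ?_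
    refine ⟨?_⟩
    change TopologicalSpace.induced _ _ = TopologicalSpace.induced
      (fun v : Taut q => (q, (v : H))) _
    rw [instTopologicalSpaceProd, induced_inf, induced_compose, induced_compose]
    simp only [Function.comp_def, induced_const, top_inf_eq]
  trivializationAtlas' := Set.range triv
  trivializationAt' := triv
  mem_baseSet_trivializationAt' q := (mem_chart_source q).1
  trivialization_mem_atlas' q := ⟨q, rfl⟩

instance (p : CotGr H n) : (triv p).IsLinear ℂ :=
  ⟨fun q _ => ⟨fun v w => by
    change fibEquiv p (toFib p ((v + w : Taut q) : H)) = _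
    rw [Submodule.coe_add, map_add, map_add]; rfl, fun c v => by
    change fibEquiv p (toFib p ((c • v : Taut q) : H)) = _
    rw [Submodule.coe_smul, map_smul, map_smul]; rfl⟩⟩

instance : VectorBundle ℂ (FibModel n) (Taut : CotGr H n → Type _) where
  trivialization_linear' e he := by
    obtain ⟨p, rfl⟩ := he.out
    infer_instance
  continuousOn_coordChange' e e' he he' := by
    obtain ⟨p, rfl⟩ := he.out
    obtain ⟨p', rfl⟩ := he'.out
    intro q hq
    have h1 : ContinuousWithinAt (fun q : CotGr H n => normMover p.op q.op)
        ((triv p).baseSet ∩ (triv p').baseSet) q :=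
      ((contDiffAt_normMover p.op hq.1).continuousAt.comp
        isEmbedding_op.continuous.continuousAt).continuousWithinAt
    have h2 : ContinuousWithinAt (fun q : CotGr H n =>
        ((fibEquiv p' : Taut p' →L[ℂ] FibModel n) ∘L toFib p') ∘L normMover p.op q.op ∘L
          ((fib p.op).subtypeL ∘L ((fibEquiv p).symm : FibModel n →L[ℂ] Taut p)))
        ((triv p).baseSet ∩ (triv p').baseSet) q :=
      continuousWithinAt_const.clm_comp (h1.clm_comp continuousWithinAt_const)
    refine h2.congr_of_mem (fun b hb => ?_) hq
    ext1 w
    rw [ContinuousLinearEquiv.coe_coe, Bundle.Trivialization.coordChangeL_apply' _ _ hb]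
    change fibEquiv p' (toFib p' (toFib b (normMover p.op b.op ((fibEquiv p).symm w)) : H)) = _
    rw [normMover_fib p b hb.1]
    rfl

/-- The identification of the (abstract) tangent space at `q` with `{A | qA + Aq = A}`; by
`hasMFDerivAt_op` it is the derivative of the inclusion of `T*G_n H` into `B(H)`. The complex
structure `I` is multiplication by `i` on either side. -/
def tangentAt (q : CotGr H n) :
    TangentSpace 𝓘(ℂ, Model H n) q ≃L[ℂ] tangentSubmodule q.op := tangentVec q

theorem chart_self (q : CotGr H n) : chart q q = 0 := by
  have h : (1 - q.op) * (1 - q.op) = 1 - q.op := one_sub_sq q.idem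
  have h1 : diagPart q.op q.op = 1 := by
    rw [diagPart, q.idem, q.idem, h, h]; abel
  have h2 : mover q.op q.op = 1 := by rw [mover, q.idem, h]; abel
  have h3 : twist q.op (normMover q.op q.op) = 0 := by
    rw [normMover, h1, h2, Ring.inverse_one, mul_one, twist, one_mul, mul_one, sub_self]
  change (tangentVec q).symm (tangentProj q (twist q.op (normMover q.op q.op))) = 0
  rw [h3, ContinuousLinearEquiv.symm_apply_eq]
  apply Subtype.ext
  change q.op * 0 * (1 - q.op) + (1 - q.op) * 0 * q.op = ((tangentVec q) 0 : H →L[ℂ] H)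
  simp

theorem hasFDerivAt_chartInv (q : CotGr H n) : HasFDerivAt (chartInv q)
    ((tangentSubmodule q.op).subtypeL ∘L (tangentVec q : Model H n →L[ℂ] _)) 0 := by
  let T : Model H n →L[ℂ] H →L[ℂ] H :=
    ((ContinuousLinearMap.mul ℂ (H →L[ℂ] H)).flip q.op - ContinuousLinearMap.mul ℂ (H →L[ℂ] H) q.op)
      ∘L ((tangentSubmodule q.op).subtypeL ∘L (tangentVec q : Model H n →L[ℂ] _))
  have hT : ∀ m, T m = twist q.op (tangentVec q m : H →L[ℂ] H) := fun m => rfl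
  have hu : IsUnit (1 + twist q.op (tangentVec q (0 : Model H n) : H →L[ℂ] H)) := by
    rw [← hT, map_zero, add_zero]; exact isUnit_one
  have hF := ((contDiffAt_chartInv q hu).differentiableAt (by simp)).hasFDerivAt
  have hF0 : chartInv q 0 = q.op := by
    rw [chartInv, ← hT, map_zero, rotate, add_zero, Ring.inverse_one, one_mul, mul_one]
  have hT1 : HasFDerivAt (fun m => 1 + T m) T 0 := T.hasFDerivAt.const_add 1
  have hprod := hF.mul' hT1
  have hev : (fun m => chartInv q m * (1 + T m)) =ᶠ[nhds 0] fun m => (1 + T m) * q.op := by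
    filter_upwards [(isOpen_unit_preimage (f := fun m : Model H n => 1 + T m)
      (continuous_const.add T.continuous)).mem_nhds (x := 0) hu] with m hm
    rw [chartInv, ← hT, rotate, mul_assoc, Ring.inverse_mul_cancel _ hm, mul_one]
  have huniq := hprod.unique ((hT1.mul_const' q.op).congr_of_eventuallyEq hev)
  have hL : (tangentSubmodule q.op).subtypeL ∘L (tangentVec q : Model H n →L[ℂ] _) =
      fderiv ℂ (chartInv q) 0 := by
    refine ContinuousLinearMap.ext fun m => ?_
    have h' : chartInv q 0 * T m + fderiv ℂ (chartInv q) 0 m * (1 + T 0) = T m * q.op :=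
      DFunLike.congr_fun huniq m
    rw [hF0, map_zero, add_zero, mul_one] at h'
    rw [eq_sub_of_add_eq' h']
    exact (twist_twist q.idem (tangentVec q m).2).symm
  rw [hL]
  exact hF

/-- The derivative of the inclusion `T*G_n H → B(H)` at `q` is `tangentAt q`. -/
theorem hasMFDerivAt_op (q : CotGr H n) :
    HasMFDerivAt 𝓘(ℂ, Model H n) 𝓘(ℂ, H →L[ℂ] H) CotGr.op q
      ((tangentSubmodule q.op).subtypeL ∘L (tangentAt q : _ →L[ℂ] tangentSubmodule q.op)) := by
  refine ⟨isEmbedding_op.continuous.continuousAt, ?_⟩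
  have h0 : extChartAt 𝓘(ℂ, Model H n) q q = 0 := chart_self q
  rw [h0]
  refine HasFDerivAt.hasFDerivWithinAt ?_
  refine (hasFDerivAt_chartInv q).congr_of_eventuallyEq ?_
  have ht : (0 : Model H n) ∈ (chart q).target := by
    rw [← chart_self q]; exact (chart q).map_source (mem_chart_source q)
  filter_upwards [(chart q).open_target.mem_nhds ht] with m hm
  exact chart_symm_op q hm

instance (B' : Type*) (f : B' → CotGr H n) (x : B') :
    AddCommGroup ((f *ᵖ (Taut : CotGr H n → Type _)) x) :=
  inferInstanceAs (AddCommGroup (Taut (f x)))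

instance (B' : Type*) (f : B' → CotGr H n) (x : B') :
    IsTopologicalAddGroup ((f *ᵖ (Taut : CotGr H n → Type _)) x) :=
  inferInstanceAs (IsTopologicalAddGroup (Taut (f x)))

instance (B' : Type*) (f : B' → CotGr H n) (x : B') :
    ContinuousSMul ℂ ((f *ᵖ (Taut : CotGr H n → Type _)) x) :=
  inferInstanceAs (ContinuousSMul ℂ (Taut (f x)))

instance (p q : CotGr H n) : NormedAddCommGroup (Taut p →L[ℂ] Taut q) :=
  ContinuousLinearMap.toNormedAddCommGroup

/-- Derivative of a vector-valued function on `T*G_n H` along a tangent vector. -/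
def dirDeriv {W : Type*} [NormedAddCommGroup W] [NormedSpace ℂ W] (f : CotGr H n → W)
    (q : CotGr H n) (a : TangentSpace 𝓘(ℂ, Model H n) q) : W :=
  mfderiv 𝓘(ℂ, Model H n) 𝓘(ℂ, W) f q a

/-- The section `σ` of the tautological bundle is holomorphic near `q`. -/
def HolSectionAt (σ : ∀ q : CotGr H n, Taut q) (q : CotGr H n) : Prop :=
  ContMDiffAt 𝓘(ℂ, Model H n) (𝓘(ℂ, Model H n).prod 𝓘(ℂ, FibModel n)) ω
    (fun x => (⟨x, σ x⟩ : Bundle.TotalSpace (FibModel n) (Taut : CotGr H n → Type _))) q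

/-- The vector field `X` is holomorphic near `q`. -/
def HolFieldAt (X : ∀ q : CotGr H n, TangentSpace 𝓘(ℂ, Model H n) q) (q : CotGr H n) : Prop :=
  ContMDiffAt 𝓘(ℂ, Model H n) (𝓘(ℂ, Model H n).prod 𝓘(ℂ, Model H n)) ω
    (fun x => (⟨x, X x⟩ : Bundle.TotalSpace (Model H n)
      (TangentSpace 𝓘(ℂ, Model H n) : CotGr H n → Type _))) q

/-- The complex structure `J A = i [A, q]`. -/
def cplxJ (q : CotGr H n) (a : TangentSpace 𝓘(ℂ, Model H n) q) :
    TangentSpace 𝓘(ℂ, Model H n) q :=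
  (tangentAt q).symm ⟨Complex.I • twist q.op (tangentAt q a : H →L[ℂ] H),
    Submodule.smul_mem _ _ (twist_tangent q.idem)⟩

variable (n) in
/-- The trace, normalized such that rank-`n` projections have trace `1`. -/
def normTrace (A : H →L[ℂ] H) : ℂ := (n : ℂ)⁻¹ * LinearMap.trace ℂ H (A : H →ₗ[ℂ] H)

variable (n) in
/-- The form `Ω_q(A, B) = i Tr(q [A, B])`, with the normalized trace. -/
def omegaForm (q A B : H →L[ℂ] H) : ℂ := Complex.I * normTrace n (q * (A * B - B * A))

/-- The section `P(q₁, q₂) : E_{q₁} → E_{q₂}`, `v ↦ q₂ v`. -/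
def propagator (q₁ q₂ : CotGr H n) : Taut q₁ →L[ℂ] Taut q₂ :=
  toFib q₂ ∘L (fib q₁.op).subtypeL

variable (H n) in
/-- Covariant derivatives on the tautological bundle. -/
abbrev Connection : Type _ :=
  CovariantDerivative 𝓘(ℂ, Model H n) (FibModel n) (Taut : CotGr H n → Type _)

/-- The connection determined by a kernel `P` that is the identity on the diagonal: the horizontal
lift of `a` at `v ∈ E_q` is `(a, d(q' ↦ P(q, q') v)(a))`, and `∇_a σ` is the difference between
`dσ(a)` and the horizontal lift of `a` at `σ(q)`. -/
def IsInducedBy (P : ∀ q₁ q₂ : CotGr H n, Taut q₁ →L[ℂ] Taut q₂) (D : Connection H n) : Prop :=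
  ∀ (σ : ∀ q : CotGr H n, Taut q) (q : CotGr H n), 
    MDifferentiableAt 𝓘(ℂ, Model H n) (𝓘(ℂ, Model H n).prod 𝓘(ℂ, FibModel n))
      (fun x => (⟨x, σ x⟩ : Bundle.TotalSpace (FibModel n) (Taut : CotGr H n → Type _))) q →
    ∀ a : TangentSpace 𝓘(ℂ, Model H n) q, ((D σ q a : Taut q) : H) =
      dirDeriv (fun q' => (σ q' : H)) q a - dirDeriv (fun q' => (P q q' (σ q) : H)) q a

/-- `∇_X ∇_Y σ - ∇_Y ∇_X σ - ∇_{[X, Y]} σ`. -/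
def curvatureOp (D : Connection H n) (X Y : ∀ q : CotGr H n, TangentSpace 𝓘(ℂ, Model H n) q)
    (σ : ∀ q : CotGr H n, Taut q) (q : CotGr H n) : Taut q :=
  D (fun x => D σ x (Y x)) q (X q) - D (fun x => D σ x (X x)) q (Y q) -
    D σ q (VectorField.mlieBracket 𝓘(ℂ, Model H n) X Y q)

/-- `R` is the curvature tensor of the connection `D`. -/
def IsCurvature (D : Connection H n)
    (R : ∀ q : CotGr H n, TangentSpace 𝓘(ℂ, Model H n) q →ₗ[ℂ]
      TangentSpace 𝓘(ℂ, Model H n) q →ₗ[ℂ] (Taut q →ₗ[ℂ] Taut q)) : Prop :=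
  ∀ (q : CotGr H n) (X Y : ∀ q : CotGr H n, TangentSpace 𝓘(ℂ, Model H n) q)
    (σ : ∀ q : CotGr H n, Taut q),
    HolFieldAt X q → HolFieldAt Y q → HolSectionAt σ q →
    curvatureOp D X Y σ q = R q (X q) (Y q) (σ q)

/-- Covariant derivative of a kernel `P`, a section of `E* ⊠ E`, along `(a, b)`, for the connection
induced by `D` on `E* ⊠ E`, evaluated on `σ(q₁)`:
`∇_b (P(q₁, ·) σ(q₁)) + d(q ↦ P(q, q₂) σ(q))(a) - P(q₁, q₂) (∇_a σ)`. -/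
def extCov (D : Connection H n) (P : ∀ q₁ q₂ : CotGr H n, Taut q₁ →L[ℂ] Taut q₂)
    (q₁ q₂ : CotGr H n) (a : TangentSpace 𝓘(ℂ, Model H n) q₁)
    (b : TangentSpace 𝓘(ℂ, Model H n) q₂) (σ : ∀ q : CotGr H n, Taut q) : Taut q₂ :=
  D (fun q => P q₁ q (σ q₁)) q₂ b +
    (dirDeriv (fun q => P q q₂ (σ q)) q₁ a - P q₁ q₂ (D σ q₁ a))

/-- `P` is polarized with respect to `𝒥 = (-J, J)`: it is covariantly constant along the complex
distribution of the vectors `Z - i 𝒥 Z`, the `+i`-eigenbundle of `𝒥` in the complexified tangent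
bundle of `T*G × T*G`. -/
def IsPolarized (D : Connection H n) (P : ∀ q₁ q₂ : CotGr H n, Taut q₁ →L[ℂ] Taut q₂) : Prop :=
  ∀ (q₁ q₂ : CotGr H n) (a : TangentSpace 𝓘(ℂ, Model H n) q₁)
    (b : TangentSpace 𝓘(ℂ, Model H n) q₂) (σ : ∀ q : CotGr H n, Taut q),
    HolSectionAt σ q₁ →
      extCov D P q₁ q₂ a b σ - Complex.I • extCov D P q₁ q₂ (-cplxJ q₁ a) (cplxJ q₂ b) σ = 0

variable (H n) in
/-- The zero section `G_n H ⊂ T*G_n H`: the orthogonal (that is, Hermitian) projections. -/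
def ZeroSection : Type _ :=
  {q : CotGr H n // ∀ v w : H, inner ℂ (q.op v) w = inner ℂ v (q.op w)}

instance : TopologicalSpace (ZeroSection H n) := instTopologicalSpaceSubtype
instance : MeasurableSpace (ZeroSection H n) := borel _
instance : BorelSpace (ZeroSection H n) := ⟨rfl⟩

/-- The value of the `m`-th wedge power `α ∧ ⋯ ∧ α` of a 2-form `α` on `2m` vectors. -/
def wedgePow {V : Type*} (α : V → V → ℂ) (m : ℕ) (v : Fin m × Fin 2 → V) : ℂ :=
  ((2 : ℂ) ^ m)⁻¹ * ∑ s : Equiv.Perm (Fin m × Fin 2),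
    ((Equiv.Perm.sign s : ℤ) : ℂ) * ∏ i : Fin m, α (v (s (i, 0))) (v (s (i, 1)))

variable (H n) in
/-- Half of the real dimension of the zero section. -/
abbrev halfDim : ℕ := n * (Module.finrank ℂ H - n)

variable (H n) in
/-- Real coordinate space of the dimension of the zero section. -/
abbrev Coord : Type := Fin (halfDim H n) × Fin 2 → ℝ

open MeasureTheory in
/-- `μ` is the measure on the zero section given by the volume form `Ω^top`: in every local
coordinate system `ψ` its density is `|Ω^top(∂_1 ψ, …, ∂_{2m} ψ)|`. -/
def IsTopMeasure (μ : Measure (ZeroSection H n)) : Prop :=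
  ∀ (U : Set (Coord H n)) (ψ : Coord H n → ZeroSection H n), IsOpen U →
    ContDiffOn ℝ ∞ (fun x => (ψ x).1.op) U → Set.InjOn ψ U →
    (∀ x ∈ U, Function.Injective (fderiv ℝ (fun x => (ψ x).1.op) x)) →
    ∀ S ⊆ U, MeasurableSet S → μ (ψ '' S) = ∫⁻ x in S,
      ‖wedgePow (omegaForm n (ψ x).1.op) (halfDim H n)
        fun j => fderiv ℝ (fun x => (ψ x).1.op) x (Pi.single j 1)‖ₑ

open MeasureTheory in
/-- The measure `(dim H / (n Vol)) μ`, where `Vol` is the total mass of `μ`. -/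
def normalized (μ : Measure (ZeroSection H n)) : Measure (ZeroSection H n) :=
  ENNReal.ofReal (Module.finrank ℂ H / (n * (μ Set.univ).toReal)) • μ

/-- A section `P` of `E* ⊠ E = Hom(π₀* E, π₁* E)` over `T*G × T*G` is holomorphic. -/
def IsHolKernel (P : ∀ q₁ q₂ : CotGr H n, Taut q₁ →L[ℂ] Taut q₂) : Prop :=
  ContMDiff (𝓘(ℂ, Model H n).prod 𝓘(ℂ, Model H n))
    ((𝓘(ℂ, Model H n).prod 𝓘(ℂ, Model H n)).prod 𝓘(ℂ, FibModel n →L[ℂ] FibModel n)) ω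
    (fun x : CotGr H n × CotGr H n =>
      (⟨x, P x.1 x.2⟩ : Bundle.TotalSpace (FibModel n →L[ℂ] FibModel n)
        (fun x : CotGr H n × CotGr H n =>
          (((ContinuousMap.fst : C(CotGr H n × CotGr H n, CotGr H n)) :
            CotGr H n × CotGr H n → CotGr H n) *ᵖ (Taut : CotGr H n → Type _)) x →L[ℂ]
          (((ContinuousMap.snd : C(CotGr H n × CotGr H n, CotGr H n)) :
            CotGr H n × CotGr H n → CotGr H n) *ᵖ (Taut : CotGr H n → Type _)) x)))

open MeasureTheory in
/-- The convolution product `(P * Q)(q₁, q₂) = ∫ P(q₁, q) Q(q, q₂) dν(q)` over the zero section,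
kernels being composed from left to right. -/
def convolve (ν : Measure (ZeroSection H n))
    (P Q : ∀ q₁ q₂ : CotGr H n, Taut q₁ →L[ℂ] Taut q₂) (q₁ q₂ : CotGr H n) :
    Taut q₁ →L[ℂ] Taut q₂ :=
  ∫ q : ZeroSection H n, Q q.1 q₂ ∘L P q₁ q.1 ∂ν

variable (H n) in
/-- Global holomorphic sections of the tautological bundle. -/
abbrev HolSection : Type _ :=
  ContMDiffSection 𝓘(ℂ, Model H n) (FibModel n) ω (Taut : CotGr H n → Type _)

end Spaces

end

end GrassCot

open GrassCot MeasureTheory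

namespace GrassCot

noncomputable section

/-! ### Holomorphy of the tautological bundle and of the kernel `P` -/

section Bundle

variable {H : Type*} [NormedAddCommGroup H] [InnerProductSpace ℂ H] [FiniteDimensional ℂ H] {n : ℕ}

/-! The tautological bundle is a holomorphic subbundle of the trivial bundle with fibre `H`, cut out
by the projection-valued function `q`. Everything is therefore calculus with `H`-valued and
`B(H)`-valued functions: a section is holomorphic exactly when its `H`-valued form is
(`contMDiffWithinAt_taut_iff`), and the derivative of the inclusion `q ↦ q` is the tangent vector
`A` itself.

The connection is the compression `∇_A σ = q dσ(A)` of the flat connection. Differentiating `qσ = σ`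
gives `dσ(A) = Aσ + q dσ(A)`, and `Aσ` is the derivative of `P(q, ·)σ(q)`, so this is the connection
induced by `P`. The derivative of `P` along `(A, B)` is `v ↦ q₂(A + B)v`, and polarization is
algebra with `qAq = 0`. A second differentiation, with the second derivatives cancelled by the
bracket term (`dirDeriv_mlieBracket`), gives the curvature `q[A, B]`; its trace is `Ω` by cyclicity.

On the zero section, the holomorphic charts restricted to Hermitian tangent vectors give smooth
parametrizations. A form of top degree changes by the Jacobian determinant, so the local densities
glue to one measure (`exists_isTopMeasure`), determined by its local values (`IsTopMeasure.ext`).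
Compactness makes its mass finite; a symplectic basis at a point shows that the density is not zero
there, so the mass is positive.

Uniqueness of the measure makes it invariant under unitary conjugation. Hence `∫ q` commutes with
all unitaries, is scalar, and its trace determines the scalar; the normalization is the one for
which `∫ q dν = 1` (`IsTopMeasure.integral_op_normalized`). The rest follows from this resolution of
the identity: `∫ q₂ q q₁ dν = q₂ q₁` is idempotency of `P`, and `P̂ = V S` with `VΨ = (q ↦ qΨ)`, `Sψ
= ∫ ψ dν` and `S V = 1`, so `P̂` is idempotent with image `V(H)`, on which the `L²` product is that
of `H`. -/

theorem contMDiff_op : ContMDiff 𝓘(ℂ, Model H n) 𝓘(ℂ, H →L[ℂ] H) ω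
    (CotGr.op : CotGr H n → H →L[ℂ] H) := by
  intro q
  rw [contMDiffAt_iff_source_of_mem_source (mem_chart_source q)]
  have h0 : extChartAt 𝓘(ℂ, Model H n) q q ∈ (chart q).target :=
    (chart q).map_source (mem_chart_source q)
  have h1 : ContMDiffAt 𝓘(ℂ, Model H n) 𝓘(ℂ, H →L[ℂ] H) ω (chartInv q)
    (extChartAt 𝓘(ℂ, Model H n) q q) := (contDiffAt_chartInv q h0).contMDiffAt
  refine (h1.congr_of_eventuallyEq ?_).contMDiffWithinAt
  filter_upwards [(chart q).open_target.mem_nhds h0] with m hm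
  exact chart_symm_op q hm

variable {EM : Type*} [NormedAddCommGroup EM] [NormedSpace ℂ EM] {HM : Type*} [TopologicalSpace HM]
  {IM : ModelWithCorners ℂ EM HM} {M : Type*} [TopologicalSpace M] [ChartedSpace HM M]

/-- The expression of an element of the tautological bundle in the trivialization at `p`. -/
theorem trivializationAt_taut_apply (p : CotGr H n)
    (x : Bundle.TotalSpace (FibModel n) (Taut : CotGr H n → Type _)) :
    (trivializationAt (FibModel n) (Taut : CotGr H n → Type _) p x).2 =
      fibEquiv p (toFib p (x.snd : H)) := rfl

/-- The trivialization `v ↦ pv` is injective on the fibre at `q`, and `normMover` is a right inverse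
of it; hence it is also a left inverse. -/
theorem normMover_toFib (p q : CotGr H n) (hD : IsUnit (diagPart p.op q.op)) (v : Taut q) :
    normMover p.op q.op (toFib p (v : H) : H) = v := by
  have h : v = toFib q (normMover p.op q.op (toFib p (v : H) : H)) :=
    toFib_injective p q hD (toFib_normMover p q hD (toFib p (v : H))).symm
  rw [← normMover_fib p q hD, ← h]

/-- The fibre coordinate of `(q, v)` is a fixed linear map applied to `v`. Conversely, `v` is
recovered from that coordinate by `normMover p q`, which depends holomorphically on `q` near `p`.
Through this equivalence bundle-valued holomorphy is tested in `H`. -/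
theorem contMDiffWithinAt_taut_iff {f : M → Bundle.TotalSpace (FibModel n) (Taut : CotGr H n → Type _)}
    {s : Set M} {x : M} :
    ContMDiffWithinAt IM (𝓘(ℂ, Model H n).prod 𝓘(ℂ, FibModel n)) ω f s x ↔
      ContMDiffWithinAt IM 𝓘(ℂ, Model H n) ω (fun y => (f y).proj) s x ∧
        ContMDiffWithinAt IM 𝓘(ℂ, H) ω (fun y => ((f y).snd : H)) s x := by
  rw [Bundle.contMDiffWithinAt_totalSpace]
  refine and_congr_right fun h1 => ?_
  set p := (f x).proj with hp
  constructor
  · intro h2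
    have hu : IsUnit (diagPart p.op p.op) := (mem_chart_source p).1
    have h3 : ContMDiffWithinAt IM 𝓘(ℂ, H →L[ℂ] H) ω
        (fun y => normMover p.op (f y).proj.op) s x :=
      ContMDiffAt.comp_contMDiffWithinAt x (g := fun q => normMover p.op q)
        (contDiffAt_normMover p.op hu).contMDiffAt
        (contMDiff_op.contMDiffAt.comp_contMDiffWithinAt x h1)
    have h4 : ContMDiffWithinAt IM 𝓘(ℂ, H) ω (fun y => (((fib p.op).subtypeL ∘L
        ((fibEquiv p).symm : FibModel n →L[ℂ] Taut p)))
          (trivializationAt (FibModel n) (Taut : CotGr H n → Type _) p (f y)).2) s x :=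
      ((ContinuousLinearMap.contMDiff _).contMDiffAt).comp_contMDiffWithinAt x h2
    have hev : ∀ᶠ y in 𝓝[s] x, (f y).proj ∈ trivBase p :=
      h1.continuousWithinAt.eventually ((isOpen_trivBase p).mem_nhds hu)
    have key : ∀ y, (f y).proj ∈ trivBase p → ((f y).snd : H) =
        normMover p.op (f y).proj.op (((fib p.op).subtypeL ∘L
          ((fibEquiv p).symm : FibModel n →L[ℂ] Taut p))
            (trivializationAt (FibModel n) (Taut : CotGr H n → Type _) p (f y)).2) := by
      intro y hy
      rw [trivializationAt_taut_apply]
      simp only [ContinuousLinearMap.comp_apply, ContinuousLinearEquiv.coe_coe,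
        ContinuousLinearEquiv.symm_apply_apply, Submodule.subtypeL_apply]
      exact (normMover_toFib p _ hy _).symm
    exact (h3.clm_apply h4).congr_of_eventuallyEq (hev.mono key) (key x hu)
  · intro h2
    exact ((((fibEquiv p : Taut p →L[ℂ] FibModel n) ∘L toFib p).contMDiff).contMDiffAt).comp_contMDiffWithinAt
      x h2

theorem contMDiffAt_taut_iff {f : M → Bundle.TotalSpace (FibModel n) (Taut : CotGr H n → Type _)}
    {x : M} :
    ContMDiffAt IM (𝓘(ℂ, Model H n).prod 𝓘(ℂ, FibModel n)) ω f x ↔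
      ContMDiffAt IM 𝓘(ℂ, Model H n) ω (fun y => (f y).proj) x ∧
        ContMDiffAt IM 𝓘(ℂ, H) ω (fun y => ((f y).snd : H)) x := by
  simp only [← contMDiffWithinAt_univ]
  exact contMDiffWithinAt_taut_iff

/-- The map `(q, v) ↦ v` is holomorphic. -/
theorem contMDiff_snd : ContMDiff (𝓘(ℂ, Model H n).prod 𝓘(ℂ, FibModel n)) 𝓘(ℂ, H) ω
    (fun x : Bundle.TotalSpace (FibModel n) (Taut : CotGr H n → Type _) => (x.snd : H)) :=
  fun _ => (contMDiffAt_taut_iff.1 contMDiffAt_id).2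

theorem contMDiffAt_section_iff {σ : ∀ q : CotGr H n, Taut q} {q : CotGr H n} :
    HolSectionAt σ q ↔ ContMDiffAt 𝓘(ℂ, Model H n) 𝓘(ℂ, H) ω (fun x => (σ x : H)) q :=
  contMDiffAt_taut_iff.trans (and_iff_right contMDiffAt_id)

theorem mdifferentiableAt_coe {σ : ∀ q : CotGr H n, Taut q} {q : CotGr H n}
    (hσ : MDifferentiableAt 𝓘(ℂ, Model H n) (𝓘(ℂ, Model H n).prod 𝓘(ℂ, FibModel n))
      (fun x => (⟨x, σ x⟩ : Bundle.TotalSpace (FibModel n) (Taut : CotGr H n → Type _))) q) :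
    MDifferentiableAt 𝓘(ℂ, Model H n) 𝓘(ℂ, H) (fun x => (σ x : H)) q :=
  ((contMDiff_snd (H := H) (n := n)).mdifferentiable (by simp)).mdifferentiableAt.comp q hσ

/-- The change of coordinates from `p` to `p'` is `w ↦ p' (normMover p q) w` up to fixed
isomorphisms, hence holomorphic in `q`. -/
instance : ContMDiffVectorBundle ω (FibModel n) (Taut : CotGr H n → Type _) 𝓘(ℂ, Model H n) where
  contMDiffOn_coordChangeL e e' he he' := by
    obtain ⟨p, rfl⟩ := he.out
    obtain ⟨p', rfl⟩ := he'.out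
    intro q hq
    have h1 : ContMDiffWithinAt 𝓘(ℂ, Model H n) 𝓘(ℂ, H →L[ℂ] H) ω
        (fun q : CotGr H n => normMover p.op q.op)
        ((triv p).baseSet ∩ (triv p').baseSet) q :=
      ContMDiffAt.comp_contMDiffWithinAt q (g := fun q => normMover p.op q)
        (contDiffAt_normMover p.op hq.1).contMDiffAt contMDiff_op.contMDiffAt.contMDiffWithinAt
    have h2 : ContMDiffWithinAt 𝓘(ℂ, Model H n) 𝓘(ℂ, FibModel n →L[ℂ] FibModel n) ω
        (fun q : CotGr H n =>
        ((fibEquiv p' : Taut p' →L[ℂ] FibModel n) ∘L toFib p') ∘L normMover p.op q.op ∘L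
          ((fib p.op).subtypeL ∘L ((fibEquiv p).symm : FibModel n →L[ℂ] Taut p)))
        ((triv p).baseSet ∩ (triv p').baseSet) q :=
      contMDiffWithinAt_const.clm_comp (h1.clm_comp contMDiffWithinAt_const)
    refine h2.congr_of_mem (fun b hb => ?_) hq
    ext1 w
    rw [ContinuousLinearEquiv.coe_coe, Bundle.Trivialization.coordChangeL_apply' _ _ hb]
    change fibEquiv p' (toFib p' (toFib b (normMover p.op b.op ((fibEquiv p).symm w)) : H)) = _
    rw [normMover_fib p b hb.1]
    rfl

theorem continuousLinearMapAt_taut (p q : CotGr H n) (hq : IsUnit (diagPart p.op q.op)) :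
    (trivializationAt (FibModel n) (Taut : CotGr H n → Type _) p).continuousLinearMapAt ℂ q =
      (fibEquiv p : Taut p →L[ℂ] FibModel n) ∘L toFib p ∘L (fib q.op).subtypeL := by
  ext1 v
  rw [Bundle.Trivialization.continuousLinearMapAt_apply_of_mem]
  · rfl
  · exact hq

theorem isHolKernel_propagator : IsHolKernel (propagator (H := H) (n := n)) := by
  intro x
  rw [contMDiffAt_hom_bundle]
  refine ⟨contMDiffAt_id, ?_⟩
  obtain ⟨p₁, p₂⟩ := x
  have hu₁ : IsUnit (diagPart p₁.op p₁.op) := (mem_chart_source p₁).1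
  have hu₂ : IsUnit (diagPart p₂.op p₂.op) := (mem_chart_source p₂).1
  have hfst : ContMDiffAt (𝓘(ℂ, Model H n).prod 𝓘(ℂ, Model H n)) 𝓘(ℂ, H →L[ℂ] H) ω
      (fun x : CotGr H n × CotGr H n => x.1.op) (p₁, p₂) :=
    contMDiff_op.contMDiffAt.comp _ contMDiffAt_fst
  have hsnd : ContMDiffAt (𝓘(ℂ, Model H n).prod 𝓘(ℂ, Model H n)) 𝓘(ℂ, H →L[ℂ] H) ω
      (fun x : CotGr H n × CotGr H n => x.2.op) (p₁, p₂) :=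
    contMDiff_op.contMDiffAt.comp _ contMDiffAt_snd
  have h1 : ContMDiffAt (𝓘(ℂ, Model H n).prod 𝓘(ℂ, Model H n)) 𝓘(ℂ, H →L[ℂ] H) ω
      (fun x : CotGr H n × CotGr H n => normMover p₁.op x.1.op) (p₁, p₂) :=
    ContMDiffAt.comp (p₁, p₂) (g := fun q => normMover p₁.op q)
      (contDiffAt_normMover p₁.op hu₁).contMDiffAt hfst
  -- The coordinate expression of `P` is `p₂ q₂ q₁ (normMover p₁ q₁)`. The factor `x.1.op` fixes the
  -- vectors it meets here; it is kept because `trivInv` contains it, so that the final comparison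
  -- is definitional.
  have h2 : ContMDiffAt (𝓘(ℂ, Model H n).prod 𝓘(ℂ, Model H n))
      𝓘(ℂ, FibModel n →L[ℂ] FibModel n) ω (fun x : CotGr H n × CotGr H n =>
        ((fibEquiv p₂ : Taut p₂ →L[ℂ] FibModel n) ∘L toFib p₂) ∘L x.2.op ∘L x.1.op ∘L
          normMover p₁.op x.1.op ∘L ((fib p₁.op).subtypeL ∘L
            ((fibEquiv p₁).symm : FibModel n →L[ℂ] Taut p₁))) (p₁, p₂) :=
    contMDiffAt_const.clm_comp (hsnd.clm_comp (hfst.clm_comp (h1.clm_comp contMDiffAt_const)))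
  refine h2.congr_of_eventuallyEq ?_
  filter_upwards [((isOpen_trivBase p₁).prod (isOpen_trivBase p₂)).mem_nhds
    (show (p₁, p₂) ∈ trivBase p₁ ×ˢ trivBase p₂ from ⟨hu₁, hu₂⟩)] with x hx
  ext1 w
  have hx₁ : x ∈ (trivializationAt (FibModel n)
    (((ContinuousMap.fst : C(CotGr H n × CotGr H n, CotGr H n)) :
            CotGr H n × CotGr H n → CotGr H n) *ᵖ (Taut : CotGr H n → Type _)) (p₁, p₂)).baseSet :=
    hx.1
  have hx₂ : x ∈ (trivializationAt (FibModel n)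
    (((ContinuousMap.snd : C(CotGr H n × CotGr H n, CotGr H n)) :
            CotGr H n × CotGr H n → CotGr H n) *ᵖ (Taut : CotGr H n → Type _)) (p₁, p₂)).baseSet :=
    hx.2
  refine (DFunLike.congr_fun (ContinuousLinearMap.inCoordinates_eq hx₁ hx₂) w).trans ?_
  have h4 : ∀ v : Taut x.1, (Bundle.Trivialization.continuousLinearEquivAt ℂ
      (trivializationAt (FibModel n) (((ContinuousMap.snd : C(CotGr H n × CotGr H n, CotGr H n)) :
            CotGr H n × CotGr H n → CotGr H n) *ᵖ (Taut : CotGr H n → Type _)) (p₁, p₂)) x hx₂)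
      (propagator x.1 x.2 v) = fibEquiv p₂ (toFib p₂ (x.2.op v)) := fun v => rfl
  have h5 : (Bundle.Trivialization.continuousLinearEquivAt ℂ (trivializationAt (FibModel n)
      (((ContinuousMap.fst : C(CotGr H n × CotGr H n, CotGr H n)) :
        CotGr H n × CotGr H n → CotGr H n) *ᵖ (Taut : CotGr H n → Type _)) (p₁, p₂)) x hx₁).symm w =
      (trivializationAt (FibModel n) (Taut : CotGr H n → Type _) p₁).symm x.1 w := by
    rw [Bundle.Trivialization.symm_continuousLinearEquivAt_eq, Bundle.Trivialization.symmL_apply]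
    · refine (Bundle.Trivialization.symm_apply _ hx₁ w).trans ?_
      rfl
    · exact hx₁
  refine (h4 _).trans ?_
  refine (congrArg (fun v : Taut x.1 => fibEquiv p₂ (toFib p₂ (x.2.op v))) h5).trans ?_
  rw [Bundle.Trivialization.symm_apply _ (show x.1 ∈ (trivializationAt (FibModel n)
    (Taut : CotGr H n → Type _) p₁).baseSet from hx.1)]
  rfl

omit [FiniteDimensional ℂ H] in
theorem propagator_self (q : CotGr H n) : propagator q q = ContinuousLinearMap.id ℂ (Taut q) := by
  ext v
  exact v.2

end Bundle

/-! ### Derivatives of vector-valued functions along vector fields -/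

section LieDerivative

open VectorField Filter

variable {H : Type*} [NormedAddCommGroup H] [InnerProductSpace ℂ H] [FiniteDimensional ℂ H] {n : ℕ}
  {W : Type*} [NormedAddCommGroup W] [NormedSpace ℂ W]

/-- The vector field `X`, read in the chart at `q`. -/
def localField (q : CotGr H n) (X : ∀ x : CotGr H n, TangentSpace 𝓘(ℂ, Model H n) x) :
    Model H n → Model H n :=
  mpullbackWithin 𝓘(ℂ, Model H n) 𝓘(ℂ, Model H n) (extChartAt 𝓘(ℂ, Model H n) q).symm X
    Set.univ

/-- The derivative of a vector-valued function along a vector field, read in a chart. -/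
theorem eventually_dirDeriv_eq {f : CotGr H n → W} {q : CotGr H n}
    (hf : ContMDiffAt 𝓘(ℂ, Model H n) 𝓘(ℂ, W) 1 f q)
    (X : ∀ x : CotGr H n, TangentSpace 𝓘(ℂ, Model H n) x) :
    ∀ᶠ m in 𝓝 (extChartAt 𝓘(ℂ, Model H n) q q),
      dirDeriv f ((extChartAt 𝓘(ℂ, Model H n) q).symm m)
        (X ((extChartAt 𝓘(ℂ, Model H n) q).symm m)) =
      fderiv ℂ (f ∘ (extChartAt 𝓘(ℂ, Model H n) q).symm) m (localField q X m) := by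
  -- An identity at `q` alone would not do, as it is differentiated once more in
  -- `dirDeriv_dirDeriv`; being `C¹` at `q` extends to a neighbourhood.
  have h1 : ∀ᶠ x in 𝓝 q, ContMDiffAt 𝓘(ℂ, Model H n) 𝓘(ℂ, W) 1 f x :=
    (contMDiffAt_iff_contMDiffAt_nhds (by simp)).1 hf
  have h2 := (continuousAt_extChartAt_symm (I := 𝓘(ℂ, Model H n)) q).eventually
    (by rwa [extChartAt_to_inv q])
  filter_upwards [h2, extChartAt_target_mem_nhds (I := 𝓘(ℂ, Model H n)) q] with m hm hmt
  have h3 : MDifferentiableAt 𝓘(ℂ, Model H n) 𝓘(ℂ, W) f ((extChartAt 𝓘(ℂ, Model H n) q).symm m) :=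
    hm.mdifferentiableAt (by simp)
  have h4 := mdifferentiableWithinAt_extChartAt_symm hmt
  have h5 := isInvertible_mfderivWithin_extChartAt_symm hmt
  have h6 : localField q X m = (mfderiv 𝓘(ℂ, Model H n) 𝓘(ℂ, Model H n)
      (extChartAt 𝓘(ℂ, Model H n) q).symm m).inverse
        (X ((extChartAt 𝓘(ℂ, Model H n) q).symm m)) := by
    rw [localField, mpullbackWithin_apply, mfderivWithin_univ]
  rw [modelWithCornersSelf_coe, Set.range_id] at h4 h5
  rw [mfderivWithin_univ] at h5
  rw [mdifferentiableWithinAt_univ] at h4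
  rw [← mfderiv_eq_fderiv, mfderiv_comp _ h3 h4, h6]
  exact congrArg (mfderiv 𝓘(ℂ, Model H n) 𝓘(ℂ, W) f ((extChartAt 𝓘(ℂ, Model H n) q).symm m))
    (h5.self_apply_inverse _).symm

theorem contDiffAt_comp_chart_symm {f : CotGr H n → W} {q : CotGr H n}
    (hf : ContMDiffAt 𝓘(ℂ, Model H n) 𝓘(ℂ, W) ω f q) :
    ContDiffAt ℂ ω (f ∘ (extChartAt 𝓘(ℂ, Model H n) q).symm) (extChartAt 𝓘(ℂ, Model H n) q q) := by
  have := (contMDiffAt_iff.1 hf).2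
  rw [modelWithCornersSelf_coe, Set.range_id] at this
  exact this

theorem differentiableAt_localField {q : CotGr H n}
    {X : ∀ x : CotGr H n, TangentSpace 𝓘(ℂ, Model H n) x} (hX : HolFieldAt X q) :
    DifferentiableAt ℂ (localField q X) (extChartAt 𝓘(ℂ, Model H n) q q) := by
  have h0 : MDifferentiableAt 𝓘(ℂ, Model H n) (𝓘(ℂ, Model H n).prod 𝓘(ℂ, Model H n))
    (fun x => (⟨x, X x⟩ : Bundle.TotalSpace (Model H n)
      (TangentSpace 𝓘(ℂ, Model H n) : CotGr H n → Type _))) q := hX.mdifferentiableAt (by simp)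
  have h := (h0.mdifferentiableWithinAt (s :=
    Set.univ)).differentiableWithinAt_mpullbackWithin_vectorField
  rw [modelWithCornersSelf_coe, Set.range_id, Set.preimage_univ, Set.univ_inter] at h
  exact differentiableWithinAt_univ.1 h

theorem localField_self (q : CotGr H n) (X : ∀ x : CotGr H n, TangentSpace 𝓘(ℂ, Model H n) x) :
    localField q X (extChartAt 𝓘(ℂ, Model H n) q q) = X q := by
  rw [localField, mpullbackWithin_apply, extChartAt_to_inv]
  have := mfderivWithin_extChartAt_symm_inverse_apply (I := 𝓘(ℂ, Model H n)) (X q)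
  rwa [modelWithCornersSelf_coe, Set.range_id] at this

theorem differentiableAt_fderiv_localField {f : CotGr H n → W} {q : CotGr H n}
    (hf : ContMDiffAt 𝓘(ℂ, Model H n) 𝓘(ℂ, W) ω f q)
    {X : ∀ x : CotGr H n, TangentSpace 𝓘(ℂ, Model H n) x} (hX : HolFieldAt X q) :
    DifferentiableAt ℂ (fun m => fderiv ℂ (f ∘ (extChartAt 𝓘(ℂ, Model H n) q).symm) m
      (localField q X m)) (extChartAt 𝓘(ℂ, Model H n) q q) :=
  (((contDiffAt_comp_chart_symm hf).fderiv_right (m := 1) (by simp)).differentiableAt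
    (by simp)).clm_apply (differentiableAt_localField hX)

theorem mdifferentiableAt_dirDeriv {f : CotGr H n → W} {q : CotGr H n}
    (hf : ContMDiffAt 𝓘(ℂ, Model H n) 𝓘(ℂ, W) ω f q)
    {X : ∀ x : CotGr H n, TangentSpace 𝓘(ℂ, Model H n) x} (hX : HolFieldAt X q) :
    MDifferentiableAt 𝓘(ℂ, Model H n) 𝓘(ℂ, W) (fun x => dirDeriv f x (X x)) q := by
  have h1 := (differentiableAt_fderiv_localField hf hX).mdifferentiableAt.comp q
    (mdifferentiableAt_extChartAt (ChartedSpace.mem_chart_source q))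
  refine h1.congr_of_eventuallyEq ?_
  filter_upwards [(continuousAt_extChartAt q).eventually
    (eventually_dirDeriv_eq (hf.of_le (by simp)) X),
    extChartAt_source_mem_nhds (I := 𝓘(ℂ, Model H n)) q] with x hx hxs
  rw [(extChartAt 𝓘(ℂ, Model H n) q).left_inv hxs] at hx
  exact hx

theorem dirDeriv_eq_fderiv {g : CotGr H n → W} {q : CotGr H n}
    (hg : MDifferentiableAt 𝓘(ℂ, Model H n) 𝓘(ℂ, W) g q) (a : TangentSpace 𝓘(ℂ, Model H n) q) :
    dirDeriv g q a = fderiv ℂ (g ∘ (extChartAt 𝓘(ℂ, Model H n) q).symm)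
      (extChartAt 𝓘(ℂ, Model H n) q q) a := by
  rw [dirDeriv, hg.mfderiv, modelWithCornersSelf_coe, Set.range_id, fderivWithin_univ]
  rfl

theorem dirDeriv_dirDeriv {f : CotGr H n → W} {q : CotGr H n}
    (hf : ContMDiffAt 𝓘(ℂ, Model H n) 𝓘(ℂ, W) ω f q)
    {X : ∀ x : CotGr H n, TangentSpace 𝓘(ℂ, Model H n) x} (hX : HolFieldAt X q)
    (a : TangentSpace 𝓘(ℂ, Model H n) q) :
    dirDeriv (fun x => dirDeriv f x (X x)) q a =
      fderiv ℂ (fun m => fderiv ℂ (f ∘ (extChartAt 𝓘(ℂ, Model H n) q).symm) m (localField q X m))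
        (extChartAt 𝓘(ℂ, Model H n) q q) a := by
  rw [dirDeriv_eq_fderiv (mdifferentiableAt_dirDeriv hf hX)]
  exact congrArg (fun L : Model H n →L[ℂ] W => L a)
    (Filter.EventuallyEq.fderiv_eq (eventually_dirDeriv_eq (hf.of_le (by simp)) X))

/-- The manifold bracket is defined in a chart, where symmetry of the second derivative of `f`
leaves only the first-order terms of the commutator. The curvature computation uses this with `f =
σ`. -/
theorem dirDeriv_mlieBracket {f : CotGr H n → W} {q : CotGr H n}
    (hf : ContMDiffAt 𝓘(ℂ, Model H n) 𝓘(ℂ, W) ω f q)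
    {X Y : ∀ x : CotGr H n, TangentSpace 𝓘(ℂ, Model H n) x} (hX : HolFieldAt X q)
    (hY : HolFieldAt Y q) :
    dirDeriv f q (mlieBracket 𝓘(ℂ, Model H n) X Y q) =
      dirDeriv (fun x => dirDeriv f x (Y x)) q (X q) -
        dirDeriv (fun x => dirDeriv f x (X x)) q (Y q) := by
  have hf' := contDiffAt_comp_chart_symm hf
  have hb : mlieBracket 𝓘(ℂ, Model H n) X Y q = lieBracket ℂ (localField q X) (localField q Y)
      (extChartAt 𝓘(ℂ, Model H n) q q) := by
    -- The tangent space at `q` is identified with the model through the chart centred at `q`, so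
    -- the derivative of that chart at `q` is the identity.
    have hid : ∀ v : Model H n, (mfderiv 𝓘(ℂ, Model H n) 𝓘(ℂ, Model H n)
        (extChartAt 𝓘(ℂ, Model H n) q) q).inverse v = v := by
      rw [mfderiv_extChartAt_self]
      exact DFunLike.congr_fun (ContinuousLinearMap.inverse_id (R := ℂ) (M := Model H n))
    rw [mlieBracket, mlieBracketWithin_apply, modelWithCornersSelf_coe, Set.range_id,
      Set.preimage_univ, Set.univ_inter]
    exact (hid _).trans (congrFun (lieBracketWithin_univ (𝕜 := ℂ) (V := localField q X)
      (W := localField q Y)) _)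
  rw [dirDeriv_dirDeriv hf hX, dirDeriv_dirDeriv hf hY, dirDeriv_eq_fderiv
    (hf.mdifferentiableAt (by simp)), hb, fderiv_apply_lieBracket_of_isSymmSndFDerivAt
      (hf'.of_le (by simp)) hf'.isSymmSndFDerivAt_of_omega
      (differentiableAt_localField hY) (differentiableAt_localField hX), localField_self,
    localField_self]

theorem dirDeriv_eq_of_hasFDerivAt {g : CotGr H n → W} {q : CotGr H n} {L : Model H n →L[ℂ] W}
    (hc : ContinuousAt g q) (hL : HasFDerivAt (g ∘ (extChartAt 𝓘(ℂ, Model H n) q).symm) L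
      (extChartAt 𝓘(ℂ, Model H n) q q)) (a : TangentSpace 𝓘(ℂ, Model H n) q) :
    dirDeriv g q a = L a := by
  have : HasMFDerivAt 𝓘(ℂ, Model H n) 𝓘(ℂ, W) g q L := ⟨hc, hL.hasFDerivWithinAt⟩
  rw [dirDeriv, this.mfderiv]
  rfl

theorem differentiableAt_comp_chart_symm {g : CotGr H n → W} {q : CotGr H n}
    (hg : MDifferentiableAt 𝓘(ℂ, Model H n) 𝓘(ℂ, W) g q) :
    DifferentiableAt ℂ (g ∘ (extChartAt 𝓘(ℂ, Model H n) q).symm)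
      (extChartAt 𝓘(ℂ, Model H n) q q) := by
  have := hg.hasMFDerivAt.2
  rw [modelWithCornersSelf_coe, Set.range_id] at this
  exact HasFDerivAt.differentiableAt (HasFDerivWithinAt.hasFDerivAt_of_univ this)

theorem dirDeriv_add {f g : CotGr H n → W} {q : CotGr H n}
    (hf : MDifferentiableAt 𝓘(ℂ, Model H n) 𝓘(ℂ, W) f q)
    (hg : MDifferentiableAt 𝓘(ℂ, Model H n) 𝓘(ℂ, W) g q) (a : TangentSpace 𝓘(ℂ, Model H n) q) :
    dirDeriv (fun x => f x + g x) q a = dirDeriv f q a + dirDeriv g q a := by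
  rw [dirDeriv_eq_fderiv hf, dirDeriv_eq_fderiv hg]
  exact dirDeriv_eq_of_hasFDerivAt (hf.continuousAt.add hg.continuousAt)
    ((differentiableAt_comp_chart_symm hf).hasFDerivAt.add
      (differentiableAt_comp_chart_symm hg).hasFDerivAt) a

theorem dirDeriv_smul {c : CotGr H n → ℂ} {g : CotGr H n → W} {q : CotGr H n}
    (hc : MDifferentiableAt 𝓘(ℂ, Model H n) 𝓘(ℂ, ℂ) c q)
    (hg : MDifferentiableAt 𝓘(ℂ, Model H n) 𝓘(ℂ, W) g q) (a : TangentSpace 𝓘(ℂ, Model H n) q) :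
    dirDeriv (fun x => c x • g x) q a = c q • dirDeriv g q a + dirDeriv c q a • g q := by
  rw [dirDeriv_eq_fderiv hc, dirDeriv_eq_fderiv hg]
  have h := ((differentiableAt_comp_chart_symm hc).hasFDerivAt.smul
      (differentiableAt_comp_chart_symm hg).hasFDerivAt)
  refine (dirDeriv_eq_of_hasFDerivAt (hc.continuousAt.smul hg.continuousAt) h a).trans ?_
  simp only [Function.comp_apply, extChartAt_to_inv]
  rfl

theorem dirDeriv_clm_comp {V : Type*} [NormedAddCommGroup V] [NormedSpace ℂ V] (T : W →L[ℂ] V)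
    {g : CotGr H n → W} {q : CotGr H n}
    (hg : MDifferentiableAt 𝓘(ℂ, Model H n) 𝓘(ℂ, W) g q) (a : TangentSpace 𝓘(ℂ, Model H n) q) :
    dirDeriv (fun x => T (g x)) q a = T (dirDeriv g q a) := by
  rw [dirDeriv_eq_fderiv hg]
  exact dirDeriv_eq_of_hasFDerivAt (T.continuous.continuousAt.comp hg.continuousAt)
    (T.hasFDerivAt.comp _ (differentiableAt_comp_chart_symm hg).hasFDerivAt) a

theorem mdifferentiableAt_op (q : CotGr H n) :
    MDifferentiableAt 𝓘(ℂ, Model H n) 𝓘(ℂ, H →L[ℂ] H) (CotGr.op : CotGr H n → H →L[ℂ] H) q :=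
  (hasMFDerivAt_op q).mdifferentiableAt

theorem dirDeriv_op (q : CotGr H n) (a : TangentSpace 𝓘(ℂ, Model H n) q) :
    dirDeriv (CotGr.op : CotGr H n → H →L[ℂ] H) q a = tangentAt q a := by
  rw [dirDeriv, (hasMFDerivAt_op q).mfderiv]
  rfl

/-- The Leibniz rule for evaluation, with `tangentAt` as the derivative of `op`. Applied to `qσ = σ`
it splits `dσ` into its parts inside and transverse to the fibre. -/
theorem dirDeriv_op_apply {g : CotGr H n → H} {q : CotGr H n}
    (hg : MDifferentiableAt 𝓘(ℂ, Model H n) 𝓘(ℂ, H) g q) (a : TangentSpace 𝓘(ℂ, Model H n) q) :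
    dirDeriv (fun x => x.op (g x)) q a =
      (tangentAt q a : H →L[ℂ] H) (g q) + q.op (dirDeriv g q a) := by
  rw [← dirDeriv_op, dirDeriv_eq_fderiv hg, dirDeriv_eq_fderiv (mdifferentiableAt_op q)]
  have h := ((differentiableAt_comp_chart_symm (mdifferentiableAt_op q)).hasFDerivAt.clm_apply
      (differentiableAt_comp_chart_symm hg).hasFDerivAt)
  refine (dirDeriv_eq_of_hasFDerivAt
    ((mdifferentiableAt_op q).continuousAt.clm_apply hg.continuousAt) h a).trans ?_
  simp only [Function.comp_apply, extChartAt_to_inv]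
  exact add_comm _ _

end LieDerivative

/-! ### The induced connection and polarization -/

section Connection

variable {H : Type*} [NormedAddCommGroup H] [InnerProductSpace ℂ H] [FiniteDimensional ℂ H] {n : ℕ}

variable (H n) in
/-- The connection `∇_a σ = q (dσ(a))`. -/
def tautConnection : Connection H n where
  toFun σ q := toFib q ∘L (mfderiv 𝓘(ℂ, Model H n) 𝓘(ℂ, H) (fun x => (σ x : H)) q)
  isCovariantDerivativeOnUniv :=
    { add := by
        intro σ σ' q hσ hσ' _
        refine ContinuousLinearMap.ext fun a => Subtype.ext ?_
        have h := dirDeriv_add (mdifferentiableAt_coe hσ) (mdifferentiableAt_coe hσ') a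
        exact (congrArg q.op h).trans (map_add q.op _ _)
      leibniz := by
        intro σ g q hσ hg _
        refine ContinuousLinearMap.ext fun a => Subtype.ext ?_
        have h := dirDeriv_smul hg (mdifferentiableAt_coe hσ) a
        refine (congrArg q.op h).trans ((map_add q.op _ _).trans ?_)
        rw [map_smul, map_smul, op_fib]
        rfl }

theorem tautConnection_apply (σ : ∀ q : CotGr H n, Taut q) (q : CotGr H n)
    (a : TangentSpace 𝓘(ℂ, Model H n) q) :
    (tautConnection H n σ q a : Taut q) = toFib q (dirDeriv (fun x => (σ x : H)) q a) := rfl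

/-- Differentiating `qσ = σ` gives `q dσ(a) = dσ(a) - Aσ`, and `Aσ(q)` is the derivative of `q' ↦
q'σ(q)`. -/
theorem isInducedBy_tautConnection : IsInducedBy propagator (tautConnection H n) := by
  intro σ q hσ a
  have hσ' := mdifferentiableAt_coe hσ
  have h1 := dirDeriv_op_apply hσ' a
  simp only [op_fib] at h1
  have h2 := dirDeriv_op_apply (q := q)
    (mdifferentiableAt_const (I := 𝓘(ℂ, Model H n)) (I' := 𝓘(ℂ, H)) (c := (σ q : H))) a
  have h3 : dirDeriv (fun _ : CotGr H n => (σ q : H)) q a = 0 :=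
    dirDeriv_eq_of_hasFDerivAt continuousAt_const (hasFDerivAt_const _ _) a
  rw [h3, map_zero, add_zero] at h2
  rw [tautConnection_apply]
  change q.op _ = _ - dirDeriv (fun q' : CotGr H n => q'.op (σ q)) q a
  -- `h1` also rewrites the occurrence of `dσ(a)` under `q.op`; the last rewrite folds it back.
  rw [h2, h1, add_sub_cancel_left, ← h1]

/-- On a fibre, `dσ(a) = A σ + ∇_a σ`. -/
theorem dirDeriv_section {σ : ∀ q : CotGr H n, Taut q} {q : CotGr H n}
    (hσ : MDifferentiableAt 𝓘(ℂ, Model H n) 𝓘(ℂ, H) (fun x => (σ x : H)) q)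
    (a : TangentSpace 𝓘(ℂ, Model H n) q) :
    dirDeriv (fun x => (σ x : H)) q a = (tangentAt q a : H →L[ℂ] H) (σ q) +
      q.op (dirDeriv (fun x => (σ x : H)) q a) := by
  have h1 := dirDeriv_op_apply hσ a
  simp only [op_fib] at h1
  exact h1

omit [FiniteDimensional ℂ H] in
theorem tangent_apply_apply {q A : H →L[ℂ] H} (hq : q * q = q) (hA : A ∈ tangentSubmodule q) (v : H) :
    q (A (q v)) = 0 :=
  DFunLike.congr_fun (tangent_mid hq hA) v

theorem tangentAt_cplxJ (q : CotGr H n) (a : TangentSpace 𝓘(ℂ, Model H n) q) :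
    (tangentAt q (cplxJ q a) : H →L[ℂ] H) =
      Complex.I • twist q.op (tangentAt q a : H →L[ℂ] H) := by
  rw [cplxJ, ContinuousLinearEquiv.apply_symm_apply]

theorem hasMFDerivAt_op_const (q : CotGr H n) (v : H) (a : TangentSpace 𝓘(ℂ, Model H n) q) :
    MDifferentiableAt 𝓘(ℂ, Model H n) 𝓘(ℂ, H) (fun x : CotGr H n => x.op v) q ∧
    dirDeriv (fun x : CotGr H n => x.op v) q a = (tangentAt q a : H →L[ℂ] H) v := by
  refine ⟨(mdifferentiableAt_op q).clm_apply mdifferentiableAt_const, ?_⟩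
  have h2 := dirDeriv_op_apply (q := q)
    (mdifferentiableAt_const (I := 𝓘(ℂ, Model H n)) (I' := 𝓘(ℂ, H)) (c := v)) a
  have h3 : dirDeriv (fun _ : CotGr H n => v) q a = 0 :=
    dirDeriv_eq_of_hasFDerivAt continuousAt_const (hasFDerivAt_const _ _) a
  rw [h3, map_zero, add_zero] at h2
  exact h2

/-- The terms with `dσ` combine to `q₂(dσ(a) - q₁ dσ(a)) = q₂Aσ(q₁)`, so the derivative of `P`
depends only on the value of `σ` at `q₁`. -/
theorem extCov_tautConnection {σ : ∀ q : CotGr H n, Taut q} {q₁ : CotGr H n}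
    (hσ : HolSectionAt σ q₁) (q₂ : CotGr H n) (a : TangentSpace 𝓘(ℂ, Model H n) q₁)
    (b : TangentSpace 𝓘(ℂ, Model H n) q₂) :
    extCov (tautConnection H n) propagator q₁ q₂ a b σ = toFib q₂
      (((tangentAt q₁ a : H →L[ℂ] H) + (tangentAt q₂ b : H →L[ℂ] H)) (σ q₁)) := by
  have hσ' : MDifferentiableAt 𝓘(ℂ, Model H n) 𝓘(ℂ, H) (fun x => (σ x : H)) q₁ :=
    (contMDiffAt_section_iff.1 hσ).mdifferentiableAt (by simp)
  have h1 : tautConnection H n (fun q => propagator q₁ q (σ q₁)) q₂ b =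
      toFib q₂ ((tangentAt q₂ b : H →L[ℂ] H) (σ q₁)) :=
    congrArg (toFib q₂) (hasMFDerivAt_op_const q₂ (σ q₁ : H) b).2
  have h2 : dirDeriv (fun q => propagator q q₂ (σ q)) q₁ a =
      toFib q₂ (dirDeriv (fun x => (σ x : H)) q₁ a) := dirDeriv_clm_comp (toFib q₂) hσ' a
  have h3 : propagator q₁ q₂ (tautConnection H n σ q₁ a) =
      toFib q₂ (q₁.op (dirDeriv (fun x => (σ x : H)) q₁ a)) := rfl
  rw [extCov, h1, h2, h3, ← map_sub, dirDeriv_section hσ' a, map_add q₁.op,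
    ← map_add (toFib q₂)]
  have h4 : q₁.op ((tangentAt q₁ a : H →L[ℂ] H) (σ q₁)) = 0 := by
    have := tangent_apply_apply q₁.idem (tangentAt q₁ a).2 (σ q₁ : H)
    rwa [op_fib] at this
  have h5 : ∀ v, q₁.op (q₁.op v) = q₁.op v := fun v => (toFib q₁ v).2
  rw [h4, h5, zero_add, add_sub_cancel_right, add_comm]
  rfl

/-- With `v = q₁v`, the expression is `q₂(A + B)v - q₂[A, q₁]v + q₂[B, q₂]v`. Since `q₁Aq₁ = 0`,
`[A, q₁]v = Av`; since `q₂Bq₂ = 0`, `q₂[B, q₂] = -q₂B`. All terms cancel. -/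
theorem isPolarized_propagator : IsPolarized (tautConnection H n) propagator := by
  intro q₁ q₂ a b σ hσ
  rw [extCov_tautConnection hσ, extCov_tautConnection hσ, ← map_smul, ← map_sub]
  apply Subtype.ext
  have h1 : (tangentAt q₁ (-cplxJ q₁ a) : H →L[ℂ] H) =
      -(Complex.I • twist q₁.op (tangentAt q₁ a : H →L[ℂ] H)) := by
    rw [map_neg, Submodule.coe_neg, tangentAt_cplxJ]
  rw [h1, tangentAt_cplxJ]
  change q₂.op _ = 0
  set A := (tangentAt q₁ a : H →L[ℂ] H) with hA
  set B := (tangentAt q₂ b : H →L[ℂ] H) with hB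
  have h4 : q₁.op (A (σ q₁)) = 0 := by
    have := tangent_apply_apply q₁.idem (tangentAt q₁ a).2 (σ q₁ : H)
    rwa [op_fib] at this
  have h5 := tangent_apply_apply q₂.idem (tangentAt q₂ b).2 (σ q₁ : H)
  have h6 : ∀ v, q₂.op (q₂.op v) = q₂.op v := fun v => (toFib q₂ v).2
  rw [← hB] at h5
  simp only [twist, add_apply, neg_apply, smul_apply, sub_apply, mul_apply_eq_comp, op_fib, h4,
    smul_add, smul_neg, smul_smul, Complex.I_mul_I, map_sub, map_add, map_neg, map_smul,
    map_zero, h5, h6, smul_sub]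
  module

end Connection

/-! ### Curvature and its trace -/

section Curvature

variable {H : Type*} [NormedAddCommGroup H] [InnerProductSpace ℂ H] [FiniteDimensional ℂ H] {n : ℕ}

/-- The curvature `q [A, B]` of the tautological connection. -/
def tautCurvature (q : CotGr H n) : TangentSpace 𝓘(ℂ, Model H n) q →ₗ[ℂ]
    TangentSpace 𝓘(ℂ, Model H n) q →ₗ[ℂ] (Taut q →ₗ[ℂ] Taut q) :=
  LinearMap.mk₂ ℂ (fun a b => ((toFib q ∘L
    ((tangentAt q a : H →L[ℂ] H) * (tangentAt q b : H →L[ℂ] H) -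
      (tangentAt q b : H →L[ℂ] H) * (tangentAt q a : H →L[ℂ] H)) ∘L (fib q.op).subtypeL :
        Taut q →L[ℂ] Taut q) : Taut q →ₗ[ℂ] Taut q))
    (fun a a' b => by
      ext v
      simp [mul_add, add_mul]
      abel)
    (fun c a b => by
      ext v
      simp [smul_sub])
    (fun a b b' => by
      ext v
      simp [mul_add, add_mul]
      abel)
    (fun c a b => by
      ext v
      simp [smul_sub])

theorem tautCurvature_apply (q : CotGr H n) (a b : TangentSpace 𝓘(ℂ, Model H n) q) (v : Taut q) :
    tautCurvature q a b v = toFib q ((tangentAt q a : H →L[ℂ] H) ((tangentAt q b : H →L[ℂ] H) v) -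
      (tangentAt q b : H →L[ℂ] H) ((tangentAt q a : H →L[ℂ] H) v)) := rfl

omit [FiniteDimensional ℂ H] in
theorem toFib_tangent (q : CotGr H n) (A : tangentSubmodule q.op) (v : H) :
    toFib q ((A : H →L[ℂ] H) (q.op v)) = 0 :=
  Subtype.ext (tangent_apply_apply q.idem A.2 v)

/-- In `d(x · dσ(Y))(a)` the derivative of the projection contributes `A(dσ(Y))`. After applying
`q`, the part of `dσ(Y)` in the fibre is killed by `qAq = 0`, which leaves `qABσ`. The remaining
second-derivative term is what the bracket cancels on antisymmetrization. -/
theorem tautConnection_tautConnection {σ : ∀ q : CotGr H n, Taut q} {q : CotGr H n}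
    (hσ : HolSectionAt σ q) {Y : ∀ q : CotGr H n, TangentSpace 𝓘(ℂ, Model H n) q}
    (hY : HolFieldAt Y q) (a : TangentSpace 𝓘(ℂ, Model H n) q) :
    tautConnection H n (fun x => tautConnection H n σ x (Y x)) q a =
      toFib q ((tangentAt q a : H →L[ℂ] H) ((tangentAt q (Y q) : H →L[ℂ] H) (σ q))) +
      toFib q (dirDeriv (fun x => dirDeriv (fun y => (σ y : H)) x (Y x)) q a) := by
  have hσ' := contMDiffAt_section_iff.1 hσ
  have h1 := dirDeriv_op_apply (mdifferentiableAt_dirDeriv hσ' hY) a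
  have h2 : toFib q (dirDeriv (fun y => (σ y : H)) q (Y q)) = tautConnection H n σ q (Y q) := rfl
  refine (congrArg (toFib q) h1).trans ?_
  have h3 : ∀ v, toFib q (q.op v) = toFib q v := fun v => Subtype.ext (toFib q v).2
  rw [map_add, h3, dirDeriv_section (hσ'.mdifferentiableAt (by simp)), map_add,
    map_add (toFib q), toFib_tangent, add_zero]

theorem isCurvature_tautCurvature : IsCurvature (tautConnection H n) tautCurvature := by
  intro q X Y σ hX hY hσ
  have hσ' := contMDiffAt_section_iff.1 hσ
  have h := congrArg (toFib q) (dirDeriv_mlieBracket hσ' hX hY)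
  rw [map_sub] at h
  rw [curvatureOp, tautConnection_tautConnection hσ hY, tautConnection_tautConnection hσ hX,
    tautConnection_apply, h, tautCurvature_apply, map_sub]
  abel

/-- The curvature is `q ∘ C ∘ inclusion` with `C = [A, B]`; cyclicity turns its trace on the fibre
into the trace of `Cq`, hence of `qC`, on `H`. -/
theorem trace_tautCurvature (q : CotGr H n) (a b : TangentSpace 𝓘(ℂ, Model H n) q) :
    Complex.I * ((n : ℂ)⁻¹ * LinearMap.trace ℂ (Taut q) (tautCurvature q a b)) =
          omegaForm n q.op (tangentAt q a) (tangentAt q b) := by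
  set C : H →L[ℂ] H := (tangentAt q a : H →L[ℂ] H) * (tangentAt q b : H →L[ℂ] H) -
      (tangentAt q b : H →L[ℂ] H) * (tangentAt q a : H →L[ℂ] H) with hC
  have h : tautCurvature q a b = (toFib q : H →ₗ[ℂ] Taut q) ∘ₗ
      ((C : H →ₗ[ℂ] H) ∘ₗ (fib q.op).subtype) := rfl
  have h2 : ((q.op * C : H →L[ℂ] H) : H →ₗ[ℂ] H) = (q.op : H →ₗ[ℂ] H) * (C : H →ₗ[ℂ] H) := rfl
  rw [h, LinearMap.trace_comp_comm', omegaForm, normTrace, h2, LinearMap.trace_mul_comm]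
  rfl

end Curvature

/-! ### Holomorphy of the connection -/

section Smooth

variable {H : Type*} [NormedAddCommGroup H] [InnerProductSpace ℂ H] [FiniteDimensional ℂ H] {n : ℕ}

theorem contMDiffCovariantDerivativeOn_tautConnection {U : Set (CotGr H n)} (hU : IsOpen U) :
    ContMDiffCovariantDerivativeOn (FibModel n) ω (tautConnection H n) U where
  contMDiff := by
    intro σ hσ q hq
    refine ContMDiffAt.contMDiffWithinAt ?_
    rw [contMDiffAt_hom_bundle]
    refine ⟨contMDiffAt_id, ?_⟩
    have h1 : ContMDiffAt 𝓘(ℂ, Model H n) 𝓘(ℂ, H) ω (fun x => (σ x : H)) q :=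
      contMDiffAt_section_iff.1 ((hσ q hq).contMDiffAt (hU.mem_nhds hq))
    have h2 := h1.mfderiv_const (m := ω) (by simp)
    have h3 : ContMDiffAt 𝓘(ℂ, Model H n) 𝓘(ℂ, Model H n →L[ℂ] FibModel n) ω (fun x : CotGr H n =>
        ((fibEquiv q : Taut q →L[ℂ] FibModel n) ∘L toFib q) ∘L x.op ∘L
          (inTangentCoordinates 𝓘(ℂ, Model H n) 𝓘(ℂ, H) id (fun x => (σ x : H))
            (mfderiv 𝓘(ℂ, Model H n) 𝓘(ℂ, H) (fun x => (σ x : H))) q x)) q :=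
      contMDiffAt_const.clm_comp (contMDiff_op.contMDiffAt.clm_comp h2)
    refine h3.congr_of_eventuallyEq ?_
    filter_upwards [(isOpen_trivBase q).mem_nhds (mem_chart_source q).1] with x hx
    have h4 := continuousLinearMapAt_taut q x hx
    refine ContinuousLinearMap.ext fun v => ?_
    refine (DFunLike.congr_fun h4 _).trans ?_
    -- The target `H` is a vector space, so its tangent trivialization is the identity and only the
    -- source is trivialized.
    have h5 : inTangentCoordinates 𝓘(ℂ, Model H n) 𝓘(ℂ, H) id (fun x => (σ x : H))
            (mfderiv 𝓘(ℂ, Model H n) 𝓘(ℂ, H) (fun x => (σ x : H))) q x v =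
      mfderiv 𝓘(ℂ, Model H n) 𝓘(ℂ, H) (fun x => (σ x : H)) x
        ((trivializationAt (Model H n) (TangentSpace 𝓘(ℂ, Model H n)) q).symmL ℂ x v) := by
      have h6 := TangentBundle.continuousLinearMapAt_model_space (𝕜 := ℂ) (σ q : H) (σ x : H)
      exact DFunLike.congr_fun h6 _
    exact congrArg (fun w : H => fibEquiv q (toFib q (x.op w))) h5.symm

end Smooth

/-! ### The Cayley-type chart and self-adjointness -/

section StarRing

variable {R : Type*} [Ring R] {p q A : R}

theorem commute_one_add_mul_one_sub (hA : p * A + A * p = A) :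
    p * ((1 - A) * (1 + A)) = (1 - A) * (1 + A) * p := by
  have h : p * (A * A) = A * A * p := by
    have h1 : p * A = A - A * p := eq_sub_of_add_eq hA
    calc p * (A * A) = p * A * A := by rw [mul_assoc]
      _ = A * A - A * (p * A) := by rw [h1, sub_mul, mul_assoc, ← h1]
      _ = A * A * p := by rw [h1, mul_sub, sub_sub_cancel, mul_assoc]
  calc p * ((1 - A) * (1 + A)) = p - p * (A * A) := by noncomm_ring
    _ = (1 - A) * (1 + A) * p := by rw [h]; noncomm_ring

theorem rotate_mul (hU : IsUnit (1 + A)) : rotate p A * (1 + A) = (1 + A) * p := by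
  rw [rotate, mul_assoc, Ring.inverse_mul_cancel _ hU, mul_one]

/-- Conjugation by `1 + A` and by `(1 - A)⁻¹` act alike on `p`, because their quotient `(1 - A)(1 +
A) = 1 - A²` commutes with `p`: the square of a block-off-diagonal element is block-diagonal. -/
theorem one_sub_mul_rotate (hA : p * A + A * p = A) (hU : IsUnit (1 + A)) :
    (1 - A) * rotate p A = p * (1 - A) := by
  apply hU.mul_right_cancel
  rw [mul_assoc, rotate_mul hU, ← mul_assoc, mul_assoc p, commute_one_add_mul_one_sub hA]

theorem eq_rotate_of_one_sub_mul (hp : p * p = p) (hA : p * A + A * p = A) (hU : IsUnit (1 + A))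
    (h : (1 - A) * q = p * (1 - A)) : q = rotate p A :=
  (unit_neg hp hA hU).mul_left_cancel (h.trans (one_sub_mul_rotate hA hU).symm)

variable [StarRing R]

/-- Conjugation by the Cayley-type transform of a skew-adjoint tangent vector preserves
self-adjointness. -/
theorem star_rotate (hp : p * p = p) (hps : star p = p) (hA : p * A + A * p = A)
    (hU : IsUnit (1 + A)) (hAs : star A = -A) : star (rotate p A) = rotate p A := by
  apply eq_rotate_of_one_sub_mul hp hA hU
  have := congrArg star (rotate_mul (p := p) hU)
  simpa [hps, hAs, sub_eq_add_neg] using this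

/-- Write `q(1 + A) = (1 + A)p` with `A` off-diagonal. The adjoint relation says that `-A*`, also
off-diagonal, rotates `p` into `q` too; since `rotate_data` recovers the off-diagonal element from
`q`, `A = -A*`. -/
theorem star_normMover (hp : p * p = p) (hps : star p = p) (hq : q * q = q) (hqs : star q = q)
    (hD : IsUnit (diagPart p q)) (hg : IsUnit (mover p q)) :
    star (normMover p q - 1) = -(normMover p q - 1) := by
  set A := normMover p q - 1 with hA
  have hAt : p * A + A * p = A := normMover_tangent hp hD
  have hU : IsUnit (1 + A) := by
    rw [hA, add_sub_cancel]; exact hg.mul hD.ringInverse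
  have hr : rotate p A = q := rotate_normMover hp hq hD hg
  have hBt : p * (-star A) + (-star A) * p = -star A := by
    have := congrArg (fun x => -star x) hAt
    simp only [star_add, star_mul, hps] at this
    rw [mul_neg, neg_mul, ← this]; abel
  have hV : IsUnit (1 + -star A) := by
    have := (unit_neg hp hAt hU).star
    rwa [star_sub, star_one, sub_eq_add_neg] at this
  have h1 : (1 - -star A) * q = p * (1 - -star A) := by
    have := congrArg star (rotate_mul (p := p) hU)
    rw [hr] at this
    simpa [hps, hqs] using this
  have h2 := eq_rotate_of_one_sub_mul hp hBt hV h1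
  have h3 := (rotate_data hp hBt hV).2.2
  rw [← h2] at h3
  have h4 : A = -star A := hA.trans (by rw [h3, add_sub_cancel_left])
  rw [eq_comm, neg_eq_iff_eq_neg]; exact h4

end StarRing

/-! ### Hermitian tangent vectors -/

section Hermitian

variable {H : Type*} [NormedAddCommGroup H] [InnerProductSpace ℂ H] [FiniteDimensional ℂ H]
  [CompleteSpace H] {n : ℕ}

/-- If `Av = -v` with `A` skew, then `⟨v, v⟩ = -⟨v, v⟩`, so `-1` is not an eigenvalue. Hence the
charts of the zero section are parametrized by the whole Hermitian tangent space. -/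
theorem isUnit_one_add_of_skew {A : H →L[ℂ] H} (hA : star A = -A) : IsUnit (1 + A) := by
  have hinj : Function.Injective (1 + A : H →L[ℂ] H) := by
    rw [injective_iff_map_eq_zero]
    intro v hv
    have h1 : A v = -v := by
      rw [add_apply, one_apply_eq_self] at hv
      exact eq_neg_of_add_eq_zero_right hv
    have h2 : inner ℂ (A v) v = inner ℂ v (star A v) :=
      (ContinuousLinearMap.adjoint_inner_right A v v).symm
    rw [hA, neg_apply, h1, neg_neg, inner_neg_left] at h2
    have h3 : (2 : ℂ) * inner ℂ v v = 0 := by linear_combination -h2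
    simpa using h3
  rw [ContinuousLinearMap.isUnit_iff_bijective]
  exact ⟨hinj, (LinearMap.injective_iff_surjective (f := ((1 + A : H →L[ℂ] H) : H →ₗ[ℂ] H))).1 hinj⟩

omit [FiniteDimensional ℂ H] in
theorem star_op (q : ZeroSection H n) : star q.1.op = q.1.op :=
  ((ContinuousLinearMap.eq_adjoint_iff _ _).2 q.2).symm

omit [FiniteDimensional ℂ H] in
theorem hermitian_of_star {q : H →L[ℂ] H} (hq : star q = q) (v w : H) :
    inner ℂ (q v) w = inner ℂ v (q w) :=
  ((ContinuousLinearMap.eq_adjoint_iff q q).1 hq.symm) v w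

/-- The tangent space of the zero section at `p`: the Hermitian tangent vectors. -/
def hermTangent (p : H →L[ℂ] H) : Submodule ℝ (H →L[ℂ] H) :=
  (tangentSubmodule p).restrictScalars ℝ ⊓ selfAdjoint.submodule ℝ (H →L[ℂ] H)

omit [FiniteDimensional ℂ H] in
theorem mem_hermTangent {p A : H →L[ℂ] H} :
    A ∈ hermTangent p ↔ p * A + A * p = A ∧ star A = A := Iff.rfl

omit [FiniteDimensional ℂ H] in
theorem star_mem_tangent {p A : H →L[ℂ] H} (hp : star p = p) (hA : A ∈ tangentSubmodule p) :
    star A ∈ tangentSubmodule p := by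
  have := congrArg star (show p * A + A * p = A from hA)
  rw [star_add, star_mul, star_mul, hp, add_comm] at this
  exact this

/-- `T_p` is the complexification of the space of Hermitian tangent vectors. -/
def complexifyTangent (p : ZeroSection H n) :
    (hermTangent p.1.op × hermTangent p.1.op) ≃ₗ[ℝ] tangentSubmodule p.1.op where
  toFun x := ⟨x.1.1 + Complex.I • x.2.1,
    Submodule.add_mem _ x.1.2.1 (Submodule.smul_mem _ _ x.2.2.1)⟩
  map_add' x y := by
    ext1
    simp only [Prod.fst_add, Prod.snd_add, Submodule.coe_add, smul_add]
    abel
  map_smul' c x := by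
    ext1
    simp only [Prod.smul_fst, Prod.smul_snd, Submodule.coe_smul, RingHom.id_apply]
    rw [smul_comm]
    exact (smul_add c _ _).symm
  -- The real and imaginary parts `(A + A*)/2` and `(A - A*)/(2i)`; both stay tangent because `p` is
  -- Hermitian.
  invFun A := (⟨(2⁻¹ : ℂ) • ((A : H →L[ℂ] H) + star (A : H →L[ℂ] H)), by
      refine mem_hermTangent.2 ⟨Submodule.smul_mem _ _ (Submodule.add_mem _ A.2
        (star_mem_tangent (star_op p) A.2)), ?_⟩
      simp [add_comm]⟩,
    ⟨(-Complex.I * 2⁻¹ : ℂ) • ((A : H →L[ℂ] H) - star (A : H →L[ℂ] H)), by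
      refine mem_hermTangent.2 ⟨Submodule.smul_mem _ _ (Submodule.sub_mem _ A.2
        (star_mem_tangent (star_op p) A.2)), ?_⟩
      simp [star_smul, smul_sub, -smul_neg, add_comm]⟩)
  left_inv x := by
    obtain ⟨⟨A, hA⟩, ⟨B, hB⟩⟩ := x
    ext1 <;> ext1
    · simp only [star_add, star_smul, (mem_hermTangent.1 hA).2, (mem_hermTangent.1 hB).2]
      simp
      module
    · simp only [star_add, star_smul, (mem_hermTangent.1 hA).2, (mem_hermTangent.1 hB).2]
      simp only [Complex.star_def, Complex.conj_I]
      match_scalars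
      · simp
      · linear_combination (-1 : ℂ) * Complex.I_sq
  right_inv A := by
    ext1
    simp only
    match_scalars
    all_goals (ring_nf; simp; try norm_num)

/-- Twice this real dimension is the real dimension of `T_p`, which is twice its complex dimension
`2 · halfDim`. -/
theorem finrank_hermTangent (p : ZeroSection H n) :
    Module.finrank ℝ (hermTangent p.1.op) = Module.finrank ℝ (Coord H n) := by
  have h := (complexifyTangent p).finrank_eq
  rw [Module.finrank_prod, finrank_real_of_complex, finrank_tangent, finrank_euclideanSpace_fin] at h
  rw [Module.finrank_fintype_fun_eq_card, Fintype.card_prod, Fintype.card_fin, Fintype.card_fin]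
  simp only [halfDim]
  omega

/-- Real linear coordinates on the Hermitian tangent vectors. -/
def hermVec (p : ZeroSection H n) : Coord H n ≃L[ℝ] hermTangent p.1.op :=
  (ContinuousLinearEquiv.ofFinrankEq (finrank_hermTangent p)).symm

end Hermitian

/-! ### Wedge powers as alternating maps -/

section Wedge

variable {V : Type*} [AddCommGroup V] [Module ℝ V]

/-- The product `∏ α(v_{i,0}, v_{i,1})`, as a multilinear map. -/
def pairProd (α : V →ₗ[ℝ] V →ₗ[ℝ] ℂ) (m : ℕ) : MultilinearMap ℝ (fun _ : Fin m × Fin 2 => V) ℂ where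
  toFun v := ∏ i, α (v (i, 0)) (v (i, 1))
  map_update_add' := by
    intro _ v j x y
    obtain ⟨i, b⟩ := j
    rw [← Finset.mul_prod_erase _ _ (Finset.mem_univ i), ← Finset.mul_prod_erase _ _
      (Finset.mem_univ i), ← Finset.mul_prod_erase _ _ (Finset.mem_univ i)]
    have h : ∀ z, ∏ k ∈ Finset.univ.erase i, α (Function.update v (i, b) z (k, 0))
        (Function.update v (i, b) z (k, 1)) = ∏ k ∈ Finset.univ.erase i, α (v (k, 0)) (v (k, 1)) := by
      intro z
      refine Finset.prod_congr rfl fun k hk => ?_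
      have hk' := Finset.ne_of_mem_erase hk
      rw [Function.update_of_ne (by simp [hk']), Function.update_of_ne (by simp [hk'])]
    rw [h, h, h, ← add_mul]
    congr 1
    fin_cases b <;> simp
  map_update_smul' := by
    intro _ v j c x
    obtain ⟨i, b⟩ := j
    rw [← Finset.mul_prod_erase _ _ (Finset.mem_univ i), ← Finset.mul_prod_erase _ _
      (Finset.mem_univ i)]
    have h : ∀ z, ∏ k ∈ Finset.univ.erase i, α (Function.update v (i, b) z (k, 0))
        (Function.update v (i, b) z (k, 1)) = ∏ k ∈ Finset.univ.erase i, α (v (k, 0)) (v (k, 1)) := by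
      intro z
      refine Finset.prod_congr rfl fun k hk => ?_
      have hk' := Finset.ne_of_mem_erase hk
      rw [Function.update_of_ne (by simp [hk']), Function.update_of_ne (by simp [hk'])]
    rw [h, h, ← smul_mul_assoc]
    congr 1
    fin_cases b <;> simp

/-- The wedge power of a bilinear form, as an alternating map. -/
def wedgeAlt (α : V →ₗ[ℝ] V →ₗ[ℝ] ℂ) (m : ℕ) : V [⋀^(Fin m × Fin 2)]→ₗ[ℝ] ℂ :=
  ((2 : ℝ) ^ m)⁻¹ • MultilinearMap.alternatization (pairProd α m)

/-- Makes multilinear algebra available for `wedgePow`: transformation by determinants and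
determination by one basis. -/
theorem wedgeAlt_apply (α : V →ₗ[ℝ] V →ₗ[ℝ] ℂ) (m : ℕ) (v : Fin m × Fin 2 → V) :
    wedgeAlt α m v = wedgePow (fun x y => α x y) m v := by
  rw [wedgeAlt, AlternatingMap.smul_apply, MultilinearMap.alternatization_apply, wedgePow,
    Complex.real_smul]
  push_cast
  congr 1
  refine Finset.sum_congr rfl fun s _ => ?_
  rw [Units.smul_def, zsmul_eq_mul]
  rfl

theorem alternating_det {ι : Type*} [Fintype ι] [DecidableEq ι]
    (f : (ι → ℝ) [⋀^ι]→ₗ[ℝ] ℂ) (L : (ι → ℝ) →ₗ[ℝ] (ι → ℝ)) :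
    f (fun j => L (Pi.single j 1)) = ((LinearMap.det L : ℝ) : ℂ) * f (fun j => Pi.single j 1) := by
  have key : ∀ (g : (ι → ℝ) [⋀^ι]→ₗ[ℝ] ℝ),
      g (fun j => L (Pi.single j 1)) = LinearMap.det L * g (fun j => Pi.single j 1) := by
    intro g
    have h := (Pi.basisFun ℝ ι).det_comp L (Pi.basisFun ℝ ι)
    have e : (fun j => (Pi.single j 1 : ι → ℝ)) = Pi.basisFun ℝ ι := by
      ext j; simp
    have e2 : (fun j => L (Pi.single j 1 : ι → ℝ)) = L ∘ Pi.basisFun ℝ ι := by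
      ext j; simp
    rw [e2, e, AlternatingMap.eq_smul_basis_det (Pi.basisFun ℝ ι) g]
    simp only [AlternatingMap.smul_apply, h, smul_eq_mul, Module.Basis.det_self]
    ring
  -- Real-valued alternating maps of top degree are multiples of the determinant, so real and
  -- imaginary parts are treated separately.
  apply Complex.ext
  · have := key (Complex.reLm.compAlternatingMap f)
    simpa using this
  · have := key (Complex.imLm.compAlternatingMap f)
    simpa using this

end Wedge

/-! ### Nonvanishing of the wedge power on a symplectic basis -/

section SymplecticWedge

variable {V : Type*}

theorem perm_fin_two (e : Equiv.Perm (Fin 2)) :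
    e 0 = 0 ∧ e 1 = 1 ∧ Equiv.Perm.sign e = 1 ∨ e 0 = 1 ∧ e 1 = 0 ∧ Equiv.Perm.sign e = -1 := by
  revert e; decide

/-- A permutation that preserves the partition into pairs permutes the pairs, after permuting
each pair. -/
theorem exists_perm_of_preserves_pairs {m : ℕ} (s : Equiv.Perm (Fin m × Fin 2))
    (hs : ∀ i, (s (i, 0)).1 = (s (i, 1)).1) :
    ∃ (τ : Equiv.Perm (Fin m)) (f : Fin m → Equiv.Perm (Fin 2)),
      (∀ i b, s (i, b) = (τ i, f i b)) ∧ Equiv.Perm.sign s = ∏ i, Equiv.Perm.sign (f i) := by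
  have h1 : ∀ i b, (s (i, b)).1 = (s (i, 0)).1 := by
    intro i b
    fin_cases b
    · rfl
    · exact (hs i).symm
  have hf : ∀ i, Function.Bijective fun b => (s (i, b)).2 := by
    intro i
    refine Finite.injective_iff_bijective.1 fun b b' h => ?_
    have : s (i, b) = s (i, b') := Prod.ext ((h1 i b).trans (h1 i b').symm) h
    simpa using this
  have ht : Function.Bijective fun i => (s (i, 0)).1 := by
    refine Finite.injective_iff_bijective.1 fun i j h => ?_
    obtain ⟨b, hb⟩ := (hf i).2 (s (j, 0)).2
    have : s (i, b) = s (j, 0) := Prod.ext ((h1 i b).trans h) hb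
    exact congrArg Prod.fst (s.injective this)
  refine ⟨Equiv.ofBijective _ ht, fun i => Equiv.ofBijective _ (hf i), fun i b =>
    Prod.ext (h1 i b) rfl, ?_⟩
  have hsplit : s = Equiv.prodCongrLeft (fun _ : Fin 2 => Equiv.ofBijective _ ht) *
      Equiv.prodCongrRight fun i => Equiv.ofBijective _ (hf i) := by
    ext1 x
    exact Prod.ext (h1 x.1 x.2) rfl
  nth_rewrite 1 [hsplit]
  -- The permutation of the pairs acts on both entries of each pair, so its sign occurs twice and
  -- cancels; only the signs of the flips inside the pairs remain.
  rw [Equiv.Perm.sign_mul, Equiv.Perm.sign_prodCongrLeft, Equiv.Perm.sign_prodCongrRight,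
    Fin.prod_univ_two, Int.units_mul_self, one_mul]

/-- If `s` respects the pairs, each flip changes the sign of one factor and also the sign of `s`, so
the contribution is always `c ^ m`. Otherwise some factor pairs vectors from different pairs and is
zero. The sum has therefore no cancellation. -/
theorem wedgePow_symplectic_term {m : ℕ} {α : V → V → ℂ} {v : Fin m × Fin 2 → V} {c : ℂ}
    (h01 : ∀ i j, α (v (i, 0)) (v (j, 1)) = if i = j then c else 0)
    (h10 : ∀ i j, α (v (i, 1)) (v (j, 0)) = if i = j then -c else 0)
    (h00 : ∀ i j, α (v (i, 0)) (v (j, 0)) = 0) (h11 : ∀ i j, α (v (i, 1)) (v (j, 1)) = 0)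
    (s : Equiv.Perm (Fin m × Fin 2)) :
    ((Equiv.Perm.sign s : ℤ) : ℂ) * ∏ i : Fin m, α (v (s (i, 0))) (v (s (i, 1))) =
      if ∀ i, (s (i, 0)).1 = (s (i, 1)).1 then c ^ m else 0 := by
  split_ifs with hs
  · obtain ⟨τ, f, hf, hsign⟩ := exists_perm_of_preserves_pairs s hs
    have hterm : ∀ i, α (v (s (i, 0))) (v (s (i, 1))) =
        ((Equiv.Perm.sign (f i) : ℤ) : ℂ) * c := by
      intro i
      rw [hf, hf]
      rcases perm_fin_two (f i) with ⟨h0, h1, h2⟩ | ⟨h0, h1, h2⟩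
      · simp [h0, h1, h2, h01]
      · simp [h0, h1, h2, h10]
    rw [Finset.prod_congr rfl fun i _ => hterm i, Finset.prod_mul_distrib, ← mul_assoc, hsign,
      Units.coe_prod, Int.cast_prod, ← Finset.prod_mul_distrib,
      Finset.prod_congr rfl fun i _ => (by
        rw [← Int.cast_mul, ← Units.val_mul, Int.units_mul_self]; simp :
          ((Equiv.Perm.sign (f i) : ℤ) : ℂ) * ((Equiv.Perm.sign (f i) : ℤ) : ℂ) = 1)]
    simp
  · push Not at hs
    obtain ⟨i, hi⟩ := hs
    rw [Finset.prod_eq_zero (Finset.mem_univ i), mul_zero]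
    generalize s (i, 0) = x at hi ⊢
    generalize s (i, 1) = y at hi ⊢
    obtain ⟨a, b⟩ := x
    obtain ⟨a', b'⟩ := y
    fin_cases b <;> fin_cases b' <;> simp [h00, h01, h10, h11, show a ≠ a' from hi]

theorem wedgePow_symplectic_ne_zero {m : ℕ} {α : V → V → ℂ} {v : Fin m × Fin 2 → V} {c : ℂ}
    (hc : c ≠ 0) (h01 : ∀ i j, α (v (i, 0)) (v (j, 1)) = if i = j then c else 0)
    (h10 : ∀ i j, α (v (i, 1)) (v (j, 0)) = if i = j then -c else 0)
    (h00 : ∀ i j, α (v (i, 0)) (v (j, 0)) = 0) (h11 : ∀ i j, α (v (i, 1)) (v (j, 1)) = 0) :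
    wedgePow α m v ≠ 0 := by
  rw [wedgePow, Finset.sum_congr rfl fun s _ => wedgePow_symplectic_term h01 h10 h00 h11 s,
    Finset.sum_ite, Finset.sum_const_zero, add_zero, Finset.sum_const, nsmul_eq_mul]
  refine mul_ne_zero (by simp) (mul_ne_zero (Nat.cast_ne_zero.2 ?_) (pow_ne_zero _ hc))
  exact Finset.card_ne_zero.2 ⟨1, by simp⟩

end SymplecticWedge

/-! ### The density of `Ω^top` in coordinates -/

section Density

variable {H : Type*} [NormedAddCommGroup H] [InnerProductSpace ℂ H] {n : ℕ}

variable (n) in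
/-- The form `Ω_q` as a real bilinear map. -/
def omegaLin (q : H →L[ℂ] H) : (H →L[ℂ] H) →ₗ[ℝ] (H →L[ℂ] H) →ₗ[ℝ] ℂ :=
  LinearMap.mk₂ ℝ (fun A B => omegaForm n q A B)
    (fun A A' B => by
      simp [omegaForm, normTrace, add_mul, mul_add, mul_sub]; ring)
    (fun c A B => by
      have h : q * (c • A * B - B * (c • A)) = (c : ℂ) • (q * (A * B - B * A)) := by
        simp [mul_sub, smul_sub]
      rw [omegaForm, h, normTrace, ContinuousLinearMap.toLinearMap_smul, map_smul, omegaForm,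
        normTrace, Complex.real_smul, smul_eq_mul]
      ring)
    (fun A B B' => by
      simp [omegaForm, normTrace, add_mul, mul_add, mul_sub]; ring)
    (fun c A B => by
      have h : q * (A * (c • B) - (c • B) * A) = (c : ℂ) • (q * (A * B - B * A)) := by
        simp [mul_sub, smul_sub]
      rw [omegaForm, h, normTrace, ContinuousLinearMap.toLinearMap_smul, map_smul, omegaForm,
        normTrace, Complex.real_smul, smul_eq_mul]
      ring)

theorem omegaLin_apply (q A B : H →L[ℂ] H) : omegaLin n q A B = omegaForm n q A B := rfl

/-- The value of `Ω^top` on the coordinate vector fields of a parametrization `F`. -/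
def topDensity (F : Coord H n → H →L[ℂ] H) (x : Coord H n) : ℂ :=
  wedgePow (omegaForm n (F x)) (halfDim H n) fun j => fderiv ℝ F x (Pi.single j 1)

/-- By the chain rule, `Ω^top` pulled back along `G` is evaluated on the columns of `g'`; in top
degree this multiplies it by the determinant. This makes the measure independent of coordinates. -/
theorem topDensity_comp {F G : Coord H n → H →L[ℂ] H} {g : Coord H n → Coord H n}
    {g' : Coord H n →L[ℝ] Coord H n} {x : Coord H n} (hF : F =ᶠ[𝓝 x] G ∘ g)
    (hG : DifferentiableAt ℝ G (g x)) (hg : HasFDerivAt g g' x) :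
    topDensity F x = ((g'.det : ℝ) : ℂ) * topDensity G (g x) := by
  have h1 : fderiv ℝ F x = fderiv ℝ G (g x) ∘L g' :=
    ((hG.hasFDerivAt.comp x hg).congr_of_eventuallyEq hF).fderiv
  have h3 := alternating_det ((wedgeAlt (omegaLin n (G (g x))) (halfDim H n)).compLinearMap
    (fderiv ℝ G (g x)).toLinearMap) g'.toLinearMap
  simp only [AlternatingMap.compLinearMap_apply, wedgeAlt_apply, omegaLin_apply] at h3
  rw [topDensity, topDensity, h1, hF.eq_of_nhds]
  exact h3

theorem continuous_topDensity {F : Coord H n → H →L[ℂ] H} (hF : ContDiff ℝ ∞ F)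
    [FiniteDimensional ℂ H] : Continuous (topDensity F) := by
  have h1 : Continuous F := hF.continuous
  have h2 : ∀ v, Continuous fun x => fderiv ℝ F x v := fun v =>
    (hF.continuous_fderiv (by simp)).clm_apply continuous_const
  have h3 : Continuous fun A : H →L[ℂ] H => LinearMap.trace ℂ H (A : H →ₗ[ℂ] H) :=
    LinearMap.continuous_of_finiteDimensional
      (LinearMap.trace ℂ H ∘ₗ ContinuousLinearMap.coeLM ℂ)
  unfold topDensity wedgePow omegaForm normTrace
  refine continuous_const.mul (continuous_finsetSum _ fun s _ => continuous_const.mul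
    (continuous_finsetProd _ fun i _ => continuous_const.mul (continuous_const.mul
      (h3.comp (h1.mul (((h2 _).mul (h2 _)).sub ((h2 _).mul (h2 _))))))))

end Density

/-! ### Smooth parametrizations of the zero section -/

section Param

variable {H : Type*} [NormedAddCommGroup H] [InnerProductSpace ℂ H] [FiniteDimensional ℂ H]
  [CompleteSpace H] {n : ℕ}

/-- The inclusion of the Hermitian tangent vectors into the model space of `T*G_n H`. -/
def hermModel (p : ZeroSection H n) : Coord H n →L[ℝ] Model H n :=
  ((tangentVec p.1).symm : tangentSubmodule p.1.op →L[ℂ] Model H n).restrictScalars ℝ ∘L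
    LinearMap.toContinuousLinearMap ((Submodule.inclusion (inf_le_left :
      hermTangent p.1.op ≤ (tangentSubmodule p.1.op).restrictScalars ℝ)) ∘ₗ
        (hermVec p : Coord H n →ₗ[ℝ] hermTangent p.1.op))

theorem tangentVec_hermModel (p : ZeroSection H n) (x : Coord H n) :
    (tangentVec p.1 (hermModel p x) : H →L[ℂ] H) = hermVec p x := by
  change (tangentVec p.1 ((tangentVec p.1).symm _) : H →L[ℂ] H) = _
  rw [ContinuousLinearEquiv.apply_symm_apply]
  rfl

omit [FiniteDimensional ℂ H] in
theorem star_twist {p A : H →L[ℂ] H} (hp : star p = p) (hA : star A = A) :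
    star (twist p A) = -twist p A := by
  rw [twist, star_sub, star_mul, star_mul, hp, hA, neg_sub]

omit [FiniteDimensional ℂ H] in
theorem star_twist_of_skew {p A : H →L[ℂ] H} (hp : star p = p) (hA : star A = -A) :
    star (twist p A) = twist p A := by
  rw [twist, star_sub, star_mul, star_mul, hp, hA, mul_neg, neg_mul]
  abel

theorem hermModel_mem_target (p : ZeroSection H n) (x : Coord H n) :
    hermModel p x ∈ (chart p.1).target := by
  change IsUnit (1 + twist p.1.op (tangentVec p.1 (hermModel p x) : H →L[ℂ] H))
  rw [tangentVec_hermModel]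
  exact isUnit_one_add_of_skew (star_twist (star_op p) (hermVec p x).2.2)

/-- A smooth parametrization of the zero section near `p`. -/
def param (p : ZeroSection H n) (x : Coord H n) : ZeroSection H n :=
  ⟨(chart p.1).symm (hermModel p x), hermitian_of_star (by
    rw [chart_symm_op _ (hermModel_mem_target p x), chartInv, tangentVec_hermModel]
    have h := star_twist (star_op p) (hermVec p x).2.2
    exact star_rotate p.1.idem (star_op p) (twist_tangent p.1.idem) (isUnit_one_add_of_skew h) h)⟩

theorem param_op (p : ZeroSection H n) (x : Coord H n) :
    (param p x).1.op = chartInv p.1 (hermModel p x) :=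
  chart_symm_op _ (hermModel_mem_target p x)

theorem contDiff_param (p : ZeroSection H n) : ContDiff ℝ ∞ fun x => (param p x).1.op := by
  simp only [param_op]
  rw [contDiff_iff_contDiffAt]
  intro x
  have h := ((contDiffAt_chartInv p.1 (hermModel_mem_target p x)).restrict_scalars ℝ).of_le
    (le_top (a := ∞))
  exact h.comp x (hermModel p).contDiff.contDiffAt

theorem exists_hermVec_leftInverse (p : ZeroSection H n) : ∃ T : Model H n →L[ℝ] Coord H n,
    ∀ x, T (hermModel p x) = x := by
  have hinj : Function.Injective (hermModel p) := by
    intro x y hxy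
    have := congrArg (fun m => (tangentVec p.1 m : H →L[ℂ] H)) hxy
    simp only [tangentVec_hermModel] at this
    exact (hermVec p).injective (Subtype.ext this)
  obtain ⟨T, hT⟩ := LinearMap.exists_leftInverse_of_injective
    (hermModel p : Coord H n →ₗ[ℝ] Model H n) (LinearMap.ker_eq_bot.2 hinj)
  exact ⟨LinearMap.toContinuousLinearMap T, fun x => DFunLike.congr_fun hT x⟩

/-- A smooth left inverse of `param p`, defined near `p` in `B(H)`. -/
def coparam (p : ZeroSection H n) (q : H →L[ℂ] H) : Coord H n :=
  (exists_hermVec_leftInverse p).choose (chartFun p.1 q)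

theorem coparam_param (p : ZeroSection H n) (x : Coord H n) : coparam p (param p x).1.op = x := by
  have h := (chart p.1).right_inv (hermModel_mem_target p x)
  change chartFun p.1 (param p x).1.op = hermModel p x at h
  rw [coparam, h]
  exact (exists_hermVec_leftInverse p).choose_spec x

theorem contDiffAt_coparam (p : ZeroSection H n) {q : H →L[ℂ] H} (hq : IsUnit (diagPart p.1.op q)) :
    ContDiffAt ℝ ∞ (coparam p) q :=
  (exists_hermVec_leftInverse p).choose.contDiff.contDiffAt.comp q
    (((contDiffAt_chartFun p.1 hq).restrict_scalars ℝ).of_le le_top)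

theorem param_mem_source (p : ZeroSection H n) (x : Coord H n) :
    (param p x).1 ∈ (chart p.1).source :=
  (chart p.1).map_target (hermModel_mem_target p x)

/-- For Hermitian `q` in the chart domain, `normMover p q - 1` is skew by `star_normMover`, so its
commutator with `p` is a Hermitian tangent vector: the chart sends `q` into the range of
`hermModel`. -/
theorem param_coparam (p q : ZeroSection H n) (hq : q.1 ∈ (chart p.1).source) :
    param p (coparam p q.1.op) = q := by
  have h1 := star_normMover p.1.idem (star_op p) q.1.idem (star_op q) hq.1 hq.2
  have h2 := star_twist_of_skew (star_op p) h1
  obtain ⟨x, hx⟩ := (hermVec p).surjective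
    ⟨_, mem_hermTangent.2 ⟨twist_tangent (A := normMover p.1.op q.1.op - 1) p.1.idem, h2⟩⟩
  have h3 : chartFun p.1 q.1.op = hermModel p x := by
    rw [chartFun, ContinuousLinearEquiv.symm_apply_eq]
    apply Subtype.ext
    rw [twist_normMover, tangentVec_hermModel, hx]
  have h4 : q = param p x := Subtype.ext (by
    rw [← (chart p.1).left_inv hq]
    exact congrArg _ h3)
  rw [h4, coparam_param]

omit [FiniteDimensional ℂ H] [CompleteSpace H] in
theorem isEmbedding_zeroSection :
    Topology.IsEmbedding fun q : ZeroSection H n => q.1.op :=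
  isEmbedding_op.comp Topology.IsEmbedding.subtypeVal

theorem continuous_param (p : ZeroSection H n) : Continuous (param p) :=
  isEmbedding_zeroSection.isInducing.continuous_iff.2 (contDiff_param p).continuous

theorem param_injective (p : ZeroSection H n) : Function.Injective (param p) := fun x y h => by
  rw [← coparam_param p x, h, coparam_param]

theorem range_param (p : ZeroSection H n) :
    Set.range (param p) = {q | q.1 ∈ (chart p.1).source} :=
  Set.Subset.antisymm (Set.range_subset_iff.2 (param_mem_source p))
    fun q hq => ⟨_, param_coparam p q hq⟩

theorem isOpen_param_image (p : ZeroSection H n) {B : Set (Coord H n)} (hB : IsOpen B) :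
    IsOpen (param p '' B) := by
  have h : param p '' B = {q | q.1 ∈ (chart p.1).source} ∩ (fun q => coparam p q.1.op) ⁻¹' B := by
    ext q
    constructor
    · rintro ⟨x, hx, rfl⟩
      exact ⟨param_mem_source p x, by rwa [Set.mem_preimage, coparam_param]⟩
    · rintro ⟨hq, hB⟩
      exact ⟨_, hB, param_coparam p q hq⟩
  rw [h]
  refine ContinuousOn.isOpen_inter_preimage (fun q hq => ?_)
    ((chart p.1).open_source.preimage continuous_subtype_val) hB
  exact (ContinuousAt.comp (f := fun q : ZeroSection H n => q.1.op)
    (contDiffAt_coparam p hq.1).continuousAt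
    isEmbedding_zeroSection.continuous.continuousAt).continuousWithinAt

/-- Differentiating `coparam ∘ param = id` provides a left inverse of the derivative. -/
theorem fderiv_param_injective (p : ZeroSection H n) (x : Coord H n) :
    Function.Injective (fderiv ℝ (fun x => (param p x).1.op) x) := by
  have h1 := ((contDiffAt_coparam p (param_mem_source p x).1).differentiableAt (by simp)).hasFDerivAt
  have h2 := ((contDiff_param p).contDiffAt (x := x)).differentiableAt (by simp) |>.hasFDerivAt
  have h0 : (coparam p ∘ fun x => (param p x).1.op) = id := funext (coparam_param p)
  have h3 := h1.comp x h2
  rw [h0] at h3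
  have h4 := h3.unique (hasFDerivAt_id x)
  intro v w hvw
  have := DFunLike.congr_fun h4 v
  have h5 := DFunLike.congr_fun h4 w
  simp only [ContinuousLinearMap.comp_apply, hvw, ContinuousLinearMap.id_apply] at this h5
  exact this.symm.trans h5

end Param

/-! ### Existence, uniqueness and total mass of `Ω^top` -/

section Measure

open MeasureTheory

variable {H : Type*} [NormedAddCommGroup H] [InnerProductSpace ℂ H] [FiniteDimensional ℂ H]
  {n : ℕ}

instance : SecondCountableTopology (ZeroSection H n) :=
  have := FiniteDimensional.proper ℂ (H →L[ℂ] H)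
  isEmbedding_zeroSection.secondCountableTopology

omit [FiniteDimensional ℂ H] in
instance : T2Space (ZeroSection H n) := isEmbedding_zeroSection.t2Space

omit [FiniteDimensional ℂ H] in
theorem norm_op_le (q : ZeroSection H n) : ‖q.1.op‖ ≤ 1 := by
  refine ContinuousLinearMap.opNorm_le_bound _ zero_le_one fun v => ?_
  rw [one_mul]
  have h1 : inner ℂ (q.1.op v) (q.1.op v) = inner ℂ v (q.1.op v) := by
    rw [q.2]
    exact congrArg _ (toFib q.1 v).2
  have h2 : ‖q.1.op v‖ * ‖q.1.op v‖ ≤ ‖v‖ * ‖q.1.op v‖ := by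
    have := norm_inner_le_norm (𝕜 := ℂ) v (q.1.op v)
    rwa [← h1, inner_self_eq_norm_sq_to_K, norm_pow, RCLike.norm_ofReal, abs_norm, sq] at this
  by_contra h
  push Not at h
  nlinarith [norm_nonneg v, norm_nonneg (q.1.op v)]

/-- The defining equations are closed in `B(H)`, and orthogonal projections have norm at most one.
Compactness gives the finite covers and the integrability of all continuous integrands below. -/
instance : CompactSpace (ZeroSection H n) := by
  have hp := FiniteDimensional.proper ℂ (H →L[ℂ] H)
  have htr : Continuous fun A : H →L[ℂ] H => LinearMap.trace ℂ H (A : H →ₗ[ℂ] H) :=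
    LinearMap.continuous_of_finiteDimensional
      (LinearMap.trace ℂ H ∘ₗ ContinuousLinearMap.coeLM ℂ)
  have hr : Set.range (fun q : ZeroSection H n => q.1.op) =
      {A : H →L[ℂ] H | A * A = A} ∩ {A | LinearMap.trace ℂ H (A : H →ₗ[ℂ] H) = n} ∩
        {A | ∀ v w : H, inner ℂ (A v) w = inner ℂ v (A w)} := by
    ext A
    constructor
    · rintro ⟨q, rfl⟩
      exact ⟨⟨q.1.idem, q.1.trace_op⟩, q.2⟩
    · rintro ⟨⟨h1, h2⟩, h3⟩
      exact ⟨⟨⟨A, h1, h2⟩, h3⟩, rfl⟩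
  have hclosed : IsClosed (Set.range fun q : ZeroSection H n => q.1.op) := by
    rw [hr]
    refine ((isClosed_eq (by fun_prop) continuous_id).inter
      (isClosed_eq htr continuous_const)).inter ?_
    simp only [Set.ofPred_forall]
    refine isClosed_iInter fun v => isClosed_iInter fun w => isClosed_eq ?_ ?_
    · fun_prop
    · fun_prop
  have hcpt : IsCompact (Set.range fun q : ZeroSection H n => q.1.op) := by
    refine Metric.isCompact_of_isClosed_isBounded hclosed ?_
    refine (Metric.isBounded_closedBall (x := (0 : H →L[ℂ] H)) (r := 1)).subset ?_
    rintro _ ⟨q, rfl⟩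
    simpa using norm_op_le q
  rw [← isCompact_univ_iff, isEmbedding_zeroSection.isCompact_iff, Set.image_univ]
  exact hcpt

variable [CompleteSpace H]

theorem measurableEmbedding_param (p : ZeroSection H n) : MeasurableEmbedding (param p) :=
  (continuous_param p).measurableEmbedding (param_injective p)

/-- The measure with density `|Ω^top|` in the coordinates `param p`. -/
def localMeasure (p : ZeroSection H n) : Measure (ZeroSection H n) :=
  (volume.withDensity fun x => ‖topDensity (fun x => (param p x).1.op) x‖ₑ).map (param p)

theorem localMeasure_image (p : ZeroSection H n) {S : Set (Coord H n)} (hS : MeasurableSet S) :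
    localMeasure p (param p '' S) = ∫⁻ x in S, ‖topDensity (fun x => (param p x).1.op) x‖ₑ := by
  rw [localMeasure, (measurableEmbedding_param p).map_apply,
    Set.preimage_image_eq _ (param_injective p), withDensity_apply _ hS]

/-- The hypotheses on a smooth parametrization of an open part of the zero section. -/
structure IsParam (U : Set (Coord H n)) (ψ : Coord H n → ZeroSection H n) : Prop where
  isOpen : IsOpen U
  contDiffOn : ContDiffOn ℝ ∞ (fun x => (ψ x).1.op) U
  injOn : Set.InjOn ψ U
  injective_fderiv : ∀ x ∈ U, Function.Injective (fderiv ℝ (fun x => (ψ x).1.op) x)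

theorem isParam_param (p : ZeroSection H n) : IsParam Set.univ (param p) :=
  ⟨isOpen_univ, (contDiff_param p).contDiffOn, (param_injective p).injOn,
    fun x _ => fderiv_param_injective p x⟩

omit [FiniteDimensional ℂ H] [CompleteSpace H] in
theorem isTopMeasure_iff {μ : Measure (ZeroSection H n)} : IsTopMeasure μ ↔
    ∀ (U : Set (Coord H n)) (ψ : Coord H n → ZeroSection H n), IsParam U ψ →
      ∀ S ⊆ U, MeasurableSet S → μ (ψ '' S) = ∫⁻ x in S, ‖topDensity (fun x => (ψ x).1.op) x‖ₑ :=
  ⟨fun h U ψ hψ => h U ψ hψ.1 hψ.2 hψ.3 hψ.4, fun h U ψ h1 h2 h3 h4 => h U ψ ⟨h1, h2, h3, h4⟩⟩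

omit [FiniteDimensional ℂ H] [CompleteSpace H] in
theorem IsParam.continuousOn {U : Set (Coord H n)} {ψ : Coord H n → ZeroSection H n}
    (hψ : IsParam U ψ) : ContinuousOn ψ U :=
  isEmbedding_zeroSection.isInducing.continuousOn_iff.2 hψ.contDiffOn.continuousOn

/-- Change of variables along the transition map `g = coparam p ∘ ψ`; the Jacobian in the integral
is the factor in `topDensity_comp`. -/
theorem localMeasure_image_of_isParam (p : ZeroSection H n) {U : Set (Coord H n)}
    {ψ : Coord H n → ZeroSection H n} (hψ : IsParam U ψ) {S : Set (Coord H n)} (hSU : S ⊆ U)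
    (hS : MeasurableSet S) (hp : ψ '' S ⊆ Set.range (param p)) :
    localMeasure p (ψ '' S) = ∫⁻ x in S, ‖topDensity (fun x => (ψ x).1.op) x‖ₑ := by
  set g : Coord H n → Coord H n := fun x => coparam p (ψ x).1.op with hg
  have hsrc : ∀ x ∈ S, (ψ x).1 ∈ (chart p.1).source := fun x hx => by
    have := hp (Set.mem_image_of_mem ψ hx)
    rwa [range_param] at this
  have hpg : ∀ x, (ψ x).1 ∈ (chart p.1).source → param p (g x) = ψ x :=
    fun x hx => param_coparam p _ hx
  have hgd : ∀ x ∈ S, HasFDerivAt g (fderiv ℝ g x) x := fun x hx => by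
    have h1 := (hψ.contDiffOn.contDiffAt (hψ.isOpen.mem_nhds (hSU hx))).differentiableAt (by simp)
    have h2 := (contDiffAt_coparam p (hsrc x hx).1).differentiableAt (by simp)
    exact (h2.comp x h1).hasFDerivAt
  have hinj : Set.InjOn g S := fun x hx y hy h => hψ.injOn (hSU hx) (hSU hy) (by
    rw [← hpg x (hsrc x hx), h, hpg y (hsrc y hy)])
  have hgS : MeasurableSet (g '' S) :=
    measurable_image_of_fderivWithin hS (fun x hx => (hgd x hx).hasFDerivWithinAt) hinj
  have himg : ψ '' S = param p '' (g '' S) := by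
    rw [Set.image_image]
    exact Set.image_congr fun x hx => (hpg x (hsrc x hx)).symm
  rw [himg, localMeasure_image p hgS, lintegral_image_eq_lintegral_abs_det_fderiv_mul volume hS
    (fun x hx => (hgd x hx).hasFDerivWithinAt) hinj]
  refine setLIntegral_congr_fun hS fun x hx => ?_
  -- `S` is merely measurable, so to compare derivatives at `x` the identity is needed on a
  -- neighbourhood; the chart domain is open and `ψ` is continuous.
  have hev : (fun x => (ψ x).1.op) =ᶠ[𝓝 x] (fun x => (param p x).1.op) ∘ g := by
    have hc : ContinuousAt (fun x => (ψ x).1) x := continuous_subtype_val.continuousAt.comp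
      (hψ.continuousOn.continuousAt (hψ.isOpen.mem_nhds (hSU hx)))
    filter_upwards [hc.eventually ((chart p.1).open_source.mem_nhds (hsrc x hx))] with y hy
    exact congrArg (fun q : ZeroSection H n => q.1.op) (hpg y hy).symm
  have h1 := topDensity_comp hev
    ((contDiff_param p).contDiffAt.differentiableAt (by simp)) (hgd x hx)
  simp only [h1, enorm_mul]
  congr 1
  rw [← ofReal_norm, Complex.norm_real, Real.norm_eq_abs]

theorem param_zero (p : ZeroSection H n) : param p 0 = p := by
  have h1 := param_coparam p p (mem_chart_source p.1)
  have h2 : coparam p p.1.op = 0 := by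
    have : chartFun p.1 p.1.op = 0 := chart_self p.1
    rw [coparam, this, map_zero]
  rwa [h2] at h1

/-- Compactness. Unit balls are used because the continuous density is bounded on them, which later
makes the total mass finite. -/
theorem exists_cover : ∃ (N : ℕ) (c : Fin N → ZeroSection H n),
    ⋃ k, param (c k) '' Metric.ball 0 1 = Set.univ := by
  obtain ⟨t, ht⟩ := isCompact_univ.elim_finite_subcover
    (fun p : ZeroSection H n => param p '' Metric.ball 0 1)
    (fun p => isOpen_param_image p Metric.isOpen_ball)
    (fun p _ => Set.mem_iUnion.2 ⟨p, 0, by simp, param_zero p⟩)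
  refine ⟨t.card, fun k => (t.equivFin.symm k : ZeroSection H n), Set.eq_univ_of_forall fun q => ?_⟩
  obtain ⟨p, hp⟩ := Set.mem_iUnion.1 (ht (Set.mem_univ q))
  obtain ⟨hpt, hq⟩ := Set.mem_iUnion.1 hp
  exact Set.mem_iUnion.2 ⟨t.equivFin ⟨p, hpt⟩, by simpa using hq⟩

variable (H n) in
/-- A finite partition of the zero section into measurable sets, each contained in the image of the
unit ball under a parametrization. -/
theorem exists_partition : ∃ (N : ℕ) (c : Fin N → ZeroSection H n) (E : Fin N → Set (ZeroSection H n)),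
    (∀ k, MeasurableSet (E k)) ∧ (∀ k, E k ⊆ param (c k) '' Metric.ball 0 1) ∧
      Pairwise (Function.onFun Disjoint E) ∧ ⋃ k, E k = Set.univ := by
  obtain ⟨N, c, hc⟩ := exists_cover (H := H) (n := n)
  refine ⟨N, c, disjointed fun k => param (c k) '' Metric.ball 0 1, fun k => ?_, fun k =>
    disjointed_subset _ _, disjoint_disjointed _, ?_⟩
  · have hm : ∀ j, MeasurableSet (param (c j) '' Metric.ball 0 1) := fun j =>
      (isOpen_param_image (c j) Metric.isOpen_ball).measurableSet
    exact disjointedRec (p := MeasurableSet) (fun t j ht => ht.diff (hm j)) (hm k)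
  · rw [iUnion_disjointed, hc]

/-- The defining property fixes the measure of every Borel set inside one parametrized patch, and
the partition cuts any Borel set into finitely many such pieces. -/
theorem IsTopMeasure.ext {μ μ' : Measure (ZeroSection H n)} (h : IsTopMeasure μ)
    (h' : IsTopMeasure μ') : μ' = μ := by
  obtain ⟨N, c, E, hE, hc, hd, hu⟩ := exists_partition H n
  refine Measure.ext fun T hT => ?_
  have hT' : T = ⋃ k, T ∩ E k := by rw [← Set.inter_iUnion, hu, Set.inter_univ]
  have hdT : Pairwise (Function.onFun Disjoint fun k => T ∩ E k) := fun i j hij =>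
    (hd hij).mono Set.inter_subset_right Set.inter_subset_right
  rw [hT', measure_iUnion hdT fun k => hT.inter (hE k),
    measure_iUnion hdT fun k => hT.inter (hE k)]
  congr 1
  ext k
  have hsub : T ∩ E k ⊆ Set.range (param (c k)) :=
    (Set.inter_subset_right.trans (hc k)).trans (Set.image_subset_range _ _)
  have hm : MeasurableSet (param (c k) ⁻¹' (T ∩ E k)) :=
    (continuous_param (c k)).measurable (hT.inter (hE k))
  rw [← Set.image_preimage_eq_of_subset hsub,
    isTopMeasure_iff.1 h _ _ (isParam_param (c k)) _ (Set.subset_univ _) hm,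
    isTopMeasure_iff.1 h' _ _ (isParam_param (c k)) _ (Set.subset_univ _) hm]

variable (H n) in
-- Take on each piece of the partition the local measure of its patch. An arbitrary parametrization
-- is split along the preimages of the pieces, on each of which the change of variables applies.
theorem exists_isTopMeasure : ∃ μ : Measure (ZeroSection H n), IsTopMeasure μ := by
  obtain ⟨N, c, E, hE, hc, hd, hu⟩ := exists_partition H n
  refine ⟨∑ k, (localMeasure (c k)).restrict (E k), isTopMeasure_iff.2 fun U ψ hψ S hSU hS => ?_⟩
  -- `ψ` is continuous only on `U`, so measurability of the preimage is obtained in the subtype `S`.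
  have hm : ∀ k, MeasurableSet (S ∩ ψ ⁻¹' E k) := by
    intro k
    have h := (continuousOn_iff_continuous_domRestrict.1 (hψ.continuousOn.mono hSU)).measurable (hE k)
    have h2 := hS.subtype_image h
    rwa [show S.domRestrict ψ ⁻¹' E k = Subtype.val ⁻¹' (ψ ⁻¹' E k) from rfl,
      Subtype.image_preimage_coe] at h2
  have hS' : S = ⋃ k, S ∩ ψ ⁻¹' E k := by
    rw [← Set.inter_iUnion, ← Set.preimage_iUnion, hu, Set.preimage_univ, Set.inter_univ]
  have hdS : Pairwise (Function.onFun Disjoint fun k => S ∩ ψ ⁻¹' E k) := fun i j hij =>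
    ((hd hij).preimage ψ).mono Set.inter_subset_right Set.inter_subset_right
  nth_rewrite 2 [hS']
  rw [lintegral_iUnion hm hdS, tsum_fintype, Measure.coe_finsetSum, Finset.sum_apply]
  refine Finset.sum_congr rfl fun k _ => ?_
  rw [Measure.restrict_apply' (hE k), ← Set.image_inter_preimage]
  refine localMeasure_image_of_isParam (c k) hψ (Set.inter_subset_left.trans hSU) (hm k) ?_
  rw [Set.image_inter_preimage]
  exact (Set.inter_subset_right.trans (hc k)).trans (Set.image_subset_range _ _)

theorem IsTopMeasure.apply_param {μ : Measure (ZeroSection H n)} (h : IsTopMeasure μ)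
    (p : ZeroSection H n) {S : Set (Coord H n)} (hS : MeasurableSet S) :
    μ (param p '' S) = ∫⁻ x in S, ‖topDensity (fun x => (param p x).1.op) x‖ₑ :=
  isTopMeasure_iff.1 h _ _ (isParam_param p) S (Set.subset_univ _) hS

theorem IsTopMeasure.measure_univ_ne_top {μ : Measure (ZeroSection H n)} (h : IsTopMeasure μ) :
    μ Set.univ ≠ ⊤ := by
  obtain ⟨N, c, hc⟩ := exists_cover (H := H) (n := n)
  rw [← hc]
  refine (lt_of_le_of_lt (measure_iUnion_fintype_le _ _) ?_).ne
  refine ENNReal.sum_lt_top.2 fun k _ => ?_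
  rw [h.apply_param _ measurableSet_ball]
  have hcont := continuous_topDensity (contDiff_param (c k))
  obtain ⟨C, hC⟩ := (isCompact_closedBall (0 : Coord H n) 1).exists_bound_of_continuousOn
    hcont.continuousOn
  refine lt_of_le_of_lt (setLIntegral_mono (g := fun _ => ENNReal.ofReal C) measurable_const
    fun x hx => ?_) ?_
  · rw [← ofReal_norm]
    exact ENNReal.ofReal_le_ofReal (hC x (Metric.ball_subset_closedBall hx))
  · rw [setLIntegral_const]
    exact ENNReal.mul_lt_top ENNReal.ofReal_lt_top measure_ball_lt_top

/-- A continuous density with zero integral vanishes identically, since Lebesgue measure charges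
nonempty open sets. -/
theorem IsTopMeasure.measure_univ_ne_zero {μ : Measure (ZeroSection H n)} (h : IsTopMeasure μ)
    {p : ZeroSection H n} (hp : topDensity (fun x => (param p x).1.op) 0 ≠ 0) :
    μ Set.univ ≠ 0 := by
  intro h0
  have h1 := h.apply_param p MeasurableSet.univ
  rw [measure_mono_null (Set.subset_univ _) h0, setLIntegral_univ] at h1
  have hcont := (continuous_topDensity (contDiff_param p)).enorm
  rw [eq_comm, lintegral_eq_zero_iff hcont.measurable] at h1
  have h2 := Continuous.ae_eq_iff_eq volume hcont continuous_const |>.1 h1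
  exact hp (enorm_eq_zero.1 (congrFun h2 0))

end Measure

/-! ### Nondegeneracy of `Ω` on Hermitian tangent vectors -/

section Nondegenerate

open InnerProductSpace

variable {H : Type*} [NormedAddCommGroup H] [InnerProductSpace ℂ H] {n : ℕ}

/-- The Hermitian operator `α |w⟩⟨u| + ᾱ |u⟩⟨w|`. -/
def hermPair (α : ℂ) (u w : H) : H →L[ℂ] H :=
  α • rankOne ℂ w u + starRingEnd ℂ α • rankOne ℂ u w

theorem inner_eq_zero_of_fixed {p : ZeroSection H n} {u w : H} (hu : p.1.op u = u)
    (hw : p.1.op w = 0) : inner ℂ u w = 0 := by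
  rw [← hu, p.2, hw, inner_zero_right]

theorem inner_eq_zero_of_fixed' {p : ZeroSection H n} {u w : H} (hu : p.1.op u = u)
    (hw : p.1.op w = 0) : inner ℂ w u = 0 := by
  rw [← hu, ← p.2, hw, inner_zero_left]

theorem inner_op_of_fixed {p : ZeroSection H n} {u : H} (hu : p.1.op u = u) (v : H) :
    inner ℂ u (p.1.op v) = inner ℂ u v := by
  rw [← p.2, hu]

theorem inner_op_of_ker {p : ZeroSection H n} {w : H} (hw : p.1.op w = 0) (v : H) :
    inner ℂ w (p.1.op v) = 0 := by
  rw [← p.2, hw, inner_zero_left]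

variable [FiniteDimensional ℂ H]

/-- Range and kernel of `p` are orthogonal, so in `p[A, B]` only the rank-one operators between `u`
and `u'` survive, and the trace of `|u⟩⟨u'|` is `⟨u', u⟩`. -/
theorem omegaForm_hermPair {p : ZeroSection H n} {u w u' w' : H} (hu : p.1.op u = u)
    (hw : p.1.op w = 0) (hu' : p.1.op u' = u') (hw' : p.1.op w' = 0) (α β : ℂ) :
    omegaForm n p.1.op (hermPair α u w) (hermPair β u' w') = Complex.I * ((n : ℂ)⁻¹ *
      (starRingEnd ℂ α * β * inner ℂ w w' * inner ℂ u' u -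
        starRingEnd ℂ β * α * inner ℂ w' w * inner ℂ u u')) := by
  have h : p.1.op * (hermPair α u w * hermPair β u' w' - hermPair β u' w' * hermPair α u w) =
      (starRingEnd ℂ α * β * inner ℂ w w') • rankOne ℂ u u' -
        (starRingEnd ℂ β * α * inner ℂ w' w) • rankOne ℂ u' u := by
    ext v
    simp only [hermPair, mul_apply_eq_comp, sub_apply, add_apply, smul_apply,
      rankOne_apply, map_sub, map_add, map_smul, hu, hw, hu', hw',
      inner_eq_zero_of_fixed hu hw', inner_eq_zero_of_fixed hu' hw, inner_eq_zero_of_fixed' hu hw',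
      inner_eq_zero_of_fixed' hu' hw]
    module
  rw [omegaForm, normTrace, h, ContinuousLinearMap.toLinearMap_sub,
    ContinuousLinearMap.toLinearMap_smul, ContinuousLinearMap.toLinearMap_smul, map_sub, map_smul,
    map_smul, trace_rankOne, trace_rankOne, smul_eq_mul, smul_eq_mul]

variable [CompleteSpace H]

omit [FiniteDimensional ℂ H] in
theorem hermPair_mem {p : ZeroSection H n} {u w : H} (hu : p.1.op u = u)
    (hw : p.1.op w = 0) (α : ℂ) : hermPair α u w ∈ hermTangent p.1.op := by
  refine mem_hermTangent.2 ⟨?_, ?_⟩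
  · ext v
    simp only [hermPair, mul_apply_eq_comp, add_apply, smul_apply, rankOne_apply,
      map_add, map_smul, hu, hw, inner_op_of_fixed hu, inner_op_of_ker hw]
    module
  · rw [hermPair, star_add, star_smul, star_smul, ContinuousLinearMap.star_eq_adjoint,
      ContinuousLinearMap.star_eq_adjoint, adjoint_rankOne, adjoint_rankOne, add_comm]
    simp

/-- For orthonormal bases `b` of the range and `d` of the kernel, the operators `hermPair 1 b_i d_j`
and `hermPair i b_i d_j` are symplectic pairs, `n (dim H - n)` of them, mutually orthogonal for `Ω`.
-/
theorem exists_symplectic_tuple (hn : n ≠ 0) (p : ZeroSection H n) :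
    ∃ v : Fin (halfDim H n) × Fin 2 → hermTangent p.1.op,
      wedgePow (fun x y => omegaLin n p.1.op (v x) (v y)) (halfDim H n) id ≠ 0 := by
  let b := (stdOrthonormalBasis ℂ (Taut p.1)).reindex (finCongr (finrank_fib p.1))
  let d := (stdOrthonormalBasis ℂ (LinearMap.ker (p.1.op : H →ₗ[ℂ] H))).reindex
    (finCongr (finrank_coker p.1))
  have hb : ∀ i, p.1.op (b i : H) = b i := fun i => (b i).2
  have hd : ∀ i, p.1.op (d i : H) = 0 := fun i => (d i).2
  have hbb : ∀ i j, inner ℂ (b i : H) (b j : H) = if i = j then 1 else 0 := fun i j =>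
    orthonormal_iff_ite.1 b.orthonormal i j
  have hdd : ∀ i j, inner ℂ (d i : H) (d j : H) = if i = j then 1 else 0 := fun i j =>
    orthonormal_iff_ite.1 d.orthonormal i j
  let f : Fin (halfDim H n) → Fin n × Fin (Module.finrank ℂ H - n) := finProdFinEquiv.symm
  refine ⟨fun x => ⟨_, hermPair_mem (hb (f x.1).1) (hd (f x.1).2)
    (if x.2 = 0 then 1 else Complex.I)⟩, ?_⟩
  have hom : ∀ (i j : Fin (halfDim H n)) (α β : ℂ),
      omegaLin n p.1.op (hermPair α (b (f i).1 : H) (d (f i).2)) (hermPair β (b (f j).1 : H) (d (f j).2)) =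
      if i = j then Complex.I * ((n : ℂ)⁻¹ * (starRingEnd ℂ α * β - starRingEnd ℂ β * α)) else 0 := by
    intro i j α β
    rw [omegaLin_apply, omegaForm_hermPair (hb _) (hd _) (hb _) (hd _), hbb, hbb, hdd, hdd]
    by_cases hij : i = j
    · simp [hij]
    · have : ¬ ((f i).1 = (f j).1 ∧ (f i).2 = (f j).2) := fun h =>
        hij (finProdFinEquiv.symm.injective (Prod.ext h.1 h.2))
      rw [if_neg hij]
      by_cases h1 : (f i).1 = (f j).1
      · have h2 : (f i).2 ≠ (f j).2 := fun h => this ⟨h1, h⟩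
        simp [h2, h2.symm]
      · simp [h1, Ne.symm h1]
  -- The constant is the value of `Ω` for `α = 1`, `β = i`; it equals `-2/n`.
  refine wedgePow_symplectic_ne_zero (c := Complex.I * ((n : ℂ)⁻¹ * (Complex.I + Complex.I)))
    ?_ ?_ ?_ ?_ ?_
  · simp [hn, ← two_mul]
  all_goals
    intro i j
    simp only [id, hom]
    by_cases hij : i = j <;> simp [hij]
  ring

theorem topDensity_param_ne_zero (hn : n ≠ 0) (p : ZeroSection H n) :
    topDensity (fun x => (param p x).1.op) 0 ≠ 0 := by
  have hF : HasFDerivAt (fun x => (param p x).1.op)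
      ((((tangentSubmodule p.1.op).subtypeL ∘L (tangentVec p.1 : Model H n →L[ℂ] _)).restrictScalars
        ℝ) ∘L hermModel p) 0 := by
    simp only [param_op]
    have h := (hasFDerivAt_chartInv p.1).restrictScalars ℝ
    rw [← map_zero (hermModel p)] at h
    exact h.comp 0 (hermModel p).hasFDerivAt
  have hF' : ∀ x, fderiv ℝ (fun x => (param p x).1.op) 0 x = hermVec p x := fun x => by
    rw [hF.fderiv]
    exact tangentVec_hermModel p x
  let f := (wedgeAlt (omegaLin n p.1.op) (halfDim H n)).compLinearMap (hermTangent p.1.op).subtype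
  let e := (Pi.basisFun ℝ (Fin (halfDim H n) × Fin 2)).map (hermVec p).toLinearEquiv
  obtain ⟨v, hv⟩ := exists_symplectic_tuple hn p
  intro h0
  have hfe : f e = 0 := by
    rw [topDensity, param_zero] at h0
    refine Eq.trans ?_ h0
    rw [AlternatingMap.compLinearMap_apply, wedgeAlt_apply]
    congr 1
    funext j
    rw [hF']
    simp [e]
  -- An alternating map of top degree is determined by its value on one basis: distinct arguments
  -- from the basis are a permutation of it. Then `f` would also vanish on the symplectic tuple.
  have hf0 : f = 0 := by
    refine Module.Basis.ext_alternating e fun w hw => ?_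
    obtain ⟨s, hs⟩ : ∃ s : Equiv.Perm (Fin (halfDim H n) × Fin 2), ∀ j, w j = s j :=
      ⟨Equiv.ofBijective w (Finite.injective_iff_bijective.1 hw), fun _ => rfl⟩
    have h : (fun i => e (w i)) = e ∘ s := funext fun i => by rw [hs]; rfl
    rw [h, f.map_perm, hfe]
    simp
  apply hv
  have h1 : f v = 0 := by rw [hf0]; rfl
  rw [AlternatingMap.compLinearMap_apply, wedgeAlt_apply] at h1
  exact h1

omit [CompleteSpace H] in
/-- A subspace of dimension `n` defines a point of the zero section. -/
theorem nonempty_zeroSection (hnH : n ≤ Module.finrank ℂ H) : Nonempty (ZeroSection H n) := by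
  let K := Submodule.span ℂ (Set.range (stdOrthonormalBasis ℂ H ∘ Fin.castLE hnH))
  have hK : Module.finrank ℂ K = n := by
    have h := finrank_span_eq_card ((stdOrthonormalBasis ℂ H).orthonormal.linearIndependent.comp _
      (Fin.castLE_injective hnH))
    rwa [Fintype.card_fin] at h
  refine ⟨⟨⟨K.starProjection, K.isIdempotentElem_starProjection, ?_⟩,
    K.starProjection_isSymmetric⟩⟩
  have h : LinearMap.IsProj K (K.starProjection : H →ₗ[ℂ] H) :=
    ⟨fun v => K.starProjection_apply_mem v, fun v hv => Submodule.starProjection_eq_self_iff.2 hv⟩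
  rw [h.trace, hK]

end Nondegenerate

/-! ### Unitary invariance and the resolution of the identity -/

section Averaging

open MeasureTheory

variable {H : Type*} [NormedAddCommGroup H] [InnerProductSpace ℂ H] [FiniteDimensional ℂ H]
  [CompleteSpace H] {n : ℕ}

/-- Conjugation by a unitary operator, on `B(H)`. -/
def conjOp (u : unitary (H →L[ℂ] H)) : (H →L[ℂ] H) →L[ℂ] (H →L[ℂ] H) :=
  ContinuousLinearMap.mulLeftRight ℂ (H →L[ℂ] H) u (star u : unitary (H →L[ℂ] H))

omit [FiniteDimensional ℂ H] in
theorem conjOp_apply (u : unitary (H →L[ℂ] H)) (A : H →L[ℂ] H) :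
    conjOp u A = (u : H →L[ℂ] H) * A * star (u : H →L[ℂ] H) := rfl

omit [FiniteDimensional ℂ H] in
theorem conjOp_mul (u : unitary (H →L[ℂ] H)) (A B : H →L[ℂ] H) :
    conjOp u (A * B) = conjOp u A * conjOp u B := by
  have h := Unitary.coe_star_mul_self u
  calc conjOp u (A * B) = u * A * 1 * B * star (u : H →L[ℂ] H) := by
        rw [conjOp_apply]; noncomm_ring
    _ = _ := by rw [← h, conjOp_apply, conjOp_apply]; noncomm_ring

omit [FiniteDimensional ℂ H] in
theorem conjOp_star_conjOp (u : unitary (H →L[ℂ] H)) (A : H →L[ℂ] H) :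
    conjOp (star u) (conjOp u A) = A := by
  have h := Unitary.coe_star_mul_self u
  rw [conjOp_apply, conjOp_apply, Unitary.coe_star, star_star]
  calc _ = (star (u : H →L[ℂ] H) * u) * A * (star (u : H →L[ℂ] H) * u) := by noncomm_ring
    _ = A := by rw [h, one_mul, mul_one]

omit [FiniteDimensional ℂ H] in
theorem trace_conjOp (u : unitary (H →L[ℂ] H)) (A : H →L[ℂ] H) :
    LinearMap.trace ℂ H (conjOp u A : H →L[ℂ] H) = LinearMap.trace ℂ H (A : H →ₗ[ℂ] H) := by
  rw [conjOp_apply, ContinuousLinearMap.toLinearMap_mul, LinearMap.trace_mul_comm,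
    ← ContinuousLinearMap.toLinearMap_mul, ← mul_assoc, Unitary.coe_star_mul_self, one_mul]

omit [FiniteDimensional ℂ H] in
theorem omegaForm_conjOp (u : unitary (H →L[ℂ] H)) (q A B : H →L[ℂ] H) :
    omegaForm n (conjOp u q) (conjOp u A) (conjOp u B) = omegaForm n q A B := by
  rw [omegaForm, normTrace, ← conjOp_mul, ← conjOp_mul, ← map_sub, ← conjOp_mul, trace_conjOp]
  rfl

/-- Conjugation by a unitary operator, on the zero section. -/
def conjZero (u : unitary (H →L[ℂ] H)) (q : ZeroSection H n) : ZeroSection H n :=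
  ⟨⟨conjOp u q.1.op, by rw [← conjOp_mul, q.1.idem], by rw [trace_conjOp, q.1.trace_op]⟩,
    hermitian_of_star (by
      change star (conjOp u q.1.op) = conjOp u q.1.op
      rw [conjOp_apply, star_mul, star_mul, star_star, star_op, mul_assoc])⟩

omit [FiniteDimensional ℂ H] in
theorem continuous_conjZero (u : unitary (H →L[ℂ] H)) :
    Continuous (conjZero u : ZeroSection H n → ZeroSection H n) :=
  isEmbedding_zeroSection.isInducing.continuous_iff.2
    ((conjOp u).continuous.comp isEmbedding_zeroSection.continuous)

omit [FiniteDimensional ℂ H] in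
theorem conjZero_star_conjZero (u : unitary (H →L[ℂ] H)) (q : ZeroSection H n) :
    conjZero (star u) (conjZero u q) = q :=
  isEmbedding_zeroSection.injective (conjOp_star_conjOp u q.1.op)

omit [FiniteDimensional ℂ H] in
theorem conjZero_conjZero_star (u : unitary (H →L[ℂ] H)) (q : ZeroSection H n) :
    conjZero u (conjZero (star u) q) = q := by
  simpa using conjZero_star_conjZero (star u) q

/-- Conjugation by a unitary operator, as an automorphism of the zero section. -/
def conjEquiv (u : unitary (H →L[ℂ] H)) : ZeroSection H n ≃ᵐ ZeroSection H n where
  toFun := conjZero u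
  invFun := conjZero (star u)
  left_inv := conjZero_star_conjZero u
  right_inv := conjZero_conjZero_star u
  measurable_toFun := (continuous_conjZero u).measurable
  measurable_invFun := (continuous_conjZero (star u)).measurable

omit [FiniteDimensional ℂ H] in
theorem fderiv_conjOp_comp (u : unitary (H →L[ℂ] H)) {F : Coord H n → H →L[ℂ] H} {x : Coord H n}
    (hF : DifferentiableAt ℝ F x) (v : Coord H n) :
    fderiv ℝ (fun x => conjOp u (F x)) x v = conjOp u (fderiv ℝ F x v) := by
  have h := (((conjOp u).restrictScalars ℝ).hasFDerivAt.comp x hF.hasFDerivAt).fderiv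
  exact DFunLike.congr_fun h v

omit [FiniteDimensional ℂ H] in
theorem IsParam.conjZero_comp {U : Set (Coord H n)} {ψ : Coord H n → ZeroSection H n}
    (hψ : IsParam U ψ) (u : unitary (H →L[ℂ] H)) : IsParam U (conjZero u ∘ ψ) where
  isOpen := hψ.isOpen
  contDiffOn := ((conjOp u).restrictScalars ℝ).contDiff.comp_contDiffOn hψ.contDiffOn
  injOn := (Function.LeftInverse.injective (conjZero_star_conjZero u)).comp_injOn hψ.injOn
  injective_fderiv x hx v w hvw := by
    have h := (hψ.contDiffOn.contDiffAt (hψ.isOpen.mem_nhds hx)).differentiableAt (by simp)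
    change fderiv ℝ (fun x => conjOp u (ψ x).1.op) x v =
      fderiv ℝ (fun x => conjOp u (ψ x).1.op) x w at hvw
    rw [fderiv_conjOp_comp u h, fderiv_conjOp_comp u h] at hvw
    exact hψ.injective_fderiv x hx
      (Function.LeftInverse.injective (conjOp_star_conjOp u) hvw)

omit [FiniteDimensional ℂ H] in
theorem topDensity_conjOp (u : unitary (H →L[ℂ] H)) {F : Coord H n → H →L[ℂ] H} {x : Coord H n}
    (hF : DifferentiableAt ℝ F x) :
    topDensity (fun x => conjOp u (F x)) x = topDensity F x := by
  simp only [topDensity, wedgePow, fderiv_conjOp_comp u hF, omegaForm_conjOp]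

omit [FiniteDimensional ℂ H] in
-- Conjugation is linear on `B(H)` and preserves `Ω`, so moving a parametrization by `u*` keeps its
-- density. Invariance of the measure then follows from uniqueness.
theorem IsTopMeasure.map_conjEquiv {μ : Measure (ZeroSection H n)} (h : IsTopMeasure μ)
    (u : unitary (H →L[ℂ] H)) : IsTopMeasure (μ.map (conjEquiv u)) := by
  refine isTopMeasure_iff.2 fun U ψ hψ S hSU hS => ?_
  have himg : conjEquiv u ⁻¹' (ψ '' S) = (conjZero (star u) ∘ ψ) '' S := by
    rw [Set.image_comp]
    exact (congrFun (Set.image_eq_preimage_of_inverse (conjZero_conjZero_star u)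
      (conjZero_star_conjZero u)) (ψ '' S)).symm
  rw [MeasurableEquiv.map_apply, himg,
    isTopMeasure_iff.1 h U _ (hψ.conjZero_comp (star u)) S hSU hS]
  refine setLIntegral_congr_fun hS fun x hx => ?_
  have hd := (hψ.contDiffOn.contDiffAt (hψ.isOpen.mem_nhds (hSU hx))).differentiableAt (by simp)
  exact congrArg _ (topDensity_conjOp (star u) hd)

theorem IsTopMeasure.map_conjEquiv_eq {μ : Measure (ZeroSection H n)} (h : IsTopMeasure μ)
    (u : unitary (H →L[ℂ] H)) : μ.map (conjEquiv u) = μ :=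
  h.ext (h.map_conjEquiv u)

omit [CompleteSpace H] in
theorem integrable_of_continuous {E : Type*} [NormedAddCommGroup E] {μ : Measure (ZeroSection H n)}
    [IsFiniteMeasure μ] {f : ZeroSection H n → E} (hf : Continuous f) : Integrable f μ :=
  hf.integrable_of_hasCompactSupport (HasCompactSupport.of_compactSpace f)

omit [FiniteDimensional ℂ H] [CompleteSpace H] in
theorem continuous_zeroSection_op : Continuous fun q : ZeroSection H n => q.1.op :=
  isEmbedding_zeroSection.continuous

omit [FiniteDimensional ℂ H] in
/-- An operator that commutes with all unitary operators is scalar. -/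
theorem eq_smul_one_of_commute_unitary {T : H →L[ℂ] H}
    (hT : ∀ u : unitary (H →L[ℂ] H), (u : H →L[ℂ] H) * T = T * u) :
    ∃ c : ℂ, T = c • 1 := by
  have hall : ∀ A : H →L[ℂ] H, A * T = T * A := by
    intro A
    -- A unital C⋆-algebra is spanned by its unitaries.
    have hA : A ∈ Submodule.span ℂ (unitary (H →L[ℂ] H) : Set (H →L[ℂ] H)) := by
      rw [CStarAlgebra.span_unitary]; trivial
    induction hA using Submodule.span_induction with
    | mem x hx => exact hT ⟨x, hx⟩
    | zero => simp
    | add x y _ _ hx hy => rw [add_mul, mul_add, hx, hy]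
    | smul c x _ hx => rw [smul_mul_assoc, mul_smul_comm, hx]
  rcases subsingleton_or_nontrivial H with hH | hH
  · exact ⟨0, by ext v; exact Subsingleton.elim _ _⟩
  -- Commutation with `|x⟩⟨y|`, evaluated at the unit vector `y`, reads `⟨y, Ty⟩ x = Tx`.
  · obtain ⟨y, hy⟩ := exists_norm_eq H (zero_le_one (α := ℝ))
    refine ⟨inner ℂ y (T y), ContinuousLinearMap.ext fun x => ?_⟩
    have h := DFunLike.congr_fun (hall (InnerProductSpace.rankOne ℂ x y)) y
    simp only [mul_apply_eq_comp, InnerProductSpace.rankOne_apply, map_smul] at h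
    rw [inner_self_eq_norm_sq_to_K, hy] at h
    simpa using h.symm

/-- Invariance of the measure makes the integral commute with every unitary, so it is a scalar `c`;
since every `q` has trace `n`, `c · dim H = n · μ(G_n H)`. -/
theorem IsTopMeasure.integral_op {μ : Measure (ZeroSection H n)} (h : IsTopMeasure μ)
    (hH : Module.finrank ℂ H ≠ 0) : ∫ q : ZeroSection H n, q.1.op ∂μ =
      ((μ.real Set.univ * n / Module.finrank ℂ H : ℝ) : ℂ) • 1 := by
  have : IsFiniteMeasure μ := ⟨h.measure_univ_ne_top.lt_top⟩
  have hint : Integrable (fun q : ZeroSection H n => q.1.op) μ :=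
    integrable_of_continuous continuous_zeroSection_op
  obtain ⟨c, hc⟩ := eq_smul_one_of_commute_unitary (T := ∫ q : ZeroSection H n, q.1.op ∂μ) (by
    intro u
    have h1 : conjOp u (∫ q : ZeroSection H n, q.1.op ∂μ) = ∫ q : ZeroSection H n, q.1.op ∂μ := by
      rw [← (conjOp u).integral_comp_comm hint]
      have h2 := integral_map_equiv (μ := μ) (conjEquiv u) fun q : ZeroSection H n => q.1.op
      rw [h.map_conjEquiv_eq] at h2
      exact h2.symm
    rw [conjOp_apply] at h1
    nth_rewrite 2 [← h1]
    rw [mul_assoc _ (star (u : H →L[ℂ] H)), Unitary.coe_star_mul_self, mul_one])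
  have htr := congrArg (fun A : H →L[ℂ] H => LinearMap.trace ℂ H (A : H →ₗ[ℂ] H)) hc
  have hT := ContinuousLinearMap.integral_comp_comm (LinearMap.toContinuousLinearMap
    (LinearMap.trace ℂ H ∘ₗ ContinuousLinearMap.coeLM ℂ)) hint
  have hT' : ∫ _ : ZeroSection H n, (n : ℂ) ∂μ = LinearMap.trace ℂ H
      ((∫ q : ZeroSection H n, q.1.op ∂μ : H →L[ℂ] H) : H →ₗ[ℂ] H) :=
    (integral_congr_ae (.of_forall fun q => q.1.trace_op.symm)).trans hT
  rw [integral_const] at hT'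
  have h1 : LinearMap.trace ℂ H ((c • (1 : H →L[ℂ] H) : H →L[ℂ] H) : H →ₗ[ℂ] H) =
      c * Module.finrank ℂ H := by
    rw [ContinuousLinearMap.toLinearMap_smul, map_smul, smul_eq_mul,
      ContinuousLinearMap.toLinearMap_one, LinearMap.trace_one]
  rw [hc] at hT' ⊢
  rw [h1] at hT'
  have hH' : (Module.finrank ℂ H : ℂ) ≠ 0 := Nat.cast_ne_zero.2 hH
  congr 1
  push_cast
  rw [eq_div_iff hH', ← hT', Complex.real_smul]

/-- The resolution of the identity. It is the only property of the normalized measure, besides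
finiteness, that the quantization uses. -/
theorem IsTopMeasure.integral_op_normalized {μ : Measure (ZeroSection H n)} (h : IsTopMeasure μ)
    (hn : n ≠ 0) (hH : Module.finrank ℂ H ≠ 0) (h0 : μ Set.univ ≠ 0) :
    ∫ q : ZeroSection H n, q.1.op ∂(normalized μ) = 1 := by
  have h1 : μ.real Set.univ ≠ 0 := ENNReal.toReal_ne_zero.2 ⟨h0, h.measure_univ_ne_top⟩
  have hH' : (Module.finrank ℂ H : ℝ) ≠ 0 := Nat.cast_ne_zero.2 hH
  have hn' : (n : ℝ) ≠ 0 := Nat.cast_ne_zero.2 hn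
  rw [normalized, integral_smul_measure, h.integral_op hH, ENNReal.toReal_ofReal (by positivity),
    ← Complex.coe_smul, smul_smul, ← Complex.ofReal_mul]
  have : (Module.finrank ℂ H : ℝ) / (n * μ.real Set.univ) *
      (μ.real Set.univ * n / Module.finrank ℂ H) = 1 := by
    field_simp
  rw [← Measure.real, this, Complex.ofReal_one, one_smul]

omit [FiniteDimensional ℂ H] [CompleteSpace H] in
theorem isFiniteMeasure_normalized {μ : Measure (ZeroSection H n)} (h : μ Set.univ ≠ ⊤) :
    IsFiniteMeasure (normalized μ) :=
  ⟨by
    rw [normalized, Measure.smul_apply, smul_eq_mul]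
    exact ENNReal.mul_lt_top ENNReal.ofReal_lt_top h.lt_top⟩

end Averaging

/-! ### Idempotency of `P` and the Hilbert space -/

section Quantization

open MeasureTheory

variable {H : Type*} [NormedAddCommGroup H] [InnerProductSpace ℂ H] [FiniteDimensional ℂ H]
  [CompleteSpace H] {n : ℕ}

omit [CompleteSpace H] in
theorem integrable_propagator_comp (ν : Measure (ZeroSection H n)) [IsFiniteMeasure ν]
    (q₁ q₂ : CotGr H n) :
    Integrable (fun q : ZeroSection H n => propagator q.1 q₂ ∘L propagator q₁ q.1) ν := by
  have h : Continuous fun q : ZeroSection H n => toFib q₂ ∘L q.1.op ∘L (fib q₁.op).subtypeL :=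
    continuous_const.clm_comp (continuous_zeroSection_op.clm_comp continuous_const)
  exact integrable_of_continuous h

omit [FiniteDimensional ℂ H] in
theorem integral_clm_comp_comp {E F X : Type*} [NormedAddCommGroup E] [NormedSpace ℂ E]
    [NormedAddCommGroup F] [NormedSpace ℂ F] [CompleteSpace F]
    [MeasurableSpace X] {ν : Measure X} (A : H →L[ℂ] F) (B : E →L[ℂ] H)
    {f : X → H →L[ℂ] H} (hf : Integrable f ν) :
    ∫ x, A ∘L f x ∘L B ∂ν = A ∘L (∫ x, f x ∂ν) ∘L B :=
  (ContinuousLinearMap.compL ℂ E H F A ∘L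
    (ContinuousLinearMap.compL ℂ E H H).flip B).integral_comp_comm hf

/-- The integrand is `q₂ q` on the fibre at `q₁`; the fixed maps come out of the integral and `∫ q
dν = 1` remains. -/
theorem convolve_propagator {ν : Measure (ZeroSection H n)} [IsFiniteMeasure ν]
    (hν : ∫ q : ZeroSection H n, q.1.op ∂ν = 1) (q₁ q₂ : CotGr H n) :
    convolve ν propagator propagator q₁ q₂ = propagator q₁ q₂ := by
  have h := integral_clm_comp_comp (toFib q₂) (fib q₁.op).subtypeL
    (integrable_of_continuous (μ := ν) (continuous_zeroSection_op (H := H) (n := n)))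
  rw [hν] at h
  exact h

/-- The holomorphic section `q ↦ q Ψ`. -/
def vectorSection : H →ₗ[ℂ] HolSection H n where
  toFun Ψ := ⟨fun q => toFib q Ψ, fun _ => contMDiffAt_section_iff.2
    (contMDiff_op.contMDiffAt.clm_apply contMDiffAt_const)⟩
  map_add' Ψ₁ Ψ₂ := by
    ext q
    exact congrArg Subtype.val (map_add (toFib q) Ψ₁ Ψ₂)
  map_smul' c Ψ := by
    ext q
    exact congrArg Subtype.val (map_smul (toFib q) c Ψ)

omit [CompleteSpace H] in
theorem continuous_section (ψ : HolSection H n) :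
    Continuous fun q : ZeroSection H n => (ψ q.1 : H) := by
  have h : ContMDiff 𝓘(ℂ, Model H n) 𝓘(ℂ, H) ω fun q : CotGr H n => (ψ q : H) :=
    fun q => contMDiffAt_section_iff.1 (ψ.contMDiff q)
  exact h.continuous.comp continuous_subtype_val

/-- The integral of a section over the zero section. -/
def sectionIntegral (ν : Measure (ZeroSection H n)) [IsFiniteMeasure ν] :
    HolSection H n →ₗ[ℂ] H where
  toFun ψ := ∫ q : ZeroSection H n, (ψ q.1 : H) ∂ν
  map_add' ψ₁ ψ₂ := integral_add (integrable_of_continuous (continuous_section ψ₁))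
    (integrable_of_continuous (continuous_section ψ₂))
  map_smul' c ψ := integral_smul c fun q : ZeroSection H n => (ψ q.1 : H)

/-- The resolution of the identity applied to `Ψ`. This one-sided inverse is what makes
`kernelOperator` a projection onto a copy of `H`. -/
theorem sectionIntegral_vectorSection {ν : Measure (ZeroSection H n)} [IsFiniteMeasure ν]
    (hν : ∫ q : ZeroSection H n, q.1.op ∂ν = 1) (Ψ : H) :
    sectionIntegral ν (vectorSection Ψ) = Ψ := by
  have hint : Integrable (fun q : ZeroSection H n => q.1.op) ν :=
    integrable_of_continuous continuous_zeroSection_op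
  have h := (ContinuousLinearMap.apply ℂ H Ψ).integral_comp_comm hint
  rw [hν] at h
  exact h

/-- The operator on sections with the kernel `P`. -/
def kernelOperator (ν : Measure (ZeroSection H n)) [IsFiniteMeasure ν] :
    HolSection H n →ₗ[ℂ] HolSection H n :=
  vectorSection ∘ₗ sectionIntegral ν

omit [CompleteSpace H] in
theorem integrable_propagator_apply (ν : Measure (ZeroSection H n)) [IsFiniteMeasure ν]
    (ψ : HolSection H n) (q : CotGr H n) :
    Integrable (fun q' : ZeroSection H n => propagator q'.1 q (ψ q'.1)) ν :=
  integrable_of_continuous ((toFib q).continuous.comp (continuous_section ψ))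

/-- `P(q', q)ψ(q') = qψ(q')` with `q` fixed, so `q` comes out of the integral; this justifies the
factorization through `H`. -/
theorem kernelOperator_apply (ν : Measure (ZeroSection H n)) [IsFiniteMeasure ν]
    (ψ : HolSection H n) (q : CotGr H n) :
    kernelOperator ν ψ q = ∫ q' : ZeroSection H n, propagator q'.1 q (ψ q'.1) ∂ν := by
  have hint : Integrable (fun q : ZeroSection H n => (ψ q.1 : H)) ν :=
    integrable_of_continuous (continuous_section ψ)
  exact ((toFib q).integral_comp_comm hint).symm

theorem kernelOperator_comp {ν : Measure (ZeroSection H n)} [IsFiniteMeasure ν]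
    (hν : ∫ q : ZeroSection H n, q.1.op ∂ν = 1) :
    kernelOperator ν ∘ₗ kernelOperator ν = kernelOperator ν :=
  LinearMap.ext fun ψ => congrArg vectorSection
    (sectionIntegral_vectorSection hν (sectionIntegral ν ψ))

/-- The identification of `H` with the image of the operator with kernel `P`. -/
def vectorSectionEquiv {ν : Measure (ZeroSection H n)} [IsFiniteMeasure ν]
    (hν : ∫ q : ZeroSection H n, q.1.op ∂ν = 1) :
    H ≃ₗ[ℂ] LinearMap.range (kernelOperator ν) where
  toFun Ψ := ⟨vectorSection Ψ, vectorSection Ψ,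
    congrArg vectorSection (sectionIntegral_vectorSection hν Ψ)⟩
  map_add' Ψ₁ Ψ₂ := Subtype.ext (map_add vectorSection Ψ₁ Ψ₂)
  map_smul' c Ψ := Subtype.ext (map_smul vectorSection c Ψ)
  invFun ψ := sectionIntegral ν ψ.1
  left_inv := sectionIntegral_vectorSection hν
  right_inv := by
    rintro ⟨_, φ, rfl⟩
    exact Subtype.ext (LinearMap.congr_fun (kernelOperator_comp hν) φ)

omit [CompleteSpace H] in
theorem integrable_inner (ν : Measure (ZeroSection H n)) [IsFiniteMeasure ν]
    (ψ₁ ψ₂ : HolSection H n) :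
    Integrable (fun q : ZeroSection H n => inner ℂ (ψ₁ q.1) (ψ₂ q.1)) ν :=
  integrable_of_continuous ((continuous_section ψ₁).inner (continuous_section ψ₂))

/-- Each `q` is a Hermitian idempotent, so `⟨qΨ₁, qΨ₂⟩ = ⟨Ψ₁, qΨ₂⟩`, and the integral moves inside
the inner product. -/
theorem integral_inner_vectorSection {ν : Measure (ZeroSection H n)} [IsFiniteMeasure ν]
    (hν : ∫ q : ZeroSection H n, q.1.op ∂ν = 1) (Ψ₁ Ψ₂ : H) :
    ∫ q : ZeroSection H n, inner ℂ (vectorSection Ψ₁ q.1) (vectorSection Ψ₂ q.1) ∂ν =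
      inner ℂ Ψ₁ Ψ₂ := by
  have hpt : ∀ q : ZeroSection H n,
      inner ℂ (vectorSection Ψ₁ q.1) (vectorSection Ψ₂ q.1) =
        inner ℂ Ψ₁ (vectorSection Ψ₂ q.1 : H) := fun q =>
    (q.2 _ _).trans (congrArg (inner ℂ Ψ₁) (toFib q.1 Ψ₂).2)
  have hint : Integrable (fun q : ZeroSection H n => (vectorSection Ψ₂ q.1 : H)) ν :=
    integrable_of_continuous (continuous_section _)
  rw [integral_congr_ae (.of_forall hpt), integral_inner hint]
  exact congrArg _ (sectionIntegral_vectorSection hν Ψ₂)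

/-- Transports the integral form to the inner product of `H`, from which all axioms in `rangeCore`,
definiteness included, are inherited. -/
theorem integral_inner_range {ν : Measure (ZeroSection H n)} [IsFiniteMeasure ν]
    (hν : ∫ q : ZeroSection H n, q.1.op ∂ν = 1) (ψ₁ ψ₂ : LinearMap.range (kernelOperator ν)) :
    ∫ q : ZeroSection H n, inner ℂ (ψ₁.1 q.1) (ψ₂.1 q.1) ∂ν =
      inner ℂ ((vectorSectionEquiv hν).symm ψ₁) ((vectorSectionEquiv hν).symm ψ₂) := by
  rw [← integral_inner_vectorSection hν]
  have h : ∀ ψ : LinearMap.range (kernelOperator ν),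
      vectorSection ((vectorSectionEquiv hν).symm ψ) = ψ.1 := fun ψ =>
    congrArg Subtype.val ((vectorSectionEquiv hν).apply_symm_apply ψ)
  rw [h, h]

/-- The inner product `∫ ⟨ψ₁(q), ψ₂(q)⟩ dν(q)` on the image of the operator with kernel `P`. -/
abbrev rangeCore {ν : Measure (ZeroSection H n)} [IsFiniteMeasure ν]
    (hν : ∫ q : ZeroSection H n, q.1.op ∂ν = 1) :
    InnerProductSpace.Core ℂ (LinearMap.range (kernelOperator ν)) where
  inner ψ₁ ψ₂ := ∫ q : ZeroSection H n, inner ℂ (ψ₁.1 q.1) (ψ₂.1 q.1) ∂ν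
  conj_inner_symm ψ₁ ψ₂ := by
    simp only [integral_inner_range hν]
    exact inner_conj_symm _ _
  re_inner_nonneg ψ := by
    simp only [integral_inner_range hν]
    exact inner_self_nonneg (𝕜 := ℂ)
  add_left ψ₁ ψ₂ ψ₃ := by
    simp only [integral_inner_range hν, map_add]
    exact inner_add_left _ _ _
  smul_left ψ₁ ψ₂ c := by
    simp only [integral_inner_range hν, map_smul]
    exact inner_smul_left _ _ _
  definite ψ h := by
    rw [integral_inner_range hν, inner_self_eq_zero] at h
    exact (LinearEquiv.map_eq_zero_iff _).1 h

end Quantization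
end
end GrassCot

/-! ### The main theorem -/

theorem mainTheorem5 {H : Type*} [NormedAddCommGroup H] [InnerProductSpace ℂ H]
    [FiniteDimensional ℂ H] (n : ℕ) (hn : 0 < n) (hnH : n ≤ Module.finrank ℂ H) :
    -- the complexified tautological bundle is a rank `n` holomorphic subbundle
    (ContMDiffVectorBundle ω (FibModel n) (Taut : CotGr H n → Type _) 𝓘(ℂ, Model H n) ∧
      (∀ q : CotGr H n, Module.finrank ℂ (Taut q) = n) ∧
      ContMDiff (𝓘(ℂ, Model H n).prod 𝓘(ℂ, FibModel n)) 𝓘(ℂ, H) ω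
        (fun x : Bundle.TotalSpace (FibModel n) (Taut : CotGr H n → Type _) => (x.snd : H))) ∧
    -- `P` is a holomorphic section of `E* ⊠ E`, equal to the identity on the diagonal
    IsHolKernel (propagator (H := H) (n := n)) ∧
    (∀ q : CotGr H n, propagator q q = ContinuousLinearMap.id ℂ (Taut q)) ∧
    -- the holomorphic connection determined by `P`, polarization, and the curvature
    (∃ D : Connection H n,
      IsInducedBy propagator D ∧
      (∀ U : Set (CotGr H n), IsOpen U → ContMDiffCovariantDerivativeOn (FibModel n) ω D U) ∧
      IsPolarized D propagator ∧
      ∃ R, IsCurvature D R ∧ ∀ (q : CotGr H n) (a b : TangentSpace 𝓘(ℂ, Model H n) q),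
        Complex.I * ((n : ℂ)⁻¹ * LinearMap.trace ℂ (Taut q) (R q a b)) =
          omegaForm n q.op (tangentAt q a) (tangentAt q b)) ∧
    -- the measure `Ω^top` on the zero section, the convolution, and the Hilbert space
    ∃ μ : Measure (ZeroSection H n), IsTopMeasure μ ∧ (∀ μ', IsTopMeasure μ' → μ' = μ) ∧
      μ Set.univ ≠ 0 ∧ μ Set.univ ≠ ⊤ ∧
      (∀ q₁ q₂ : CotGr H n,
        Integrable (fun q : ZeroSection H n => propagator q.1 q₂ ∘L propagator q₁ q.1)
          (normalized μ) ∧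
        convolve (normalized μ) propagator propagator q₁ q₂ = propagator q₁ q₂) ∧
      ∃ Phat : HolSection H n →ₗ[ℂ] HolSection H n,
        (∀ (ψ : HolSection H n) (q : CotGr H n),
          Integrable (fun q' : ZeroSection H n => propagator q'.1 q (ψ q'.1)) (normalized μ) ∧
          Phat ψ q = ∫ q' : ZeroSection H n, propagator q'.1 q (ψ q'.1) ∂(normalized μ)) ∧
        Phat ∘ₗ Phat = Phat ∧
        ∃ c : InnerProductSpace.Core ℂ (LinearMap.range Phat),
          (∀ ψ₁ ψ₂ : LinearMap.range Phat,
            Integrable (fun q : ZeroSection H n => inner ℂ (ψ₁.1 q.1) (ψ₂.1 q.1))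
              (normalized μ) ∧
            c.inner ψ₁ ψ₂ =
              ∫ q : ZeroSection H n, inner ℂ (ψ₁.1 q.1) (ψ₂.1 q.1) ∂(normalized μ)) ∧
          ∃ e : H ≃ₗ[ℂ] LinearMap.range Phat,
            (∀ (Ψ : H) (q : CotGr H n), (((e Ψ).1 q : Taut q) : H) = q.op Ψ) ∧
            ∀ Ψ₁ Ψ₂ : H, c.inner (e Ψ₁) (e Ψ₂) = inner ℂ Ψ₁ Ψ₂ := by
  have : CompleteSpace H := FiniteDimensional.complete ℂ H
  have hn0 : n ≠ 0 := hn.ne'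
  have hH : Module.finrank ℂ H ≠ 0 := by omega
  obtain ⟨μ, hμ⟩ := exists_isTopMeasure H n
  -- Positivity of the total mass needs a point of the zero section, which exists because `n ≤ dim
  -- H`.
  obtain ⟨p⟩ := nonempty_zeroSection (H := H) hnH
  have h0 : μ Set.univ ≠ 0 := hμ.measure_univ_ne_zero (topDensity_param_ne_zero hn0 p)
  have hfin := isFiniteMeasure_normalized hμ.measure_univ_ne_top
  have hν := hμ.integral_op_normalized hn0 hH h0
  refine ⟨⟨inferInstance, finrank_fib, contMDiff_snd⟩, isHolKernel_propagator, propagator_self,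
    ⟨tautConnection H n, isInducedBy_tautConnection,
      fun U hU => contMDiffCovariantDerivativeOn_tautConnection hU, isPolarized_propagator,
      tautCurvature, isCurvature_tautCurvature, trace_tautCurvature⟩,
    μ, hμ, fun μ' h' => hμ.ext h', h0, hμ.measure_univ_ne_top,
    fun q₁ q₂ => ⟨integrable_propagator_comp _ q₁ q₂, convolve_propagator hν q₁ q₂⟩,
    kernelOperator (normalized μ),
    fun ψ q => ⟨integrable_propagator_apply _ ψ q, kernelOperator_apply _ ψ q⟩,
    kernelOperator_comp hν, rangeCore hν, fun ψ₁ ψ₂ => ⟨integrable_inner _ _ _, rfl⟩,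
    vectorSectionEquiv hν, fun Ψ q => rfl, integral_inner_vectorSection hν⟩
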